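/- Let $N\ge 1$, let $\Omega\subseteq\mathbb R^N$ be a bounded domain with $C^2$-boundary, let $1<p<\infty$, and put $p^*=\frac{Np}{N-p}$ if $p<N$, $p^*=+\infty$ if $p\ge N$. Let $W^{1,p}_0(\Omega)$ be the closure of $C_c^\infty(\Omega)$ in the Sobolev norm $(\|u\|_{L^p}^p+\|\nabla u\|_{L^p}^p)^{1/p}$ (equivalent there to $\|\nabla u\|_{L^p}$ by Poincaré's inequality), and let $\hat\lambda_1(p)$ be the smallest eigenvalue of the Dirichlet $p$-Laplacian on $\Omega$, i.e. the smallest $\lambda$ for which $-\Delta_pu=\lambda|u|^{p-2}u$ has a nontrivial weak solution in $W^{1,p}_0(\Omega)$. Let $\vartheta\in C^1(0,\infty)$ and constants $\hat c,c_0,c_1,c_2>0$ be such that, for all $t>0$, $$\hat c\le \frac{t\vartheta'(t)}{\vartheta(t)}\le c_0,\qquad c_1t^{p-1}\le\vartheta(t)\le c_2(1+t^{p-1}).$$ Hypotheses $H(a)_1$: $a(\xi)=a_0(\|\xi\|)\xi$ for $\xi\in\mathbb R^N$, with $a_0(t)>0$ for all $t>0$, and with $G_0(t)=\int_0^t s\,a_0(s)\,ds$,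 (i) $a_0\in C^1(0,\infty)$, $t\mapsto ta_0(t)$ is strictly increasing on $(0,\infty)$, $\lim_{t\to0^+}ta_0(t)=0$, and $\lim_{t\to0^+}\frac{ta_0'(t)}{a_0(t)}$ exists and is $>-1$; (ii) $\|\nabla a(\xi)\|\le c_3\frac{\vartheta(\|\xi\|)}{\|\xi\|}$ for all $\xi\ne0$ and some $c_3>0$; (iii) $(\nabla a(\xi)y,y)\ge\frac{\vartheta(\|\xi\|)}{\|\xi\|}\|y\|^2$ for all $\xi\neq0$ and all $y\in\mathbb R^N$; (iv) $pG_0(t)-t^2a_0(t)\ge-c_6$ and $t^2a_0(t)-G_0(t)\ge\hat\eta t^p$ for all $t>0$ and some $c_6,\hat\eta>0$. Hypotheses $H(f)_1$: $f:\Omega\times\mathbb R\to\mathbb R$ is a Carathéodory function (measurable in $x$ for every $s$, continuous in $s$ for a.a. $x$) with $f(x,0)=0$ for a.a. $x\in\Omega$, and with $F(x,s)=\int_0^sf(x,t)\,dt$, (i) $|f(x,s)|\le\alpha(x)(1+|s|^{r-1})$ for a.a. $x\in\Omega$ and all $s\in\mathbb R$, with $0\le\alpha\in L^\infty(\Omega)$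 and $p<r<p^*$; (ii) $\lim_{s\to\pm\infty}\frac{F(x,s)}{|s|^p}=+\infty$ uniformly for a.a. $x\in\Omega$; (iii) there are $\tau\in\left((r-p)\max\{\frac Np,1\},p^*\right)$ and $\beta_0>0$ with $\liminf_{s\to\pm\infty}\frac{f(x,s)s-pF(x,s)}{|s|^\tau}\ge\beta_0$ uniformly for a.a. $x\in\Omega$; (iv) there is $0\le\eta\in L^\infty(\Omega)$ with $\eta\le\frac{c_1}{p-1}\hat\lambda_1(p)$ a.e. in $\Omega$, $\eta$ not a.e. equal to $\frac{c_1}{p-1}\hat\lambda_1(p)$, and $\limsup_{s\to0}\frac{pF(x,s)}{|s|^p}\le\eta(x)$ uniformly for a.a. $x\in\Omega$; (v) for every $\varrho>0$ there is $\kappa_\varrho>0$ with $f(x,s)s+\kappa_\varrho|s|^p\ge0$ for a.a. $x\in\Omega$ and all $|s|\le\varrho$. Let $G(\xi)=G_0(\|\xi\|)$, $s^\pm=\max\{\pm s,0\}$, $f_\pm(x,s)=f(x,\pm s^\pm)$, $F_\pm(x,s)=\int_0^sf_\pm(x,t)\,dt$, and for $u\in W^{1,p}_0(\Omega)$ $$\varphi(u)=\int_\Omega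 G(\nabla u)\,dx-\int_\Omega F(x,u)\,dx,\qquad \varphi_\pm(u)=\int_\Omega G(\nabla u)\,dx-\int_\Omega F_\pm(x,u)\,dx .$$ If $H(a)_1$ and $H(f)_1$ hold, then each $\phi\in\{\varphi,\varphi_+,\varphi_-\}$ is of class $C^1$ on $X=W^{1,p}_0(\Omega)$ and satisfies the Cerami condition: every sequence $(u_n)\subseteq X$ such that $(\phi(u_n))$ is bounded in $\mathbb R$ and $(1+\|u_n\|_X)\phi'(u_n)\to0$ in $X^*$ has a subsequence converging strongly in $X$. -/

import Mathlib

open MeasureTheory Filter Topology Set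
open scoped ENNReal ContDiff

noncomputable section

/-- `ℝ^N` with the Euclidean norm. -/
abbrev RN (N : ℕ) : Type := EuclideanSpace ℝ (Fin N)

instance fact_one_le_ofReal (p : ℝ) [hp : Fact (1 < p)] : Fact (1 ≤ ENNReal.ofReal p) :=
  ⟨ENNReal.one_le_ofReal.2 hp.out.le⟩

/-- A bounded domain of `ℝ^N` with `C²` boundary: near each boundary point, `Ω` is the sublevel set
`{ρ < 0}` of a `C²` function `ρ` without critical points. -/
structure IsBoundedC2Domain {N : ℕ} (Ω : Set (RN N)) : Prop where
  isOpen : IsOpen Ω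
  isConnected : IsConnected Ω
  isBounded : Bornology.IsBounded Ω
  boundary : ∀ x₀ ∈ frontier Ω, ∃ U : Set (RN N), IsOpen U ∧ x₀ ∈ U ∧
    ∃ ρ : RN N → ℝ, ContDiffOn ℝ 2 ρ U ∧ (∀ x ∈ U, fderiv ℝ ρ x ≠ 0) ∧
      ∀ x ∈ U, x ∈ Ω ↔ ρ x < 0

/-! ### The Sobolev space `W^{1,p}_0(Ω)` -/

/-- `C_c^∞(Ω)`. -/
structure IsTestFunction {N : ℕ} (Ω : Set (RN N)) (ψ : RN N → ℝ) : Prop where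
  contDiff : ContDiff ℝ ∞ ψ
  hasCompactSupport : HasCompactSupport ψ
  tsupport_subset : tsupport ψ ⊆ Ω

/-- The space `L^p(Ω) × L^p(Ω; ℝ^N)` with the norm `(‖u‖_p ^ p + ‖g‖_p ^ p) ^ (1 / p)`. -/
abbrev LpPair {N : ℕ} (Ω : Set (RN N)) (p : ℝ) : Type :=
  WithLp (ENNReal.ofReal p)
    (Lp ℝ (ENNReal.ofReal p) (volume.restrict Ω) × Lp (RN N) (ENNReal.ofReal p) (volume.restrict Ω))

/-- The pairs `(ψ, ∇ψ)` with `ψ ∈ C_c^∞(Ω)`, as a subspace of `L^p(Ω) × L^p(Ω; ℝ^N)`. -/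
def testPairs {N : ℕ} (Ω : Set (RN N)) (p : ℝ) [Fact (1 < p)] : Submodule ℝ (LpPair Ω p) where
  carrier := {w | ∃ ψ : RN N → ℝ, IsTestFunction Ω ψ ∧
    w.fst =ᵐ[volume.restrict Ω] ψ ∧ w.snd =ᵐ[volume.restrict Ω] gradient ψ}
  zero_mem' := by
    refine ⟨fun _ => 0, ⟨contDiff_const, HasCompactSupport.zero, ?_⟩, ?_, ?_⟩
    · simp [tsupport]
    · exact Lp.coeFn_zero _ _ _
    · have h : gradient (fun _ : RN N => (0 : ℝ)) = 0 := by
        funext x; simp [gradient]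
      rw [h]
      exact Lp.coeFn_zero _ _ _
  add_mem' := by
    rintro w₁ w₂ ⟨ψ₁, h₁, a₁, b₁⟩ ⟨ψ₂, h₂, a₂, b₂⟩
    refine ⟨ψ₁ + ψ₂, ⟨h₁.contDiff.add h₂.contDiff,
      h₁.hasCompactSupport.add h₂.hasCompactSupport,
      (tsupport_add ψ₁ ψ₂).trans (union_subset h₁.tsupport_subset h₂.tsupport_subset)⟩, ?_, ?_⟩
    · rw [WithLp.add_fst]
      filter_upwards [Lp.coeFn_add w₁.fst w₂.fst, a₁, a₂] with x hx h1 h2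
      rw [hx, Pi.add_apply, Pi.add_apply, h1, h2]
    · rw [WithLp.add_snd]
      filter_upwards [Lp.coeFn_add w₁.snd w₂.snd, b₁, b₂] with x hx h1 h2
      rw [hx, Pi.add_apply, h1, h2, gradient, gradient, gradient,
        fderiv_add (h₁.contDiff.differentiable (by simp) x)
          (h₂.contDiff.differentiable (by simp) x), map_add]
  smul_mem' := by
    rintro c w ⟨ψ, h, a, b⟩
    refine ⟨c • ψ, ⟨h.contDiff.const_smul c, h.hasCompactSupport.smul_left (f := fun _ => c),
      (tsupport_smul_subset_right (fun _ => c) ψ).trans h.tsupport_subset⟩, ?_, ?_⟩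
    · rw [WithLp.smul_fst]
      filter_upwards [Lp.coeFn_smul c w.fst, a] with x hx h1
      rw [hx, Pi.smul_apply, Pi.smul_apply, h1]
    · rw [WithLp.smul_snd]
      filter_upwards [Lp.coeFn_smul c w.snd, b] with x hx h1
      rw [hx, Pi.smul_apply, h1, gradient, gradient,
        fderiv_const_smul (h.contDiff.differentiable (by simp) x)]
      simp

/-- `W^{1,p}_0(Ω)`: the closure of `C_c^∞(Ω)` for the Sobolev norm
`(‖u‖_p ^ p + ‖∇u‖_p ^ p) ^ (1 / p)`. An element is stored as the pair `(u, ∇u)` of the function and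
its weak gradient (the weak gradient is determined by the function). -/
abbrev W1p0 {N : ℕ} (Ω : Set (RN N)) (p : ℝ) [Fact (1 < p)] : Type :=
  (testPairs Ω p).topologicalClosure

/-- The function underlying an element of `W^{1,p}_0(Ω)`. -/
def W1p0.fn {N : ℕ} {Ω : Set (RN N)} {p : ℝ} [Fact (1 < p)] (u : W1p0 Ω p) : RN N → ℝ :=
  (u : LpPair Ω p).fst

/-- The weak gradient of an element of `W^{1,p}_0(Ω)`. -/
def W1p0.grad {N : ℕ} {Ω : Set (RN N)} {p : ℝ} [Fact (1 < p)] (u : W1p0 Ω p) : RN N → RN N :=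
  (u : LpPair Ω p).snd

/-- The critical Sobolev exponent `p^*`. -/
def critExp (N : ℕ) (p : ℝ) : EReal :=
  if p < N then ((N * p / (N - p) : ℝ) : EReal) else ⊤

/-- `lam` is an eigenvalue of the Dirichlet `p`-Laplacian: `-Δ_p u = lam |u|^{p-2} u` has a nontrivial
weak solution in `W^{1,p}_0(Ω)`. -/
def IsPLaplaceEigenvalue {N : ℕ} (Ω : Set (RN N)) (p : ℝ) [Fact (1 < p)] (lam : ℝ) : Prop :=
  ∃ u : W1p0 Ω p, u ≠ 0 ∧ ∀ v : W1p0 Ω p,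
    ∫ x in Ω, ‖u.grad x‖ ^ (p - 2) * inner ℝ (u.grad x) (v.grad x)
      = lam * ∫ x in Ω, |u.fn x| ^ (p - 2) * u.fn x * v.fn x

/-- The first (smallest) eigenvalue of the Dirichlet `p`-Laplacian. -/
def firstEigenvalue {N : ℕ} (Ω : Set (RN N)) (p : ℝ) [Fact (1 < p)] : ℝ :=
  sInf {lam | IsPLaplaceEigenvalue Ω p lam}

/-! ### Hypotheses on the differential operator -/

/-- The comparison function `ϑ ∈ C¹(0, ∞)`. -/
structure IsComparison (p : ℝ) (ϑ : ℝ → ℝ) (chat c₀ c₁ c₂ : ℝ) : Prop where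
  chat_pos : 0 < chat
  c₀_pos : 0 < c₀
  c₁_pos : 0 < c₁
  c₂_pos : 0 < c₂
  contDiffOn : ContDiffOn ℝ 1 ϑ (Ioi 0)
  log_deriv : ∀ t > 0, chat ≤ t * deriv ϑ t / ϑ t ∧ t * deriv ϑ t / ϑ t ≤ c₀
  growth : ∀ t > 0, c₁ * t ^ (p - 1) ≤ ϑ t ∧ ϑ t ≤ c₂ * (1 + t ^ (p - 1))

/-- `a(ξ) = a₀(‖ξ‖) ξ`. -/
def aMap (N : ℕ) (a₀ : ℝ → ℝ) (ξ : RN N) : RN N := a₀ ‖ξ‖ • ξ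

/-- `G₀(t) = ∫₀ᵗ s a₀(s) ds`. -/
def G₀ (a₀ : ℝ → ℝ) (t : ℝ) : ℝ := ∫ s in (0 : ℝ)..t, s * a₀ s

/-- `G(ξ) = G₀(‖ξ‖)`. -/
def GFun (N : ℕ) (a₀ : ℝ → ℝ) (ξ : RN N) : ℝ := G₀ a₀ ‖ξ‖

/-- The hypotheses on `a(ξ) = a₀(‖ξ‖) ξ`. -/
structure HypA (N : ℕ) (p : ℝ) (ϑ a₀ : ℝ → ℝ) : Prop where
  pos : ∀ t > 0, 0 < a₀ t
  contDiffOn : ContDiffOn ℝ 1 a₀ (Ioi 0)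
  strictMono : StrictMonoOn (fun t => t * a₀ t) (Ioi 0)
  tendsto_zero : Tendsto (fun t => t * a₀ t) (𝓝[>] 0) (𝓝 0)
  log_deriv : ∃ L > -1, Tendsto (fun t => t * deriv a₀ t / a₀ t) (𝓝[>] 0) (𝓝 L)
  upper : ∃ c₃ > 0, ∀ ξ : RN N, ξ ≠ 0 → ‖fderiv ℝ (aMap N a₀) ξ‖ ≤ c₃ * (ϑ ‖ξ‖ / ‖ξ‖)
  lower : ∀ ξ : RN N, ξ ≠ 0 → ∀ y : RN N,
    ϑ ‖ξ‖ / ‖ξ‖ * ‖y‖ ^ 2 ≤ inner ℝ (fderiv ℝ (aMap N a₀) ξ y) y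
  primitive_lower : ∃ c₆ > 0, ∀ t > 0, -c₆ ≤ p * G₀ a₀ t - t ^ 2 * a₀ t
  primitive_upper : ∃ η > 0, ∀ t > 0, η * t ^ p ≤ t ^ 2 * a₀ t - G₀ a₀ t

/-! ### Hypotheses on the reaction -/

/-- `F(x, s) = ∫₀ˢ f(x, t) dt`. -/
def primitiveF {N : ℕ} (f : RN N → ℝ → ℝ) (x : RN N) (s : ℝ) : ℝ := ∫ t in (0 : ℝ)..s, f x t

/-- Carathéodory functions on `Ω × ℝ`. -/
structure IsCaratheodory {N : ℕ} (Ω : Set (RN N)) (f : RN N → ℝ → ℝ) : Prop where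
  measurable : ∀ s, AEMeasurable (fun x => f x s) (volume.restrict Ω)
  continuous : ∀ᵐ x ∂volume.restrict Ω, Continuous (f x)

/-- The cone `L^∞(Ω)_+`. -/
def IsLinftyPos {N : ℕ} (Ω : Set (RN N)) (h : RN N → ℝ) : Prop :=
  MemLp h ⊤ (volume.restrict Ω) ∧ ∀ᵐ x ∂volume.restrict Ω, 0 ≤ h x

/-- The hypotheses on the reaction `f`; `c₁` is the constant in the lower bound of `ϑ`. -/
structure HypF {N : ℕ} (Ω : Set (RN N)) (p : ℝ) [Fact (1 < p)] (c₁ : ℝ) (r : ℝ)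
    (f : RN N → ℝ → ℝ) : Prop where
  caratheodory : IsCaratheodory Ω f
  zero : ∀ᵐ x ∂volume.restrict Ω, f x 0 = 0
  p_lt_r : p < r
  r_lt_crit : (r : EReal) < critExp N p
  growth : ∃ α : RN N → ℝ, IsLinftyPos Ω α ∧
    ∀ᵐ x ∂volume.restrict Ω, ∀ s : ℝ, |f x s| ≤ α x * (1 + |s| ^ (r - 1))
  superlinear : ∀ K : ℝ, ∃ S > 0, ∀ᵐ x ∂volume.restrict Ω, ∀ s : ℝ, S ≤ |s| →
    K ≤ primitiveF f x s / |s| ^ p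
  quasi_superlinear : ∃ τ : ℝ, (r - p) * max (N / p) 1 < τ ∧ (τ : EReal) < critExp N p ∧
    ∃ β₀ > 0, ∀ ε > 0, ∃ S > 0, ∀ᵐ x ∂volume.restrict Ω, ∀ s : ℝ, S ≤ |s| →
      β₀ - ε ≤ (f x s * s - p * primitiveF f x s) / |s| ^ τ
  near_zero : ∃ η : RN N → ℝ, IsLinftyPos Ω η ∧
    (∀ᵐ x ∂volume.restrict Ω, η x ≤ c₁ / (p - 1) * firstEigenvalue Ω p) ∧
    (¬ ∀ᵐ x ∂volume.restrict Ω, η x = c₁ / (p - 1) * firstEigenvalue Ω p) ∧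
    ∀ ε > 0, ∃ δ > 0, ∀ᵐ x ∂volume.restrict Ω, ∀ s : ℝ, 0 < |s| → |s| < δ →
      p * primitiveF f x s / |s| ^ p ≤ η x + ε
  sign : ∀ ϱ > 0, ∃ κ > 0, ∀ᵐ x ∂volume.restrict Ω, ∀ s : ℝ, |s| ≤ ϱ →
    0 ≤ f x s * s + κ * |s| ^ p

/-! ### The energy functionals and the Cerami condition -/

/-- `φ(u) = ∫_Ω G(∇u) dx - ∫_Ω F(x, u) dx`. -/
def energy {N : ℕ} (Ω : Set (RN N)) (p : ℝ) [Fact (1 < p)] (a₀ : ℝ → ℝ) (f : RN N → ℝ → ℝ)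
    (u : W1p0 Ω p) : ℝ :=
  (∫ x in Ω, GFun N a₀ (u.grad x)) - ∫ x in Ω, primitiveF f x (u.fn x)

/-- `f₊(x, s) = f(x, s⁺)`. -/
def truncPos {N : ℕ} (f : RN N → ℝ → ℝ) (x : RN N) (s : ℝ) : ℝ := f x (max s 0)

/-- `f₋(x, s) = f(x, -s⁻)`. -/
def truncNeg {N : ℕ} (f : RN N → ℝ → ℝ) (x : RN N) (s : ℝ) : ℝ := f x (-max (-s) 0)

/-- `φ ∈ C¹(X)` and `φ` satisfies the Cerami condition. -/
def CeramiCondition {X : Type*} [NormedAddCommGroup X] [NormedSpace ℝ X] (φ : X → ℝ) : Prop :=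
  ContDiff ℝ 1 φ ∧
    ∀ u : ℕ → X, (∃ M : ℝ, ∀ n, |φ (u n)| ≤ M) →
      Tendsto (fun n => (1 + ‖u n‖) • fderiv ℝ φ (u n)) atTop (𝓝 0) →
      ∃ (u₀ : X) (k : ℕ → ℕ), StrictMono k ∧ Tendsto (u ∘ k) atTop (𝓝 u₀)

end

/-! Both integrals in the energy are Nemytskii functionals, `∇u ↦ ∫ G(∇u)` on `L^p` and `u ↦ ∫ F(x,
u)` on `L^r`, composed with bounded linear maps out of `W^{1,p}_0(Ω)`. A Carathéodory map of growth
`q - 1` acts continuously from `L^q` to the conjugate Lebesgue space (`IsNemytskii.continuous_op`),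
so these functionals are of class `C¹` (`IsNemytskii.hasFDerivAt`).

Boundedness of Cerami sequences (`bounded_of_energy_bounded`): both `φ(u)` and `φ'(u)u` stay
bounded, hence so does `pφ(u) - φ'(u)u`. As `pG(ξ) - (a(ξ), ξ) ≥ -c₆` and `f(x,s)s - pF(x,s) ≥
β|s|^τ - C`, this bounds `∫ |u|^τ`. If `τ < r`, interpolation of `L^r` between `L^τ` and a
Sobolev-admissible `L^q` gives `∫ |u|^r ≤ C ‖∇u‖^{qθ}` with `θ = (r - τ)/(q - τ)`; the lower bound
on `τ` allows a choice of `q` with `qθ < p`. Inserted in `c‖∇u‖^p ≤ ∫ (a(∇u), ∇u) ≤ M + ∫ f(x,u)u`,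
where `c = c₁/(p - 1)`, this bounds `‖∇u‖`, and Poincaré's inequality bounds `u`.

Strong convergence (`exists_tendsto_of_uniform_monotone`): the embedding into `L^1` is compact,
being a norm limit of finite-rank averaging operators, and interpolation with `L^q` upgrades this to
`L^r`. Along the resulting subsequence `⟨a(∇u_i) - a(∇u_j), ∇u_i - ∇u_j⟩` tends to `0`. The operator
`a` dominates `c` times the `p`-Laplacian in the sense of monotonicity, so a quantitative form of
monotonicity makes the gradients Cauchy. No weak limit is needed.

The three functionals are handled together: the reaction is composed with a truncation `ρ`, and
`|u|` is replaced by the gauge `|ρ(u)|` in the estimates above. The other part of `u` needs no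
separate bound, because `φ'(u)u` already controls the full gradient. -/

noncomputable section

set_option linter.unusedSectionVars false
set_option linter.style.haveILetI false

/-! ### Nemytskii operators and differentiability of integral functionals on `L^q`. -/

section Nemytskii

variable {X : Type*} [MeasurableSpace X] {μ : Measure X}

theorem holderConjugate_ofReal {q q' : ℝ} (hq : q.HolderConjugate q') :
    ENNReal.HolderConjugate (ENNReal.ofReal q) (ENNReal.ofReal q') := by
  rw [ENNReal.holderConjugate_iff, ← ENNReal.ofReal_inv_of_pos hq.pos,
    ← ENNReal.ofReal_inv_of_pos hq.symm.pos, ← ENNReal.ofReal_add hq.inv_nonneg hq.symm.inv_nonneg,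
    hq.inv_add_inv_eq_one, ENNReal.ofReal_one]

theorem norm_rpow_eq_integral {E : Type*} [NormedAddCommGroup E] {q : ℝ} (hq : 0 < q)
    (f : Lp E (ENNReal.ofReal q) μ) : ‖f‖ ^ q = ∫ x, ‖f x‖ ^ q ∂μ := by
  have h := (Lp.memLp f).eLpNorm_eq_integral_rpow_norm (by simpa using hq) ENNReal.ofReal_ne_top
  have hn : 0 ≤ ∫ x, ‖f x‖ ^ q ∂μ := integral_nonneg fun x => by positivity
  rw [Lp.norm_def, h, ENNReal.toReal_ofReal_eq_iff.2 (by positivity), ENNReal.toReal_ofReal hq.le,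
    ← Real.rpow_mul hn, inv_mul_cancel₀ hq.ne', Real.rpow_one]

theorem integrable_norm_rpow {E : Type*} [NormedAddCommGroup E] {q : ℝ} (hq : 0 < q)
    (f : Lp E (ENNReal.ofReal q) μ) : Integrable (fun x => ‖f x‖ ^ q) μ := by
  have := (Lp.memLp f).integrable_norm_rpow (by simpa using hq) ENNReal.ofReal_ne_top
  rwa [ENNReal.toReal_ofReal hq.le] at this

/-- The identity `(q - 1) q' = q` turns growth of order `q - 1` into a bound on `q'`-th powers. Two
base quantities are kept so that the parts coming from a limit `u` and from a difference `v - u` can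
be separated. -/
theorem rpow_conj_growth {q q' : ℝ} (hq : q.HolderConjugate q') {A : ℝ} :
    ∃ K, 0 ≤ K ∧ ∀ a b c : ℝ, 0 ≤ a → 0 ≤ b → 0 ≤ c → c ≤ A * (1 + (a + b) ^ (q - 1)) →
      c ^ q' ≤ K * (1 + a ^ q + b ^ q) := by
  refine ⟨(2 * |A|) ^ q' * 2 ^ q, by positivity, fun a b c ha hb hc h => ?_⟩
  have hq1 : 0 ≤ q - 1 := hq.sub_one_pos.le
  set M := max 1 (max a b) with hM
  have hM1 : 1 ≤ M := le_max_left _ _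
  have haM : a ≤ M := (le_max_left _ _).trans (le_max_right _ _)
  have hbM : b ≤ M := (le_max_right _ _).trans (le_max_right _ _)
  have h1 : (a + b) ^ (q - 1) ≤ (2 * M) ^ (q - 1) :=
    Real.rpow_le_rpow (by positivity) (by linarith) hq1
  have h2 : 1 ≤ (2 * M) ^ (q - 1) := Real.one_le_rpow (by linarith) hq1
  have h3 : c ≤ 2 * |A| * (2 * M) ^ (q - 1) := by
    have h4 : A * (1 + (a + b) ^ (q - 1)) ≤ |A| * (1 + (a + b) ^ (q - 1)) :=
      mul_le_mul_of_nonneg_right (le_abs_self A) (by positivity)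
    have h5 : |A| * (1 + (a + b) ^ (q - 1)) ≤ |A| * (2 * (2 * M) ^ (q - 1)) :=
      mul_le_mul_of_nonneg_left (by linarith) (abs_nonneg A)
    linarith
  have h4 : c ^ q' ≤ (2 * |A| * (2 * M) ^ (q - 1)) ^ q' :=
    Real.rpow_le_rpow hc h3 hq.symm.nonneg
  have h5 : (2 * |A| * (2 * M) ^ (q - 1)) ^ q' = (2 * |A|) ^ q' * 2 ^ q * M ^ q := by
    rw [Real.mul_rpow (x := 2 * |A|) (by positivity) (by positivity),
      ← Real.rpow_mul (by positivity), hq.sub_one_mul_conj,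
      Real.mul_rpow (x := 2) (y := M) (by norm_num) (by positivity), mul_assoc]
  have h6 : M ^ q ≤ 1 + a ^ q + b ^ q := by
    have ha' := Real.rpow_nonneg ha q
    have hb' := Real.rpow_nonneg hb q
    rcases max_choice 1 (max a b) with h | h
    · rw [hM, h, Real.one_rpow]; linarith
    · rcases max_choice a b with h' | h' <;> rw [hM, h, h'] <;> linarith
  rw [h5] at h4
  exact h4.trans (mul_le_mul_of_nonneg_left h6 (by positivity))

variable {E : Type*} [NormedAddCommGroup E] [InnerProductSpace ℝ E] [MeasurableSpace E]
  [BorelSpace E] [SecondCountableTopology E]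

/-- A jointly measurable map, continuous in the second variable, of growth `‖ξ‖ ^ (q - 1)`. -/
structure IsNemytskii (μ : Measure X) (q : ℝ) (h : X → E → E) : Prop where
  measurable : Measurable (Function.uncurry h)
  continuous : ∀ x, Continuous (h x)
  growth : ∃ A, ∀ᵐ x ∂μ, ∀ ξ, ‖h x ξ‖ ≤ A * (1 + ‖ξ‖ ^ (q - 1))

variable {q q' : ℝ} {h : X → E → E}

theorem aestronglyMeasurable_nemytskii {E' : Type*} [TopologicalSpace E'] [MeasurableSpace E'] [BorelSpace E']
    [SecondCountableTopology E'] [TopologicalSpace.PseudoMetrizableSpace E'] {h : X → E → E'}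
    (hh : Measurable (Function.uncurry h)) {u : X → E}
    (hu : AEStronglyMeasurable u μ) : AEStronglyMeasurable (fun x => h x (u x)) μ :=
  (hh.comp_aemeasurable (aemeasurable_id.prodMk hu.aemeasurable)).aestronglyMeasurable

theorem IsNemytskii.memLp [IsFiniteMeasure μ] (hh : IsNemytskii μ q h)
    (hq : q.HolderConjugate q') (u : Lp E (ENNReal.ofReal q) μ) :
    MemLp (fun x => h x (u x)) (ENNReal.ofReal q') μ := by
  obtain ⟨A, hA⟩ := hh.growth
  obtain ⟨K, hK, hgr⟩ := rpow_conj_growth hq (A := A)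
  have hm := aestronglyMeasurable_nemytskii hh.measurable (Lp.aestronglyMeasurable u)
  rw [← integrable_norm_rpow_iff hm (by simpa using hq.symm.pos) ENNReal.ofReal_ne_top,
    ENNReal.toReal_ofReal hq.symm.nonneg]
  refine Integrable.mono' (((integrable_const (1 : ℝ)).add
    (integrable_norm_rpow hq.pos u)).const_mul K)
    (hm.norm.aemeasurable.pow_const _).aestronglyMeasurable ?_
  filter_upwards [hA] with x hx
  rw [Real.norm_of_nonneg (by positivity)]
  have := hgr ‖u x‖ 0 ‖h x (u x)‖ (norm_nonneg _) le_rfl (norm_nonneg _) (by simpa using hx (u x))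
  simpa [Real.zero_rpow hq.ne_zero] using this

/-- The Nemytskii operator `u ↦ h(·, u(·))` from `L^q` to `L^q'`. -/
def IsNemytskii.op [IsFiniteMeasure μ] (hh : IsNemytskii μ q h) (hq : q.HolderConjugate q')
    (u : Lp E (ENNReal.ofReal q) μ) : Lp E (ENNReal.ofReal q') μ :=
  (hh.memLp hq u).toLp

theorem IsNemytskii.coeFn_op [IsFiniteMeasure μ] (hh : IsNemytskii μ q h)
    (hq : q.HolderConjugate q') (u : Lp E (ENNReal.ofReal q) μ) :
    hh.op hq u =ᵐ[μ] fun x => h x (u x) := (hh.memLp hq u).coeFn_toLp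

/-- Every subsequence has a further a.e. convergent one, and along it a generalised dominated
convergence argument applies. -/
theorem IsNemytskii.continuous_op [IsFiniteMeasure μ] (hh : IsNemytskii μ q h)
    (hq : q.HolderConjugate q') [Fact (1 ≤ ENNReal.ofReal q)] [Fact (1 ≤ ENNReal.ofReal q')] :
    Continuous (hh.op hq) := by
  rw [continuous_iff_seqContinuous]
  intro w u hw
  refine tendsto_of_subseq_tendsto fun ns hns => ?_
  have hw1 := hw.comp hns
  obtain ⟨ms, hms, hae⟩ := (tendstoInMeasure_of_tendsto_Lp hw1).exists_seq_tendsto_ae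
  refine ⟨ms, ?_⟩
  set v : ℕ → Lp E (ENNReal.ofReal q) μ := fun n => w (ns (ms n)) with hv
  have hvu : Tendsto v atTop (𝓝 u) := hw1.comp hms.tendsto_atTop
  obtain ⟨A, hA⟩ := hh.growth
  obtain ⟨K, hK, hgr⟩ := rpow_conj_growth hq (A := 2 * |A|)
  have hnorm : Tendsto (fun n => ‖v n - u‖ ^ q) atTop (𝓝 0) := by
    have := (tendsto_iff_norm_sub_tendsto_zero.1 hvu).rpow_const (p := q) (Or.inr hq.nonneg)
    simpa [Real.zero_rpow hq.ne_zero] using this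
  set D : ℕ → X → ℝ := fun n x => ‖h x (v n x) - h x (u x)‖ ^ q' with hD
  -- The majorant of `D n` contains the moving term `K ‖v n - u‖ ^ q`. Subtracting that term leaves
  -- a fixed integrable majorant, and its integral vanishes in the limit separately.
  set W : ℕ → X → ℝ := fun n x => max (D n x - K * ‖v n x - u x‖ ^ q) 0 with hW
  have hm : ∀ z : Lp E (ENNReal.ofReal q) μ, AEStronglyMeasurable (fun x => h x (z x)) μ :=
    fun z => aestronglyMeasurable_nemytskii hh.measurable (Lp.aestronglyMeasurable z)
  have hDm : ∀ n, AEStronglyMeasurable (D n) μ := fun n =>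
    (((hm (v n)).sub (hm u)).norm.aemeasurable.pow_const _).aestronglyMeasurable
  have hVm : ∀ n, AEStronglyMeasurable (fun x => ‖v n x - u x‖ ^ q) μ := fun n =>
    (((Lp.aestronglyMeasurable (v n)).sub
      (Lp.aestronglyMeasurable u)).norm.aemeasurable.pow_const _).aestronglyMeasurable
  have hWm : ∀ n, AEStronglyMeasurable (W n) μ := fun n =>
    ((hDm n).sub ((hVm n).const_mul K)).sup aestronglyMeasurable_const
  have hDle : ∀ n, ∀ᵐ x ∂μ, D n x ≤ K * (1 + ‖u x‖ ^ q + ‖v n x - u x‖ ^ q) := by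
    intro n
    filter_upwards [hA] with x hx
    refine hgr _ _ _ (norm_nonneg _) (norm_nonneg _) (norm_nonneg _) ?_
    have hq1 : 0 ≤ q - 1 := hq.sub_one_pos.le
    have h1 : ‖v n x‖ ^ (q - 1) ≤ (‖u x‖ + ‖v n x - u x‖) ^ (q - 1) :=
      Real.rpow_le_rpow (norm_nonneg _) (by
        have := norm_add_le (u x) (v n x - u x)
        rwa [add_sub_cancel] at this) hq1
    have h2 : ‖u x‖ ^ (q - 1) ≤ (‖u x‖ + ‖v n x - u x‖) ^ (q - 1) :=
      Real.rpow_le_rpow (norm_nonneg _) (by linarith [norm_nonneg (v n x - u x)]) hq1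
    have key : ∀ ξ, ‖ξ‖ ^ (q - 1) ≤ (‖u x‖ + ‖v n x - u x‖) ^ (q - 1) →
        ‖h x ξ‖ ≤ |A| * (1 + (‖u x‖ + ‖v n x - u x‖) ^ (q - 1)) := fun ξ hξ =>
      (hx ξ).trans ((mul_le_mul_of_nonneg_right (le_abs_self A) (by positivity)).trans
        (mul_le_mul_of_nonneg_left (by linarith) (abs_nonneg A)))
    have := norm_sub_le (h x (v n x)) (h x (u x))
    linarith [key _ h1, key _ h2]
  have hWle : ∀ n, ∀ᵐ x ∂μ, ‖W n x‖ ≤ K * (1 + ‖u x‖ ^ q) := by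
    intro n
    filter_upwards [hDle n] with x hx
    rw [Real.norm_of_nonneg (le_max_right _ _)]
    exact max_le (by linarith) (by positivity)
  have hbd : Integrable (fun x => K * (1 + ‖u x‖ ^ q)) μ :=
    ((integrable_const (1 : ℝ)).add (integrable_norm_rpow hq.pos u)).const_mul K
  have hWlim : ∀ᵐ x ∂μ, Tendsto (fun n => W n x) atTop (𝓝 0) := by
    filter_upwards [hae] with x hx
    have hD0 : Tendsto (fun n => D n x) atTop (𝓝 0) := by
      have h1 : Tendsto (fun n => h x (v n x) - h x (u x)) atTop (𝓝 0) := by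
        have := (((hh.continuous x).tendsto (u x)).comp hx).sub_const (h x (u x))
        simpa using this
      have := h1.norm.rpow_const (p := q') (Or.inr hq.symm.nonneg)
      simpa [Real.zero_rpow hq.symm.ne_zero] using this
    refine squeeze_zero (fun n => le_max_right _ _) (fun n => ?_) hD0
    exact max_le (sub_le_self _ (by positivity)) (by positivity)
  have hWint : Tendsto (fun n => ∫ x, W n x ∂μ) atTop (𝓝 0) := by
    simpa using tendsto_integral_of_dominated_convergence _ hWm hbd hWle hWlim
  have hVint : ∀ n, Integrable (fun x => ‖v n x - u x‖ ^ q) μ ∧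
      ∫ x, ‖v n x - u x‖ ^ q ∂μ = ‖v n - u‖ ^ q := by
    intro n
    have he : (fun x => ‖(v n - u) x‖ ^ q) =ᵐ[μ] fun x => ‖v n x - u x‖ ^ q := by
      filter_upwards [Lp.coeFn_sub (v n) u] with x hx
      rw [hx, Pi.sub_apply]
    exact ⟨(integrable_norm_rpow hq.pos _).congr he,
      by rw [norm_rpow_eq_integral hq.pos, integral_congr_ae he]⟩
  have hfin : Tendsto (fun n => ‖hh.op hq (v n) - hh.op hq u‖ ^ q') atTop (𝓝 0) := by
    have hlim := hWint.add (hnorm.const_mul K)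
    rw [mul_zero, add_zero] at hlim
    refine squeeze_zero (fun n => by positivity) (fun n => ?_) hlim
    rw [norm_rpow_eq_integral hq.symm.pos, ← (hVint n).2, ← integral_const_mul,
      ← integral_add (hbd.mono' (hWm n) (hWle n)) ((hVint n).1.const_mul K)]
    have he : (fun x => ‖(hh.op hq (v n) - hh.op hq u) x‖ ^ q') =ᵐ[μ] D n := by
      filter_upwards [Lp.coeFn_sub (hh.op hq (v n)) (hh.op hq u), hh.coeFn_op hq (v n),
        hh.coeFn_op hq u] with x h1 h2 h3
      rw [h1, Pi.sub_apply, h2, h3]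
    rw [integral_congr_ae he]
    refine integral_mono_of_nonneg (ae_of_all _ fun x => by positivity)
      ((hbd.mono' (hWm n) (hWle n)).add ((hVint n).1.const_mul K)) (ae_of_all _ fun x => ?_)
    have := le_max_left (D n x - K * ‖v n x - u x‖ ^ q) 0
    simp only [hW]
    linarith
  rw [tendsto_iff_norm_sub_tendsto_zero]
  have := hfin.rpow_const (p := 1 / q') (Or.inr (by have := hq.symm.pos; positivity))
  rw [Real.zero_rpow (by have := hq.symm.pos; positivity)] at this
  refine this.congr fun n => ?_
  rw [← Real.rpow_mul (norm_nonneg _), mul_one_div_cancel hq.symm.ne_zero, Real.rpow_one]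
  rfl

/-- The candidate derivative `u ↦ (v ↦ ∫ ⟨h(x, u(x)), v(x)⟩)`. -/
def IsNemytskii.deriv [IsFiniteMeasure μ] (hh : IsNemytskii μ q h) (hq : q.HolderConjugate q')
    [Fact (1 ≤ ENNReal.ofReal q)] [Fact (1 ≤ ENNReal.ofReal q')]
    (u : Lp E (ENNReal.ofReal q) μ) : Lp E (ENNReal.ofReal q) μ →L[ℝ] ℝ :=
  haveI := holderConjugate_ofReal hq.symm
  (innerSL ℝ).lpPairing μ (ENNReal.ofReal q') (ENNReal.ofReal q) (hh.op hq u)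

section

variable [IsFiniteMeasure μ] [Fact (1 ≤ ENNReal.ofReal q)] [Fact (1 ≤ ENNReal.ofReal q')]

theorem IsNemytskii.deriv_apply (hh : IsNemytskii μ q h) (hq : q.HolderConjugate q')
    (u v : Lp E (ENNReal.ofReal q) μ) :
    hh.deriv hq u v = ∫ x, inner ℝ (h x (u x)) (v x) ∂μ := by
  haveI := holderConjugate_ofReal hq.symm
  rw [IsNemytskii.deriv, ContinuousLinearMap.lpPairing_eq_integral]
  refine integral_congr_ae ?_
  filter_upwards [hh.coeFn_op hq u] with x hx
  rw [hx, innerSL_apply_apply]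

theorem IsNemytskii.integrable_inner (hh : IsNemytskii μ q h) (hq : q.HolderConjugate q')
    (u v : Lp E (ENNReal.ofReal q) μ) :
    Integrable (fun x => inner ℝ (h x (u x)) (v x)) μ := by
  haveI := holderConjugate_ofReal hq.symm
  exact (memLp_one_iff_integrable).1 ((innerSL ℝ (E := E)).memLp_of_bilin (r := 1) (hh.memLp hq u) (Lp.memLp v))

theorem IsNemytskii.continuous_deriv (hh : IsNemytskii μ q h) (hq : q.HolderConjugate q') :
    Continuous (hh.deriv hq) := by
  haveI := holderConjugate_ofReal hq.symm
  exact ((innerSL ℝ).lpPairing μ (ENNReal.ofReal q') (ENNReal.ofReal q)).continuous.comp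
    (hh.continuous_op hq)

variable {H : X → E → ℝ}

theorem IsNemytskii.abs_primitive_le {A : ℝ} (hq : 1 < q) {x : X}
    (hA : ∀ ξ, ‖h x ξ‖ ≤ A * (1 + ‖ξ‖ ^ (q - 1)))
    (hH : ∀ ξ, HasFDerivAt (H x) (innerSL ℝ (h x ξ)) ξ) (h0 : H x 0 = 0) (ξ : E) :
    ‖H x ξ‖ ≤ 2 * A * (1 + ‖ξ‖ ^ q) := by
  have hA0 : 0 ≤ A := by
    have := (norm_nonneg _).trans (hA 0)
    rw [norm_zero, Real.zero_rpow (by linarith), add_zero, mul_one] at this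
    exact this
  have h1 : ‖H x ξ - H x 0‖ ≤ A * (1 + ‖ξ‖ ^ (q - 1)) * ‖ξ - 0‖ := by
    refine Convex.norm_image_sub_le_of_norm_hasFDerivWithin_le (s := Metric.closedBall 0 ‖ξ‖)
      (fun y _ => (hH y).hasFDerivWithinAt) (fun y hy => ?_) (convex_closedBall _ _) (by simp)
      (by simp)
    rw [innerSL_apply_norm]
    refine (hA y).trans (mul_le_mul_of_nonneg_left ?_ hA0)
    have := Real.rpow_le_rpow (norm_nonneg y) (by simpa using hy) (by linarith : 0 ≤ q - 1)
    linarith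
  rw [h0, sub_zero, sub_zero] at h1
  refine h1.trans ?_
  have h2 : ‖ξ‖ ^ (q - 1) * ‖ξ‖ = ‖ξ‖ ^ q := by
    rw [← Real.rpow_add_one' (norm_nonneg _) (by linarith)]; congr 1; ring
  have h3 : ‖ξ‖ ≤ 1 + ‖ξ‖ ^ q := by
    rcases le_total ‖ξ‖ 1 with h | h
    · have := Real.rpow_nonneg (norm_nonneg ξ) q; linarith
    · have := Real.self_le_rpow_of_one_le h hq.le; linarith
  have h4 : (1 + ‖ξ‖ ^ (q - 1)) * ‖ξ‖ ≤ 2 * (1 + ‖ξ‖ ^ q) := by rw [add_mul, h2]; linarith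
  nlinarith [mul_le_mul_of_nonneg_left h4 hA0]

theorem IsNemytskii.integrable_primitive (hh : IsNemytskii μ q h) (hq : 1 < q)
    (hHm : Measurable (Function.uncurry H))
    (hH : ∀ x ξ, HasFDerivAt (H x) (innerSL ℝ (h x ξ)) ξ) (h0 : ∀ x, H x 0 = 0)
    (u : Lp E (ENNReal.ofReal q) μ) : Integrable (fun x => H x (u x)) μ := by
  obtain ⟨A, hA⟩ := hh.growth
  refine Integrable.mono' (((integrable_const (1 : ℝ)).add
    (integrable_norm_rpow (by linarith) u)).const_mul (2 * A))
    (aestronglyMeasurable_nemytskii hHm (Lp.aestronglyMeasurable u)) ?_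
  filter_upwards [hA] with x hx
  exact IsNemytskii.abs_primitive_le hq hx (hH x) (h0 x) (u x)

/-- Differentiation under the integral sign along a line. The full derivative then follows from
continuity of the candidate and the mean value inequality. -/
theorem IsNemytskii.hasDerivAt_line (hh : IsNemytskii μ q h) (hq : q.HolderConjugate q')
    (hHm : Measurable (Function.uncurry H))
    (hH : ∀ x ξ, HasFDerivAt (H x) (innerSL ℝ (h x ξ)) ξ) (h0 : ∀ x, H x 0 = 0)
    (u v : Lp E (ENNReal.ofReal q) μ) (t₀ : ℝ) :
    HasDerivAt (fun t : ℝ => ∫ x, H x ((u + t • v) x) ∂μ) (hh.deriv hq (u + t₀ • v) v) t₀ := by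
  have hcoe : ∀ t : ℝ, ∀ᵐ x ∂μ, (u + t • v) x = u x + t • v x := by
    intro t
    filter_upwards [Lp.coeFn_add u (t • v), Lp.coeFn_smul t v] with x h1 h2
    rw [h1, Pi.add_apply, h2, Pi.smul_apply]
  have e1 : (fun t : ℝ => ∫ x, H x ((u + t • v) x) ∂μ) = fun t => ∫ x, H x (u x + t • v x) ∂μ := by
    funext t
    refine integral_congr_ae ?_
    filter_upwards [hcoe t] with x hx
    rw [hx]
  have e2 : hh.deriv hq (u + t₀ • v) v = ∫ x, inner ℝ (h x (u x + t₀ • v x)) (v x) ∂μ := by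
    rw [hh.deriv_apply hq]
    refine integral_congr_ae ?_
    filter_upwards [hcoe t₀] with x hx
    rw [hx]
  rw [e1, e2]
  obtain ⟨A, hA⟩ := hh.growth
  have hum := Lp.aestronglyMeasurable u
  have hvm := Lp.aestronglyMeasurable v
  have hm : ∀ t : ℝ, AEStronglyMeasurable (fun x => u x + t • v x) μ := fun t =>
    hum.add (hvm.const_smul t)
  -- `R` bounds `|t|` on the unit ball about `t₀`, so `‖u‖ + R‖v‖` dominates every `‖u + t v‖`
  -- there; `R ≥ 1` makes it dominate `‖v‖` as well.
  set R : ℝ := |t₀| + 1 with hR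
  have hR1 : 1 ≤ R := by have := abs_nonneg t₀; linarith
  have hR0 : 0 ≤ R := by linarith
  have hz : Integrable (fun x => (‖u x‖ + R * ‖v x‖) ^ q) μ := by
    have h1 : MemLp (fun x => ‖u x‖ + R * ‖v x‖) (ENNReal.ofReal q) μ :=
      (Lp.memLp u).norm.add ((Lp.memLp v).norm.const_mul R)
    have h2 := h1.integrable_norm_rpow (by simpa using hq.pos) ENNReal.ofReal_ne_top
    rw [ENNReal.toReal_ofReal hq.nonneg] at h2
    refine h2.congr (ae_of_all _ fun x => ?_)
    simp only []
    rw [Real.norm_of_nonneg (by positivity)]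
  refine (hasDerivAt_integral_of_dominated_loc_of_deriv_le (s := Metric.ball t₀ 1)
    (bound := fun x => 2 * |A| * (1 + (‖u x‖ + R * ‖v x‖) ^ q))
    (F' := fun t x => inner ℝ (h x (u x + t • v x)) (v x)) (Metric.ball_mem_nhds _ one_pos)
    (Eventually.of_forall fun t => aestronglyMeasurable_nemytskii hHm (hm t)) ?_ ?_ ?_ ?_ ?_).2
  · refine (hh.integrable_primitive hq.lt hHm hH h0 (u + t₀ • v)).congr ?_
    filter_upwards [hcoe t₀] with x hx
    rw [hx]
  · exact (aestronglyMeasurable_nemytskii hh.measurable (hm t₀)).inner hvm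
  · filter_upwards [hA] with x hx t ht
    have ht' : |t| ≤ R := by
      have := abs_sub_abs_le_abs_sub t t₀
      rw [Metric.mem_ball, Real.dist_eq] at ht
      linarith
    set y := ‖u x‖ + R * ‖v x‖ with hy
    have hy0 : 0 ≤ y := by positivity
    have h1 : ‖u x + t • v x‖ ≤ y := (norm_add_le _ _).trans (by
      rw [norm_smul, Real.norm_eq_abs]
      have := mul_le_mul_of_nonneg_right ht' (norm_nonneg (v x))
      linarith)
    have h2 : ‖h x (u x + t • v x)‖ ≤ |A| * (1 + y ^ (q - 1)) :=
      (hx _).trans ((mul_le_mul_of_nonneg_right (le_abs_self A) (by positivity)).trans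
        (mul_le_mul_of_nonneg_left (by
          have := Real.rpow_le_rpow (norm_nonneg _) h1 hq.sub_one_pos.le
          linarith) (abs_nonneg A)))
    have h3 : ‖v x‖ ≤ y := by
      have := mul_le_mul_of_nonneg_right hR1 (norm_nonneg (v x))
      have := norm_nonneg (u x)
      linarith
    have h4 : y ^ (q - 1) * y = y ^ q := by
      rw [← Real.rpow_add_one' hy0 (by have := hq.pos; linarith)]; congr 1; ring
    have h5 : y ≤ 1 + y ^ q := by
      rcases le_total y 1 with h | h
      · have := Real.rpow_nonneg hy0 q; linarith
      · have := Real.self_le_rpow_of_one_le h hq.lt.le; linarith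
    calc ‖inner ℝ (h x (u x + t • v x)) (v x)‖ ≤ ‖h x (u x + t • v x)‖ * ‖v x‖ :=
          norm_inner_le_norm _ _
      _ ≤ |A| * (1 + y ^ (q - 1)) * y := mul_le_mul h2 h3 (norm_nonneg _) (by positivity)
      _ = |A| * (y + y ^ q) := by rw [← h4]; ring
      _ ≤ |A| * (2 * (1 + y ^ q)) := mul_le_mul_of_nonneg_left (by linarith) (abs_nonneg A)
      _ = _ := by ring
  · exact (((integrable_const (1 : ℝ)).add hz).const_mul _)
  · refine ae_of_all _ fun x t _ => ?_
    have h1 : HasDerivAt (fun t : ℝ => u x + t • v x) (v x) t := by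
      simpa using ((hasDerivAt_id t).smul_const (v x)).const_add (u x)
    have := (hH x (u x + t • v x)).comp_hasDerivAt t h1
    simpa [innerSL_apply_apply, Function.comp_def] using this

/-- The mean value inequality on the segment from `u` to `u + v`, applied to the functional minus
its linear part, turns continuity of `hh.deriv hq` into the little-o estimate. -/
theorem IsNemytskii.hasFDerivAt (hh : IsNemytskii μ q h) (hq : q.HolderConjugate q')
    (hHm : Measurable (Function.uncurry H))
    (hH : ∀ x ξ, HasFDerivAt (H x) (innerSL ℝ (h x ξ)) ξ) (h0 : ∀ x, H x 0 = 0)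
    (u : Lp E (ENNReal.ofReal q) μ) :
    HasFDerivAt (fun u : Lp E (ENNReal.ofReal q) μ => ∫ x, H x (u x) ∂μ) (hh.deriv hq u) u := by
  rw [hasFDerivAt_iff_isLittleO_nhds_zero, Asymptotics.isLittleO_iff]
  intro ε hε
  obtain ⟨δ, hδ, hc⟩ := (Metric.continuous_iff (f := hh.deriv hq)).1 (hh.continuous_deriv hq) u ε hε
  filter_upwards [Metric.ball_mem_nhds (0 : Lp E (ENNReal.ofReal q) μ) hδ] with v hv
  rw [mem_ball_zero_iff] at hv
  have hd : ∀ t : ℝ, HasDerivAt (fun t : ℝ => (∫ x, H x ((u + t • v) x) ∂μ) - t * hh.deriv hq u v)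
      (hh.deriv hq (u + t • v) v - hh.deriv hq u v) t := fun t => by
    have h1 : HasDerivAt (fun t : ℝ => t * hh.deriv hq u v) (hh.deriv hq u v) t := by
      simpa using (hasDerivAt_id t).mul_const (hh.deriv hq u v)
    exact (hh.hasDerivAt_line hq hHm hH h0 u v t).sub h1
  have := norm_image_sub_le_of_norm_deriv_le_segment_01' (C := ε * ‖v‖)
    (fun t _ => (hd t).hasDerivWithinAt) (fun t ht => by
      rw [← sub_apply]
      refine (ContinuousLinearMap.le_opNorm _ _).trans
        (mul_le_mul_of_nonneg_right ?_ (norm_nonneg _))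
      rw [← dist_eq_norm]
      refine (hc _ ?_).le
      rw [dist_eq_norm, add_sub_cancel_left, norm_smul, Real.norm_of_nonneg ht.1]
      exact (mul_le_of_le_one_left (norm_nonneg _) ht.2.le).trans_lt hv)
  simpa [sub_right_comm] using this

end

end Nemytskii

/-! ### Quantitative monotonicity of `ξ ↦ ‖ξ‖^{p-2} ξ`. -/

section PLaplace

variable {E : Type*} [NormedAddCommGroup E] [InnerProductSpace ℝ E]

theorem inner_radial_sub (α β : ℝ) (ξ η : E) :
    inner ℝ (α • ξ - β • η) (ξ - η) = α * ‖ξ‖ ^ 2 + β * ‖η‖ ^ 2 - (α + β) * inner ℝ ξ η := by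
  rw [inner_sub_left, inner_sub_right, inner_sub_right, real_inner_smul_left, real_inner_smul_left,
    real_inner_smul_left, real_inner_smul_left, real_inner_self_eq_norm_sq,
    real_inner_self_eq_norm_sq, real_inner_comm ξ η]
  ring

/-- By Cauchy–Schwarz the worst case is that of parallel vectors, where the expression is the scalar
one in the hypothesis. -/
theorem inner_radial_sub_nonneg {α β : ℝ} (hα : 0 ≤ α) (hβ : 0 ≤ β) (ξ η : E)
    (h : 0 ≤ (α * ‖ξ‖ - β * ‖η‖) * (‖ξ‖ - ‖η‖)) :
    0 ≤ inner ℝ (α • ξ - β • η) (ξ - η) := by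
  rw [inner_radial_sub]
  nlinarith [mul_le_mul_of_nonneg_left (real_inner_le_norm ξ η) (add_nonneg hα hβ)]

/-- Bernoulli's inequality for the concave power `p - 1` at the ratio `t / s`, after weakening `(s +
t)^{p-2}` to `s^{p-2}`. -/
theorem rpow_sub_rpow_ge {p s t : ℝ} (hp : 1 < p) (hp2 : p < 2) (ht : 0 < t) (hts : t ≤ s) :
    (p - 1) * (s + t) ^ (p - 2) * (s - t) ≤ s ^ (p - 2) * s - t ^ (p - 2) * t := by
  have hs : 0 < s := ht.trans_le hts
  have e : ∀ x : ℝ, 0 < x → x ^ (p - 2) * x = x ^ (p - 1) := fun x hx => by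
    rw [← Real.rpow_add_one hx.ne']; congr 1; ring
  have h1 := rpow_one_add_le_one_add_mul_self (s := t / s - 1) (p := p - 1)
    (by have : 0 < t / s := div_pos ht hs
        linarith) (by linarith) (by linarith)
  rw [add_sub_cancel, Real.div_rpow ht.le hs.le, div_le_iff₀ (by positivity)] at h1
  have h2 : (s + t) ^ (p - 2) ≤ s ^ (p - 2) :=
    Real.rpow_le_rpow_of_nonpos hs (by linarith) (by linarith)
  have h3 : (p - 1) * (s + t) ^ (p - 2) * (s - t) ≤ (p - 1) * s ^ (p - 2) * (s - t) :=
    mul_le_mul_of_nonneg_right (mul_le_mul_of_nonneg_left h2 (by linarith)) (by linarith)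
  refine h3.trans ?_
  rw [e t ht, e s hs]
  have h4 : (1 + (p - 1) * (t / s - 1)) * s ^ (p - 1)
      = s ^ (p - 1) - (p - 1) * s ^ (p - 2) * (s - t) := by
    rw [← e s hs]; field_simp; ring
  linarith

/-- With `α = ‖ξ‖^{p-2}` and `β = ‖η‖^{p-2}`, twice the inner product equals `(α + β)‖ξ - η‖² + (α -
β)(‖ξ‖² - ‖η‖²)`, and the last product is nonnegative since `p - 2 ≥ 0`. -/
theorem pLaplace_monotone_of_two_le {p : ℝ} (hp : 2 ≤ p) (ξ η : E) :
    ‖ξ - η‖ ^ p ≤ 2 ^ (p - 1) *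
      inner ℝ (‖ξ‖ ^ (p - 2) • ξ - ‖η‖ ^ (p - 2) • η) (ξ - η) := by
  set s := ‖ξ‖ with hs
  set t := ‖η‖ with ht
  have hs0 : 0 ≤ s := norm_nonneg _
  have ht0 : 0 ≤ t := norm_nonneg _
  have hp2 : 0 ≤ p - 2 := by linarith
  have hPs := Real.rpow_nonneg hs0 (p - 2)
  have hPt := Real.rpow_nonneg ht0 (p - 2)
  have h1 : ‖ξ - η‖ ^ (p - 2) ≤ 2 ^ (p - 2) * (s ^ (p - 2) + t ^ (p - 2)) := by
    have : ‖ξ - η‖ ≤ 2 * max s t := by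
      have := norm_sub_le ξ η
      linarith [le_max_left s t, le_max_right s t]
    refine (Real.rpow_le_rpow (norm_nonneg _) this hp2).trans ?_
    rw [Real.mul_rpow (by norm_num) (by positivity)]
    refine mul_le_mul_of_nonneg_left ?_ (by positivity)
    rcases max_choice s t with h | h <;> rw [h] <;> linarith
  have h2 : (s ^ (p - 2) + t ^ (p - 2)) * ‖ξ - η‖ ^ 2 ≤
      2 * inner ℝ (s ^ (p - 2) • ξ - t ^ (p - 2) • η) (ξ - η) := by
    have h3 : 0 ≤ (s ^ (p - 2) - t ^ (p - 2)) * (s ^ 2 - t ^ 2) := by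
      rcases le_total s t with h | h
      · exact mul_nonneg_of_nonpos_of_nonpos (sub_nonpos.2 (Real.rpow_le_rpow hs0 h hp2))
          (by nlinarith)
      · exact mul_nonneg (sub_nonneg.2 (Real.rpow_le_rpow ht0 h hp2)) (by nlinarith)
    rw [inner_radial_sub, norm_sub_sq_real, ← hs, ← ht]
    nlinarith
  have h3 : ‖ξ - η‖ ^ p = ‖ξ - η‖ ^ (p - 2) * ‖ξ - η‖ ^ 2 := by
    rw [← Real.rpow_two, ← Real.rpow_add' (norm_nonneg _) (by linarith)]; congr 1; ring
  have h4 : (2 : ℝ) ^ (p - 1) = 2 ^ (p - 2) * 2 := by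
    rw [← Real.rpow_add_one (by norm_num)]; congr 1; ring
  rw [h3, h4]
  calc _ ≤ 2 ^ (p - 2) * (s ^ (p - 2) + t ^ (p - 2)) * ‖ξ - η‖ ^ 2 :=
        mul_le_mul_of_nonneg_right h1 (by positivity)
    _ = 2 ^ (p - 2) * ((s ^ (p - 2) + t ^ (p - 2)) * ‖ξ - η‖ ^ 2) := by ring
    _ ≤ 2 ^ (p - 2) * (2 * inner ℝ (s ^ (p - 2) • ξ - t ^ (p - 2) • η) (ξ - η)) :=
        mul_le_mul_of_nonneg_left h2 (by positivity)
    _ = _ := by ring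

/-- The difference of the two sides is affine in `k = ⟨ξ, η⟩ ∈ [-st, st]`, where `s = ‖ξ‖` and `t =
‖η‖`. It is therefore enough to check parallel (`hX`) and antiparallel (`hY`) vectors. -/
theorem pLaplace_monotone_of_lt_two {p : ℝ} (hp : 1 < p) (hp2 : p < 2) {ξ η : E} (hξ : ξ ≠ 0)
    (hη : η ≠ 0) :
    (p - 1) * (‖ξ‖ + ‖η‖) ^ (p - 2) * ‖ξ - η‖ ^ 2 ≤
      inner ℝ (‖ξ‖ ^ (p - 2) • ξ - ‖η‖ ^ (p - 2) • η) (ξ - η) := by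
  rw [inner_radial_sub, norm_sub_sq_real]
  have hs : 0 < ‖ξ‖ := norm_pos_iff.2 hξ
  have ht : 0 < ‖η‖ := norm_pos_iff.2 hη
  have hk := abs_le.1 (abs_real_inner_le_norm ξ η)
  set s := ‖ξ‖
  set t := ‖η‖
  set k := inner ℝ ξ η
  have e : ∀ x : ℝ, 0 < x → x ^ (p - 2) * x = x ^ (p - 1) := fun x hx => by
    rw [← Real.rpow_add_one hx.ne']; congr 1; ring
  have hX : 0 ≤ (s ^ (p - 2) * s - t ^ (p - 2) * t) * (s - t)
      - (p - 1) * (s + t) ^ (p - 2) * (s - t) ^ 2 := by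
    rcases le_total t s with h | h
    · nlinarith [mul_le_mul_of_nonneg_right (rpow_sub_rpow_ge hp hp2 ht h) (sub_nonneg.2 h)]
    · have := mul_le_mul_of_nonneg_right (rpow_sub_rpow_ge hp hp2 hs h) (sub_nonneg.2 h)
      rw [add_comm t s] at this
      nlinarith
  have hY : 0 ≤ (s ^ (p - 2) * s + t ^ (p - 2) * t) * (s + t)
      - (p - 1) * (s + t) ^ (p - 2) * (s + t) ^ 2 := by
    have h1 := Real.rpow_add_le_add_rpow hs.le ht.le (by linarith : 0 ≤ p - 1) (by linarith)
    rw [← e s hs, ← e t ht, ← e (s + t) (by positivity)] at h1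
    have h2 : (p - 1) * ((s + t) ^ (p - 2) * (s + t)) ≤ (s + t) ^ (p - 2) * (s + t) :=
      mul_le_of_le_one_left (by positivity) (by linarith)
    nlinarith [mul_le_mul_of_nonneg_right (h2.trans h1) (add_pos hs ht).le]
  set a := s ^ (p - 2)
  set b := t ^ (p - 2)
  set m := (s + t) ^ (p - 2)
  have hst : 0 < 2 * (s * t) := by positivity
  -- Affine interpolation between the endpoints `k = st` and `k = -st`, cleared of the denominator
  -- `2st`.
  have hid : 2 * (s * t) * (a * s ^ 2 + b * t ^ 2 - (a + b) * k
      - (p - 1) * m * (s ^ 2 - 2 * k + t ^ 2)) =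
      (s * t + k) * ((a * s - b * t) * (s - t) - (p - 1) * m * (s - t) ^ 2) +
      (s * t - k) * ((a * s + b * t) * (s + t) - (p - 1) * m * (s + t) ^ 2) := by ring
  have h0 : 0 ≤ 2 * (s * t) * (a * s ^ 2 + b * t ^ 2 - (a + b) * k
      - (p - 1) * m * (s ^ 2 - 2 * k + t ^ 2)) := by
    rw [hid]
    exact add_nonneg (mul_nonneg (by linarith [hk.1]) hX) (mul_nonneg (by linarith [hk.2]) hY)
  linarith [nonneg_of_mul_nonneg_right h0 hst]

/-- The error term `δ` covers the singular range `p < 2`. If `‖ξ - η‖ ≥ κ(‖ξ‖ + ‖η‖)`, the weight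
`(‖ξ‖ + ‖η‖)^{p-2}` is bounded below by a multiple of `‖ξ - η‖^{p-2}`. Otherwise `‖ξ - η‖^p` is
absorbed by the error, with `κ` fixed by `κ^p 2^p = δ`. -/
theorem pLaplace_uniform_monotone {p : ℝ} (hp : 1 < p) {δ : ℝ} (hδ : 0 < δ) :
    ∃ C, 0 ≤ C ∧ ∀ ξ η : E, ξ ≠ 0 → η ≠ 0 → ‖ξ - η‖ ^ p ≤
      C * inner ℝ (‖ξ‖ ^ (p - 2) • ξ - ‖η‖ ^ (p - 2) • η) (ξ - η) + δ * (‖ξ‖ ^ p + ‖η‖ ^ p) := by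
  rcases le_or_gt 2 p with h2 | h2
  · refine ⟨2 ^ (p - 1), by positivity, fun ξ η _ _ => ?_⟩
    have := pLaplace_monotone_of_two_le h2 ξ η
    have : 0 ≤ δ * (‖ξ‖ ^ p + ‖η‖ ^ p) := by positivity
    linarith
  · set κ : ℝ := (δ / 2 ^ p) ^ (1 / p) with hκ
    have hp0 : 0 < p := by linarith
    have hκ0 : 0 < κ := by positivity
    have hκp : κ ^ p * 2 ^ p = δ := by
      rw [hκ, ← Real.rpow_mul (by positivity), one_div_mul_cancel hp0.ne', Real.rpow_one]
      field_simp
    refine ⟨κ ^ (p - 2) / (p - 1), div_nonneg (by positivity) (by linarith), fun ξ η hξ hη => ?_⟩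
    have hD := pLaplace_monotone_of_lt_two hp h2 hξ hη
    have hs : 0 < ‖ξ‖ := norm_pos_iff.2 hξ
    have ht : 0 < ‖η‖ := norm_pos_iff.2 hη
    have hp1 : 0 < p - 1 := by linarith
    have hD0 : 0 ≤ inner ℝ (‖ξ‖ ^ (p - 2) • ξ - ‖η‖ ^ (p - 2) • η) (ξ - η) :=
      le_trans (by positivity) hD
    have hC : 0 ≤ κ ^ (p - 2) / (p - 1) := by positivity
    rcases le_total (κ * (‖ξ‖ + ‖η‖)) ‖ξ - η‖ with h | h
    · have h3 : ‖ξ - η‖ ^ (p - 2) ≤ κ ^ (p - 2) * (‖ξ‖ + ‖η‖) ^ (p - 2) := by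
        rw [← Real.mul_rpow hκ0.le (by positivity)]
        exact Real.rpow_le_rpow_of_nonpos (by positivity) h (by linarith)
      have h4 : ‖ξ - η‖ ^ p = ‖ξ - η‖ ^ (p - 2) * ‖ξ - η‖ ^ 2 := by
        rw [← Real.rpow_two, ← Real.rpow_add' (norm_nonneg _) (by linarith)]; congr 1; ring
      have h5 := mul_le_mul_of_nonneg_left hD hC
      have h6 : κ ^ (p - 2) / (p - 1) * ((p - 1) * (‖ξ‖ + ‖η‖) ^ (p - 2) * ‖ξ - η‖ ^ 2) =
          κ ^ (p - 2) * (‖ξ‖ + ‖η‖) ^ (p - 2) * ‖ξ - η‖ ^ 2 := by field_simp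
      have h7 := mul_le_mul_of_nonneg_right h3 (sq_nonneg ‖ξ - η‖)
      have : 0 ≤ δ * (‖ξ‖ ^ p + ‖η‖ ^ p) := by positivity
      linarith
    · have h3 : ‖ξ - η‖ ^ p ≤ κ ^ p * (2 ^ p * (‖ξ‖ ^ p + ‖η‖ ^ p)) := by
        refine (Real.rpow_le_rpow (norm_nonneg _) h hp0.le).trans ?_
        rw [Real.mul_rpow hκ0.le (by positivity)]
        refine mul_le_mul_of_nonneg_left ?_ (by positivity)
        have h4 : ‖ξ‖ + ‖η‖ ≤ 2 * max ‖ξ‖ ‖η‖ := by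
          linarith [le_max_left ‖ξ‖ ‖η‖, le_max_right ‖ξ‖ ‖η‖]
        refine (Real.rpow_le_rpow (by positivity) h4 hp0.le).trans ?_
        rw [Real.mul_rpow (by norm_num) (by positivity)]
        refine mul_le_mul_of_nonneg_left ?_ (by positivity)
        have := Real.rpow_nonneg hs.le p
        have := Real.rpow_nonneg ht.le p
        rcases max_choice ‖ξ‖ ‖η‖ with h | h <;> rw [h] <;> linarith
      rw [← mul_assoc, hκp] at h3
      have := mul_nonneg hC hD0
      linarith

end PLaplace

theorem hasFDerivAt_norm_of_ne_zero {E : Type*} [NormedAddCommGroup E] [InnerProductSpace ℝ E]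
    {ξ : E} (h : ξ ≠ 0) : HasFDerivAt (fun ξ : E => ‖ξ‖) (‖ξ‖⁻¹ • innerSL ℝ ξ) ξ := by
  have hξ : ‖ξ‖ ≠ 0 := norm_ne_zero_iff.2 h
  have h1 := (hasStrictFDerivAt_norm_sq ξ).hasFDerivAt.sqrt (by positivity)
  simp only [Real.sqrt_sq (norm_nonneg _)] at h1
  refine h1.congr_fderiv ?_
  ext v
  simp
  field_simp

/-! ### Growth, coercivity and monotonicity of `a`, and the potential `G`. -/

section Operator

variable {N : ℕ} {p : ℝ} {ϑ a₀ : ℝ → ℝ} {chat c₀ c₁ c₂ : ℝ}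

theorem HypA.differentiableAt (ha : HypA N p ϑ a₀) {t : ℝ} (ht : 0 < t) :
    DifferentiableAt ℝ a₀ t :=
  (ha.contDiffOn.differentiableOn (by simp)).differentiableAt (Ioi_mem_nhds ht)

theorem HypA.differentiableAt_aMap (ha : HypA N p ϑ a₀) {ξ : RN N} (hξ : ξ ≠ 0) :
    DifferentiableAt ℝ (aMap N a₀) ξ := by
  have h1 : DifferentiableAt ℝ (fun ξ : RN N => ‖ξ‖) ξ := differentiableAt_id.norm ℝ hξ
  exact ((ha.differentiableAt (norm_pos_iff.2 hξ)).comp ξ h1).smul differentiableAt_id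

/-- The derivative of `t ↦ t a₀(t)` is pinched between multiples of `ϑ(t) / t`. -/
theorem HypA.hasDerivAt_mul (hN : 1 ≤ N) (ha : HypA N p ϑ a₀) :
    ∃ c₃ > 0, ∃ b' : ℝ → ℝ, ∀ t > 0, HasDerivAt (fun t => t * a₀ t) (b' t) t ∧
      ϑ t / t ≤ b' t ∧ b' t ≤ c₃ * (ϑ t / t) := by
  obtain ⟨c₃, hc₃, hup⟩ := ha.upper
  refine ⟨c₃, hc₃, fun t => deriv (fun t => t * a₀ t) t, fun t ht => ?_⟩
  have hd : HasDerivAt (fun t => t * a₀ t) (deriv (fun t => t * a₀ t) t) t :=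
    (differentiableAt_id.mul (ha.differentiableAt ht)).hasDerivAt
  refine ⟨hd, ?_⟩
  set b' := deriv (fun t => t * a₀ t) t
  -- On the ray through a unit vector `e`, `a(te) = t a₀(t) e`. The bounds on `∇a` tested in the
  -- radial direction thus become bounds on the derivative of `t a₀(t)`.
  set e : RN N := EuclideanSpace.single (⟨0, hN⟩ : Fin N) (1 : ℝ) with he
  have hne : ‖e‖ = 1 := by simp [he]
  have hn : ‖t • e‖ = t := by rw [norm_smul, hne, mul_one, Real.norm_of_nonneg ht.le]
  have h0 : t • e ≠ 0 := by rw [← norm_pos_iff, hn]; exact ht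
  have h1 : HasDerivAt (fun s : ℝ => aMap N a₀ (s • e)) (fderiv ℝ (aMap N a₀) (t • e) e) t := by
    have h2 : HasDerivAt (fun s : ℝ => s • e) e t := by
      simpa using (hasDerivAt_id t).smul_const e
    exact (ha.differentiableAt_aMap h0).hasFDerivAt.comp_hasDerivAt t h2
  have h2 : HasDerivAt (fun s : ℝ => aMap N a₀ (s • e)) (b' • e) t := by
    refine (hd.smul_const e).congr_of_eventuallyEq ?_
    filter_upwards [Ioi_mem_nhds ht] with s hs
    simp only [aMap, norm_smul, hne, mul_one, Real.norm_of_nonneg (le_of_lt hs), smul_smul]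
    rw [mul_comm]
  have h3 := h1.unique h2
  have hl := ha.lower (t • e) h0 e
  have hu := hup (t • e) h0
  rw [hn] at hl hu
  rw [h3, hne, real_inner_smul_left, real_inner_self_eq_norm_sq, hne] at hl
  refine ⟨by simpa using hl, le_trans ?_ hu⟩
  have h4 := (fderiv ℝ (aMap N a₀) (t • e)).le_opNorm e
  rw [h3, norm_smul, hne, mul_one, mul_one] at h4
  exact (le_abs_self b').trans h4

/-- The derivative is at least `ϑ(t)/t - c₁ t^{p-2} ≥ 0`. Hence `a` minus `c₁/(p - 1)` times the
`p`-Laplacian field is still monotone. -/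
theorem HypA.monotoneOn_sub (hN : 1 ≤ N) (hp : 1 < p) (hϑ : IsComparison p ϑ chat c₀ c₁ c₂)
    (ha : HypA N p ϑ a₀) :
    MonotoneOn (fun t => t * a₀ t - c₁ / (p - 1) * t ^ (p - 1)) (Ioi 0) := by
  obtain ⟨c₃, hc₃, b', hb'⟩ := ha.hasDerivAt_mul hN
  have hd : ∀ t > 0, HasDerivAt (fun t => t * a₀ t - c₁ / (p - 1) * t ^ (p - 1))
      (b' t - c₁ * t ^ (p - 2)) t := fun t ht => by
    have h1 := (Real.hasDerivAt_rpow_const (p := p - 1) (Or.inl (ne_of_gt ht))).const_mul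
      (c₁ / (p - 1))
    have h2 : c₁ / (p - 1) * ((p - 1) * t ^ (p - 1 - 1)) = c₁ * t ^ (p - 2) := by
      have : p - 1 ≠ 0 := by linarith
      rw [show p - 1 - 1 = p - 2 by ring]; field_simp
    rw [h2] at h1
    exact (hb' t ht).1.sub h1
  refine monotoneOn_of_deriv_nonneg (convex_Ioi 0)
    (fun t ht => (hd t ht).continuousAt.continuousWithinAt)
    (fun t ht => (hd t (by simpa using ht)).differentiableAt.differentiableWithinAt)
    (fun t ht => ?_)
  rw [interior_Ioi] at ht
  rw [(hd t ht).deriv]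
  have h1 := (hϑ.growth t ht).1
  have h2 : c₁ * t ^ (p - 2) ≤ ϑ t / t := by
    rw [le_div_iff₀ ht, mul_assoc, ← Real.rpow_add_one (ne_of_gt ht)]
    rwa [show p - 2 + 1 = p - 1 by ring]
  linarith [(hb' t ht).2.1]

theorem HypA.lower_bound (hN : 1 ≤ N) (hp : 1 < p) (hϑ : IsComparison p ϑ chat c₀ c₁ c₂)
    (ha : HypA N p ϑ a₀) {t : ℝ} (ht : 0 < t) : c₁ / (p - 1) * t ^ (p - 1) ≤ t * a₀ t := by
  have hlim : Tendsto (fun t => t * a₀ t - c₁ / (p - 1) * t ^ (p - 1)) (𝓝[>] 0) (𝓝 0) := by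
    have h1 : Tendsto (fun t : ℝ => t ^ (p - 1)) (𝓝[>] 0) (𝓝 0) := by
      have := (Real.continuousAt_rpow_const 0 (p - 1) (Or.inr (by linarith))).tendsto
      rw [Real.zero_rpow (by linarith)] at this
      exact this.mono_left nhdsWithin_le_nhds
    simpa using ha.tendsto_zero.sub (h1.const_mul (c₁ / (p - 1)))
  have := le_of_tendsto hlim (b := t * a₀ t - c₁ / (p - 1) * t ^ (p - 1)) (by
    filter_upwards [Ioc_mem_nhdsGT ht] with s hs
    exact ha.monotoneOn_sub hN hp hϑ hs.1 ht hs.2)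
  linarith

/-- The bound on the derivative is integrated only over `[1, ∞)`, where `1 + t^{p-1} ≤ 2t^{p-1}`. On
`(0, 1]` monotonicity gives `t a₀(t) ≤ a₀(1)`. -/
theorem HypA.upper_bound (hN : 1 ≤ N) (hp : 1 < p) (hϑ : IsComparison p ϑ chat c₀ c₁ c₂)
    (ha : HypA N p ϑ a₀) : ∃ B, 0 ≤ B ∧ ∀ t > 0, t * a₀ t ≤ B * (1 + t ^ (p - 1)) := by
  obtain ⟨c₃, hc₃, b', hb'⟩ := ha.hasDerivAt_mul hN
  have hp1 : 0 < p - 1 := by linarith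
  have hc₂ := hϑ.c₂_pos
  have ha1 := ha.pos 1 one_pos
  set K := 2 * c₃ * c₂ / (p - 1) with hK
  have hK0 : 0 ≤ K := by positivity
  have hd : ∀ t > 0, HasDerivAt (fun t => K * t ^ (p - 1) - t * a₀ t)
      (2 * c₃ * c₂ * t ^ (p - 2) - b' t) t := fun t ht => by
    have h1 := (Real.hasDerivAt_rpow_const (p := p - 1) (Or.inl (ne_of_gt ht))).const_mul K
    have h2 : K * ((p - 1) * t ^ (p - 1 - 1)) = 2 * c₃ * c₂ * t ^ (p - 2) := by
      rw [show p - 1 - 1 = p - 2 by ring, hK]; field_simp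
    rw [h2] at h1
    exact h1.sub (hb' t ht).1
  have hmono : MonotoneOn (fun t => K * t ^ (p - 1) - t * a₀ t) (Ici 1) := by
    refine monotoneOn_of_deriv_nonneg (convex_Ici 1)
      (fun t ht => (hd t (one_pos.trans_le ht)).continuousAt.continuousWithinAt)
      (fun t ht => ?_) (fun t ht => ?_)
    · rw [interior_Ici] at ht
      exact (hd t (one_pos.trans ht)).differentiableAt.differentiableWithinAt
    · rw [interior_Ici] at ht
      have ht1 : 1 < t := ht
      have ht0 : 0 < t := one_pos.trans ht
      rw [(hd t ht0).deriv]
      have h1 := (hϑ.growth t ht0).2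
      have h2 : 1 ≤ t ^ (p - 1) := Real.one_le_rpow ht1.le hp1.le
      have h3 : ϑ t / t ≤ 2 * c₂ * t ^ (p - 2) := by
        rw [div_le_iff₀ ht0, mul_assoc, ← Real.rpow_add_one ht0.ne',
          show p - 2 + 1 = p - 1 by ring]
        nlinarith
      have h4 := (hb' t ht0).2.2
      nlinarith [mul_le_mul_of_nonneg_left h3 hc₃.le]
  refine ⟨a₀ 1 + K, by positivity, fun t ht => ?_⟩
  have htp : 0 ≤ t ^ (p - 1) := by positivity
  rcases le_total t 1 with h | h
  · have := ha.strictMono.monotoneOn ht (mem_Ioi.2 one_pos) h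
    simp only [one_mul] at this
    nlinarith [mul_nonneg ha1.le htp, mul_nonneg hK0 htp]
  · have := hmono (mem_Ici.2 le_rfl) h h
    simp only [one_mul, Real.one_rpow, mul_one] at this
    nlinarith [mul_nonneg ha1.le htp, mul_nonneg hK0 htp]

theorem HypA.norm_aMap (ha : HypA N p ϑ a₀) (ξ : RN N) : ‖aMap N a₀ ξ‖ = ‖ξ‖ * a₀ ‖ξ‖ := by
  rcases eq_or_ne ξ 0 with rfl | h
  · simp [aMap]
  · rw [aMap, norm_smul, Real.norm_of_nonneg (ha.pos _ (norm_pos_iff.2 h)).le, mul_comm]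

theorem HypA.norm_aMap_le (hN : 1 ≤ N) (hp : 1 < p) (hϑ : IsComparison p ϑ chat c₀ c₁ c₂)
    (ha : HypA N p ϑ a₀) : ∃ B, ∀ ξ : RN N, ‖aMap N a₀ ξ‖ ≤ B * (1 + ‖ξ‖ ^ (p - 1)) := by
  obtain ⟨B, hB0, hB⟩ := ha.upper_bound hN hp hϑ
  refine ⟨B, fun ξ => ?_⟩
  rw [ha.norm_aMap]
  rcases eq_or_ne ξ 0 with rfl | h
  · rw [norm_zero, zero_mul]; positivity
  · exact hB _ (norm_pos_iff.2 h)

theorem HypA.inner_aMap_self (hN : 1 ≤ N) (hp : 1 < p) (hϑ : IsComparison p ϑ chat c₀ c₁ c₂)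
    (ha : HypA N p ϑ a₀) (ξ : RN N) :
    c₁ / (p - 1) * ‖ξ‖ ^ p ≤ inner ℝ (aMap N a₀ ξ) ξ := by
  rcases eq_or_ne ξ 0 with rfl | h
  · simp [Real.zero_rpow (by linarith : p ≠ 0)]
  · have hξ := norm_pos_iff.2 h
    rw [aMap, real_inner_smul_left, real_inner_self_eq_norm_sq]
    have h1 := mul_le_mul_of_nonneg_right (ha.lower_bound hN hp hϑ hξ) hξ.le
    rw [mul_assoc, ← Real.rpow_add_one hξ.ne', sub_add_cancel] at h1
    linarith

theorem HypA.continuousOn_mul (ha : HypA N p ϑ a₀) :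
    ContinuousOn (fun t => t * a₀ t) (Ici 0) := by
  intro t ht
  rcases eq_or_lt_of_le (show (0 : ℝ) ≤ t from ht) with rfl | h
  · rw [← continuousWithinAt_Ioi_iff_Ici, ContinuousWithinAt, zero_mul]
    exact ha.tendsto_zero
  · exact (continuousAt_id.mul (ha.differentiableAt h).continuousAt).continuousWithinAt

theorem HypA.continuous_mul_max (ha : HypA N p ϑ a₀) :
    Continuous fun t : ℝ => max t 0 * a₀ (max t 0) :=
  ha.continuousOn_mul.comp_continuous (continuous_id.max continuous_const) fun _ =>
    mem_Ici.2 (le_max_right _ _)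

theorem HypA.continuous_aMap (ha : HypA N p ϑ a₀) : Continuous (aMap N a₀) := by
  rw [continuous_iff_continuousAt]
  intro ξ
  rcases eq_or_ne ξ 0 with rfl | h
  · have h1 : Tendsto (fun ξ : RN N => max ‖ξ‖ 0 * a₀ (max ‖ξ‖ 0)) (𝓝 0) (𝓝 0) := by
      have := (ha.continuous_mul_max.comp (continuous_norm (E := RN N))).tendsto 0
      simpa [Function.comp_def] using this
    rw [ContinuousAt, show aMap N a₀ 0 = 0 by simp [aMap], tendsto_zero_iff_norm_tendsto_zero]
    refine h1.congr fun ξ => ?_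
    rw [ha.norm_aMap, max_eq_left (norm_nonneg _)]
  · exact (ha.differentiableAt_aMap h).continuousAt

theorem HypA.hasFDerivAt_GFun (ha : HypA N p ϑ a₀) (ξ : RN N) :
    HasFDerivAt (GFun N a₀) (innerSL ℝ (aMap N a₀ ξ)) ξ := by
  -- A continuous extension of `t a₀(t)` to the whole line, zero for `t ≤ 0`. It makes the
  -- fundamental theorem of calculus available at `t = 0` too, where `b 0 = 0` gives `G₀(t) = o(t)`.
  set b : ℝ → ℝ := fun t => max t 0 * a₀ (max t 0) with hb
  have hbc : Continuous b := ha.continuous_mul_max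
  have hG : GFun N a₀ = fun ξ => ∫ s in (0 : ℝ)..‖ξ‖, b s := by
    funext ξ
    rw [GFun, G₀]
    refine intervalIntegral.integral_congr fun s hs => ?_
    rw [uIcc_of_le (norm_nonneg _)] at hs
    simp only [hb, max_eq_left hs.1]
  have hd : ∀ t, HasDerivAt (fun t => ∫ s in (0 : ℝ)..t, b s) (b t) t := fun t =>
    intervalIntegral.integral_hasDerivAt_right (hbc.intervalIntegrable _ _)
      (hbc.stronglyMeasurableAtFilter _ _) hbc.continuousAt
  rw [hG]
  rcases eq_or_ne ξ 0 with rfl | h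
  · have hb0 : b 0 = 0 := by simp [hb]
    have hz : aMap N a₀ 0 = 0 := by simp [aMap]
    rw [hz, map_zero, hasFDerivAt_iff_isLittleO]
    have h1 := (hasDerivAt_iff_isLittleO.1 (hd 0)).comp_tendsto
      (show Tendsto (fun ξ : RN N => ‖ξ‖) (𝓝 0) (𝓝 0) by simpa using (continuous_norm (E := RN N)).tendsto 0)
    simp only [hb0, Function.comp_def] at h1
    rw [Asymptotics.isLittleO_norm_right.symm]
    simpa [Function.comp_def] using h1
  · have hn := hasFDerivAt_norm_of_ne_zero h
    refine ((hd ‖ξ‖).comp_hasFDerivAt ξ hn).congr_fderiv ?_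
    ext v
    simp only [hb, max_eq_left (norm_nonneg ξ), aMap]
    have hξ : ‖ξ‖ ≠ 0 := norm_ne_zero_iff.2 h
    simp only [smul_apply, innerSL_apply_apply, smul_eq_mul, real_inner_smul_left]
    field_simp

/-- Write `a` as `c` times the `p`-Laplacian field plus a monotone radial remainder, which only
helps. If one vector is zero, coercivity of `a` suffices; the constant uses `C + 1` rather than `C`
to cover this case. -/
theorem HypA.uniform_monotone (hN : 1 ≤ N) (hp : 1 < p) (hϑ : IsComparison p ϑ chat c₀ c₁ c₂)
    (ha : HypA N p ϑ a₀) {δ : ℝ} (hδ : 0 < δ) :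
    ∃ C, 0 ≤ C ∧ ∀ ξ η : RN N, ‖ξ - η‖ ^ p ≤
      C * inner ℝ (aMap N a₀ ξ - aMap N a₀ η) (ξ - η) + δ * (‖ξ‖ ^ p + ‖η‖ ^ p) := by
  obtain ⟨C, hC, h⟩ := pLaplace_uniform_monotone (E := RN N) hp hδ
  set c := c₁ / (p - 1) with hc
  have hc0 : 0 < c := div_pos hϑ.c₁_pos (by linarith)
  have hone : ∀ ξ : RN N, ‖ξ‖ ^ p ≤ (C + 1) / c * inner ℝ (aMap N a₀ ξ) ξ := fun ξ => by
    have h1 := mul_le_mul_of_nonneg_left (ha.inner_aMap_self hN hp hϑ ξ)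
      (by positivity : 0 ≤ (C + 1) / c)
    have h2 : (C + 1) / c * (c * ‖ξ‖ ^ p) = (C + 1) * ‖ξ‖ ^ p := by field_simp
    have h3 : 0 ≤ C * ‖ξ‖ ^ p := by positivity
    rw [← hc] at h1
    linarith
  refine ⟨(C + 1) / c, by positivity, fun ξ η => ?_⟩
  have hz : aMap N a₀ 0 = 0 := by simp [aMap]
  have hnn : 0 ≤ δ * (‖ξ‖ ^ p + ‖η‖ ^ p) := by positivity
  rcases eq_or_ne ξ 0 with rfl | hξ
  · have := hone η
    rw [hz, zero_sub, zero_sub, norm_neg, inner_neg_neg]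
    linarith
  rcases eq_or_ne η 0 with rfl | hη
  · have := hone ξ
    rw [hz, sub_zero, sub_zero]
    linarith
  have hs := norm_pos_iff.2 hξ
  have ht := norm_pos_iff.2 hη
  have e : ∀ x : ℝ, 0 < x → x ^ (p - 2) * x = x ^ (p - 1) := fun x hx => by
    rw [← Real.rpow_add_one hx.ne']; congr 1; ring
  have hw : ∀ x : ℝ, 0 < x → 0 ≤ a₀ x - c * x ^ (p - 2) := fun x hx => by
    have h1 := ha.lower_bound hN hp hϑ hx
    rw [← e x hx] at h1
    have : 0 ≤ (a₀ x - c * x ^ (p - 2)) * x := by rw [← hc] at h1; linarith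
    exact nonneg_of_mul_nonneg_left this hx
  have hm := ha.monotoneOn_sub hN hp hϑ
  have hmul : 0 ≤ ((a₀ ‖ξ‖ - c * ‖ξ‖ ^ (p - 2)) * ‖ξ‖ - (a₀ ‖η‖ - c * ‖η‖ ^ (p - 2)) * ‖η‖) *
      (‖ξ‖ - ‖η‖) := by
    have e' : ∀ x : ℝ, 0 < x → (a₀ x - c * x ^ (p - 2)) * x = x * a₀ x - c * x ^ (p - 1) :=
      fun x hx => by rw [← e x hx]; ring
    rw [e' _ hs, e' _ ht]
    rcases le_total ‖ξ‖ ‖η‖ with h1 | h1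
    · exact mul_nonneg_of_nonpos_of_nonpos (sub_nonpos.2 (hm hs ht h1)) (sub_nonpos.2 h1)
    · exact mul_nonneg (sub_nonneg.2 (hm ht hs h1)) (sub_nonneg.2 h1)
  have h1 := inner_radial_sub_nonneg (hw _ hs) (hw _ ht) ξ η hmul
  have h2 : inner ℝ (aMap N a₀ ξ - aMap N a₀ η) (ξ - η) =
      inner ℝ ((a₀ ‖ξ‖ - c * ‖ξ‖ ^ (p - 2)) • ξ - (a₀ ‖η‖ - c * ‖η‖ ^ (p - 2)) • η) (ξ - η) +
      c * inner ℝ (‖ξ‖ ^ (p - 2) • ξ - ‖η‖ ^ (p - 2) • η) (ξ - η) := by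
    simp only [aMap, inner_radial_sub]; ring
  have h3 := h ξ η hξ hη
  set D := inner ℝ (‖ξ‖ ^ (p - 2) • ξ - ‖η‖ ^ (p - 2) • η) (ξ - η)
  have hD : 0 ≤ D := by
    refine inner_radial_sub_nonneg (by positivity) (by positivity) ξ η ?_
    rw [e _ hs, e _ ht]
    rcases le_total ‖ξ‖ ‖η‖ with h1 | h1
    · exact mul_nonneg_of_nonpos_of_nonpos
        (sub_nonpos.2 (Real.rpow_le_rpow hs.le h1 (by linarith))) (sub_nonpos.2 h1)
    · exact mul_nonneg (sub_nonneg.2 (Real.rpow_le_rpow ht.le h1 (by linarith)))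
        (sub_nonneg.2 h1)
  have h4 : C * D ≤ (C + 1) / c * inner ℝ (aMap N a₀ ξ - aMap N a₀ η) (ξ - η) := by
    have h5 : (C + 1) / c * (c * D) = (C + 1) * D := by field_simp
    rw [h2, mul_add, h5]
    have := mul_nonneg (by positivity : 0 ≤ (C + 1) / c) h1
    linarith
  linarith

end Operator

open scoped NNReal

/-! ### Sobolev inequalities for test functions. -/

section Sobolev

variable {N : ℕ} {Ω : Set (RN N)}

theorem norm_gradient (ψ : RN N → ℝ) (x : RN N) : ‖gradient ψ x‖ = ‖fderiv ℝ ψ x‖ :=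
  LinearIsometryEquiv.norm_map _ _

theorem IsTestFunction.eLpNorm_fderiv {ψ : RN N → ℝ} (hψ : IsTestFunction Ω ψ) (s : ℝ≥0∞) :
    eLpNorm (fderiv ℝ ψ) s volume = eLpNorm (gradient ψ) s (volume.restrict Ω) := by
  rw [eLpNorm_restrict_eq_of_support_subset]
  · exact eLpNorm_congr_norm_ae (ae_of_all _ fun x => (norm_gradient ψ x).symm)
  · intro x hx
    refine hψ.tsupport_subset (support_fderiv_subset ℝ ?_)
    rw [Function.mem_support, ← norm_pos_iff, norm_gradient, norm_pos_iff] at hx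
    exact hx

theorem IsTestFunction.support_subset {ψ : RN N → ℝ} (hψ : IsTestFunction Ω ψ) :
    Function.support ψ ⊆ Ω := (subset_tsupport ψ).trans hψ.tsupport_subset

theorem IsTestFunction.continuous_gradient {ψ : RN N → ℝ} (hψ : IsTestFunction Ω ψ) :
    Continuous (gradient ψ) :=
  (LinearIsometryEquiv.continuous _).comp (hψ.contDiff.continuous_fderiv (by simp))

/-- The fundamental theorem of calculus on a half-line, transported to `RN 1` by a linear isometry.
-/
theorem enorm_le_lintegral_fderiv_of_one {ψ : RN 1 → ℝ} (hψ : ContDiff ℝ 1 ψ)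
    (hc : HasCompactSupport ψ) (x : RN 1) : ‖ψ x‖ₑ ≤ ∫⁻ y, ‖fderiv ℝ ψ y‖ₑ := by
  have hcard : Module.finrank ℝ ℝ = 1 := by simp
  let L : ℝ ≃ₗᵢ[ℝ] RN 1 := (stdOrthonormalBasis ℝ ℝ).equiv (EuclideanSpace.basisFun (Fin 1) ℝ)
    (finCongr hcard)
  have hφ : ContDiff ℝ 1 (ψ ∘ L) := hψ.comp L.toContinuousLinearEquiv.contDiff
  have hφc : HasCompactSupport (ψ ∘ L) := hc.comp_homeomorph L.toHomeomorph
  have h1 := hφc.enorm_le_lintegral_Ici_deriv hφ (L.symm x)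
  rw [Function.comp_apply, L.apply_symm_apply] at h1
  refine h1.trans ((setLIntegral_le_lintegral _ _).trans ?_)
  have h2 : ∀ t, ‖deriv (ψ ∘ L) t‖ₑ ≤ ‖fderiv ℝ ψ (L t)‖ₑ := by
    intro t
    have hL : HasDerivAt (fun t => L t) (L 1) t := by
      simpa using (L.toContinuousLinearEquiv.hasFDerivAt (x := t)).hasDerivAt
    have := ((hψ.differentiable (by simp) (L t)).hasFDerivAt.comp_hasDerivAt t hL).deriv
    rw [this, enorm_le_iff_norm_le]
    refine (ContinuousLinearMap.le_opNorm _ _).trans ?_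
    rw [L.norm_map, norm_one, mul_one]
  refine (lintegral_mono h2).trans ?_
  exact (L.measurePreserving.lintegral_comp_emb L.toHomeomorph.measurableEmbedding
    (fun y => ‖fderiv ℝ ψ y‖ₑ)).le

/-- The exponent condition says `q ≤ p^*` when `p < N`, where the Gagliardo–Nirenberg–Sobolev
inequality applies directly. For `p ≥ N`, boundedness of `Ω` permits lowering `p` to a suitable `p₀
< N` if `N ≥ 2`, and to `1` if `N = 1`. -/
theorem sobolev_test (hN : 1 ≤ N) (hb : Bornology.IsBounded Ω) {p q : ℝ} (hp : 1 < p) (hq : 1 ≤ q)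
    (hpq : p < N → p⁻¹ - (N : ℝ)⁻¹ ≤ q⁻¹) :
    ∃ C : ℝ≥0, ∀ ψ : RN N → ℝ, IsTestFunction Ω ψ →
      eLpNorm ψ (ENNReal.ofReal q) (volume.restrict Ω) ≤
        C * eLpNorm (gradient ψ) (ENNReal.ofReal p) (volume.restrict Ω) := by
  have hfin : volume Ω ≠ ⊤ := hb.measure_lt_top.ne
  have hrank : Module.finrank ℝ (RN N) = N := by simp
  have hN0 : (0 : ℝ) < N := by exact_mod_cast hN
  have hlow : ∀ p₀ : ℝ, 1 ≤ p₀ → p₀ ≤ p → ∃ D : ℝ≥0, ∀ ψ : RN N → ℝ, IsTestFunction Ω ψ →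
      eLpNorm (gradient ψ) (ENNReal.ofReal p₀) (volume.restrict Ω) ≤
        D * eLpNorm (gradient ψ) (ENNReal.ofReal p) (volume.restrict Ω) := by
    intro p₀ hp₀ hp₀p
    have hexp : 0 ≤ 1 / (ENNReal.ofReal p₀).toReal - 1 / (ENNReal.ofReal p).toReal := by
      rw [ENNReal.toReal_ofReal (by linarith), ENNReal.toReal_ofReal (by linarith), sub_nonneg]
      exact one_div_le_one_div_of_le (by linarith) hp₀p
    refine ⟨((volume.restrict Ω) univ ^ (1 / (ENNReal.ofReal p₀).toReal
      - 1 / (ENNReal.ofReal p).toReal)).toNNReal, fun ψ hψ => ?_⟩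
    rw [ENNReal.coe_toNNReal (ENNReal.rpow_ne_top_of_nonneg hexp (by simpa using hfin)), mul_comm]
    exact eLpNorm_le_eLpNorm_mul_rpow_measure_univ (ENNReal.ofReal_le_ofReal hp₀p)
      hψ.continuous_gradient.aestronglyMeasurable
  have hgns : ∀ p₀ : ℝ, 1 ≤ p₀ → p₀ < N → p₀⁻¹ - (N : ℝ)⁻¹ ≤ q⁻¹ → ∃ C : ℝ≥0,
      ∀ ψ : RN N → ℝ, IsTestFunction Ω ψ →
      eLpNorm ψ (ENNReal.ofReal q) (volume.restrict Ω) ≤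
        C * eLpNorm (gradient ψ) (ENNReal.ofReal p₀) (volume.restrict Ω) := by
    intro p₀ hp₀ hp₀N hpq₀
    refine ⟨eLpNormLESNormFDerivOfLeConst ℝ (volume : Measure (RN N)) Ω p₀.toNNReal q.toNNReal,
      fun ψ hψ => ?_⟩
    rw [← hψ.eLpNorm_fderiv, eLpNorm_restrict_eq_of_support_subset hψ.support_subset]
    refine eLpNorm_le_eLpNorm_fderiv_of_le volume (hψ.contDiff.of_le (by simp))
      hψ.support_subset (by simpa using hp₀) ?_ ?_ hb
    · rw [hrank, ← NNReal.coe_lt_coe, Real.coe_toNNReal _ (by linarith)]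
      simpa using hp₀N
    · rw [hrank, NNReal.coe_inv, Real.coe_toNNReal _ (by linarith), Real.coe_toNNReal _ (by linarith)]
      exact hpq₀
  rcases lt_or_ge p N with hpN | hpN
  · exact hgns p hp.le hpN (hpq hpN)
  rcases Nat.lt_or_ge 1 N with hN2 | hN1
  · have hN2' : (2 : ℝ) ≤ N := by exact_mod_cast hN2
    set q₁ := max q 2 with hq₁
    have hq2 : 2 ≤ q₁ := le_max_right _ _
    have hqq : q ≤ q₁ := le_max_left _ _
    -- The exponent whose critical Sobolev exponent is `q₁`; `q₁ ≥ 2` and `N ≥ 2` ensure `p₀ ≥ 1`.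
    set p₀ : ℝ := N * q₁ / (N + q₁) with hp₀
    have h1 : 1 ≤ p₀ := by rw [hp₀, le_div_iff₀ (by positivity)]; nlinarith
    have h2 : p₀ < N := by rw [hp₀, div_lt_iff₀ (by positivity)]; nlinarith
    have h3 : p₀⁻¹ - (N : ℝ)⁻¹ ≤ q⁻¹ := by
      have : p₀⁻¹ - (N : ℝ)⁻¹ = q₁⁻¹ := by
        have : q₁ ≠ 0 := by linarith
        rw [hp₀]; field_simp; ring
      rw [this]
      exact inv_anti₀ (by linarith) hqq
    obtain ⟨C, hC⟩ := hgns p₀ h1 h2 h3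
    obtain ⟨D, hD⟩ := hlow p₀ h1 (by linarith)
    refine ⟨C * D, fun ψ hψ => (hC ψ hψ).trans ?_⟩
    rw [ENNReal.coe_mul, mul_assoc]
    gcongr
    exact hD ψ hψ
  · obtain rfl : N = 1 := by omega
    obtain ⟨D, hD⟩ := hlow 1 le_rfl hp.le
    rw [ENNReal.ofReal_one] at hD
    have hexp : 0 ≤ (ENNReal.ofReal q).toReal⁻¹ := by positivity
    refine ⟨((volume.restrict Ω) univ ^ ((ENNReal.ofReal q).toReal⁻¹)).toNNReal * D,
      fun ψ hψ => ?_⟩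
    rw [ENNReal.coe_mul,
      ENNReal.coe_toNNReal (ENNReal.rpow_ne_top_of_nonneg hexp (by simpa using hfin)), mul_assoc]
    have hle : ∀ x, ‖ψ x‖ₑ ≤ eLpNorm (gradient ψ) 1 (volume.restrict Ω) := fun x => by
      rw [← hψ.eLpNorm_fderiv, eLpNorm_one_eq_lintegral_enorm]
      exact enorm_le_lintegral_fderiv_of_one (hψ.contDiff.of_le (by simp)) hψ.hasCompactSupport x
    have h1 : eLpNorm ψ (ENNReal.ofReal q) (volume.restrict Ω) ≤
        eLpNorm (gradient ψ) 1 (volume.restrict Ω) *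
          (volume.restrict Ω) univ ^ ((ENNReal.ofReal q).toReal⁻¹) := by
      refine le_trans (eLpNorm_le_of_ae_enorm_bound (ae_of_all _ hle)) ?_
      rw [smul_eq_mul]
    refine h1.trans ?_
    rw [mul_comm]
    gcongr
    exact hD ψ hψ

end Sobolev

/-! ### Embeddings of `W^{1,p}_0(Ω)`. -/

section SobolevSpace

variable {N : ℕ} {Ω : Set (RN N)} {p : ℝ} [Fact (1 < p)]

/-- The weak gradient as a bounded operator. -/
def W1p0.gradL (Ω : Set (RN N)) (p : ℝ) [Fact (1 < p)] :
    W1p0 Ω p →L[ℝ] Lp (RN N) (ENNReal.ofReal p) (volume.restrict Ω) :=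
  (WithLp.sndL (ENNReal.ofReal p) ℝ _ _).comp (testPairs Ω p).topologicalClosure.subtypeL

/-- The inclusion into `L^p` as a bounded operator. -/
def W1p0.fnL (Ω : Set (RN N)) (p : ℝ) [Fact (1 < p)] :
    W1p0 Ω p →L[ℝ] Lp ℝ (ENNReal.ofReal p) (volume.restrict Ω) :=
  (WithLp.fstL (ENNReal.ofReal p) ℝ _ _).comp (testPairs Ω p).topologicalClosure.subtypeL

theorem W1p0.coe_gradL (u : W1p0 Ω p) : (W1p0.gradL Ω p u : RN N → RN N) = u.grad := rfl

theorem W1p0.coe_fnL (u : W1p0 Ω p) : (W1p0.fnL Ω p u : RN N → ℝ) = u.fn := rfl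

theorem W1p0.fn_add (u v : W1p0 Ω p) :
    (u + v).fn =ᵐ[volume.restrict Ω] fun x => u.fn x + v.fn x := by
  rw [← W1p0.coe_fnL, map_add]
  exact Lp.coeFn_add _ _

theorem W1p0.fn_smul (c : ℝ) (u : W1p0 Ω p) :
    (c • u).fn =ᵐ[volume.restrict Ω] fun x => c * u.fn x := by
  rw [← W1p0.coe_fnL, map_smul]
  exact Lp.coeFn_smul _ _

theorem W1p0.norm_le (u : W1p0 Ω p) : ‖u‖ ≤ ‖W1p0.fnL Ω p u‖ + ‖W1p0.gradL Ω p u‖ := by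
  have hp : 1 < p := Fact.out
  have h1 : ‖u‖ = (‖W1p0.fnL Ω p u‖ ^ p + ‖W1p0.gradL Ω p u‖ ^ p) ^ (1 / p) := by
    have := WithLp.prod_norm_eq_add (p := ENNReal.ofReal p)
      (by rw [ENNReal.toReal_ofReal] <;> linarith) (u : LpPair Ω p)
    rw [ENNReal.toReal_ofReal (by linarith)] at this
    exact this
  rw [h1]
  exact Real.rpow_add_rpow_le_add (norm_nonneg _) (norm_nonneg _) hp.le

/-- The element of `W^{1,p}_0(Ω)` attached to a test function approximates every element. -/
theorem W1p0.exists_test_seq (u : W1p0 Ω p) : ∃ (w : ℕ → W1p0 Ω p) (ψ : ℕ → RN N → ℝ),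
    Tendsto w atTop (𝓝 u) ∧ ∀ n, IsTestFunction Ω (ψ n) ∧
      (w n).fn =ᵐ[volume.restrict Ω] ψ n ∧ (w n).grad =ᵐ[volume.restrict Ω] gradient (ψ n) := by
  obtain ⟨w, hw, hlim⟩ := mem_closure_iff_seq_limit.1 u.2
  choose ψ hψ using id hw
  exact ⟨fun n => ⟨w n, subset_closure (hw n)⟩, ψ, tendsto_subtype_rng.2 hlim,
    fun n => ⟨(hψ n).1, (hψ n).2.1, (hψ n).2.2⟩⟩

/-- Approximation by test functions: a subsequence converges a.e., and by Fatou's lemma the `L^q`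
norm is lower semicontinuous along it. -/
theorem W1p0.sobolev (hN : 1 ≤ N) (hb : Bornology.IsBounded Ω) {q : ℝ} (hq : 1 ≤ q)
    (hpq : p < N → p⁻¹ - (N : ℝ)⁻¹ ≤ q⁻¹) : ∃ C : ℝ≥0, ∀ u : W1p0 Ω p,
      eLpNorm u.fn (ENNReal.ofReal q) (volume.restrict Ω) ≤ C * ‖W1p0.gradL Ω p u‖ₑ := by
  obtain ⟨C, hC⟩ := sobolev_test hN hb (Fact.out : 1 < p) hq hpq
  refine ⟨C, fun u => ?_⟩
  obtain ⟨w, ψ, hw, hψ⟩ := u.exists_test_seq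
  have h1 : Tendsto (fun n => W1p0.fnL Ω p (w n)) atTop (𝓝 (W1p0.fnL Ω p u)) :=
    ((W1p0.fnL Ω p).continuous.tendsto u).comp hw
  have h2 : Tendsto (fun n => (C : ℝ≥0∞) * ‖W1p0.gradL Ω p (w n)‖ₑ) atTop
      (𝓝 (C * ‖W1p0.gradL Ω p u‖ₑ)) :=
    ENNReal.Tendsto.const_mul ((continuous_enorm.tendsto _).comp
      (((W1p0.gradL Ω p).continuous.tendsto u).comp hw)) (Or.inr ENNReal.coe_ne_top)
  obtain ⟨ns, hns, hae⟩ := (tendstoInMeasure_of_tendsto_Lp h1).exists_seq_tendsto_ae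
  refine (Lp.eLpNorm_lim_le_liminf_eLpNorm (fun n => Lp.aestronglyMeasurable _) _ hae).trans ?_
  rw [← (h2.comp hns.tendsto_atTop).liminf_eq]
  refine liminf_le_liminf (Eventually.of_forall fun n => ?_)
  rw [Function.comp_apply, W1p0.coe_fnL, eLpNorm_congr_ae (hψ (ns n)).2.1, Lp.enorm_def,
    W1p0.coe_gradL, eLpNorm_congr_ae (hψ (ns n)).2.2]
  exact hC _ (hψ (ns n)).1

theorem W1p0.exists_embedding (hN : 1 ≤ N) (hb : Bornology.IsBounded Ω) {q : ℝ} (hq : 1 ≤ q)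
    {s : ℝ≥0∞} (hs : s = ENNReal.ofReal q) [Fact (1 ≤ s)]
    (hpq : p < N → p⁻¹ - (N : ℝ)⁻¹ ≤ q⁻¹) :
    ∃ J : W1p0 Ω p →L[ℝ] Lp ℝ s (volume.restrict Ω),
      (∀ u, J u =ᵐ[volume.restrict Ω] u.fn) ∧ ∃ C : ℝ, 0 ≤ C ∧ ∀ u, ‖J u‖ ≤ C * ‖W1p0.gradL Ω p u‖ := by
  subst hs
  obtain ⟨C, hC⟩ := W1p0.sobolev (p := p) hN hb hq hpq
  have hmem : ∀ u : W1p0 Ω p, MemLp u.fn (ENNReal.ofReal q) (volume.restrict Ω) := fun u =>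
    ⟨Lp.aestronglyMeasurable (W1p0.fnL Ω p u),
      (hC u).trans_lt (ENNReal.mul_lt_top ENNReal.coe_lt_top enorm_lt_top)⟩
  have hbd : ∀ u : W1p0 Ω p, ‖(hmem u).toLp‖ ≤ C * ‖W1p0.gradL Ω p u‖ := fun u => by
    rw [Lp.norm_toLp]
    refine ENNReal.toReal_le_of_le_ofReal (by positivity) ((hC u).trans_eq ?_)
    rw [ENNReal.ofReal_mul (by positivity), ofReal_norm, ENNReal.ofReal_coe_nnreal]
  let J₀ : W1p0 Ω p →ₗ[ℝ] Lp ℝ (ENNReal.ofReal q) (volume.restrict Ω) :=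
    { toFun := fun u => (hmem u).toLp
      map_add' := fun u v => by
        rw [← MemLp.toLp_add]
        exact MemLp.toLp_congr _ _ (W1p0.fn_add u v)
      map_smul' := fun c u => by
        rw [RingHom.id_apply, ← MemLp.toLp_const_smul]
        exact MemLp.toLp_congr _ _ (W1p0.fn_smul c u) }
  refine ⟨J₀.mkContinuous (C * ‖W1p0.gradL Ω p‖) fun u => (hbd u).trans ?_,
    fun u => (hmem u).coeFn_toLp, C, C.2, hbd⟩
  rw [mul_assoc]
  exact mul_le_mul_of_nonneg_left ((W1p0.gradL Ω p).le_opNorm u) C.2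

end SobolevSpace

/-! ### Translation estimate in `L¹`. -/

section Translation

variable {N : ℕ}

/-- The increment is the integral of the derivative along the segment; Tonelli and translation
invariance finish. -/
theorem lintegral_enorm_translate_sub_le {ψ : RN N → ℝ} (hψ : ContDiff ℝ 1 ψ) (z : RN N) :
    ∫⁻ x, ‖ψ (x + z) - ψ x‖ₑ ≤ ‖z‖ₑ * ∫⁻ x, ‖fderiv ℝ ψ x‖ₑ := by
  have hcf : Continuous (fderiv ℝ ψ) := hψ.continuous_fderiv (by simp)
  have h1 : ∀ x, ‖ψ (x + z) - ψ x‖ₑ ≤ ∫⁻ t in Ioc (0 : ℝ) 1, ‖z‖ₑ * ‖fderiv ℝ ψ (x + t • z)‖ₑ := by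
    intro x
    have hd : ∀ t : ℝ, HasDerivAt (fun t : ℝ => ψ (x + t • z)) (fderiv ℝ ψ (x + t • z) z) t := by
      intro t
      have h2 : HasDerivAt (fun t : ℝ => x + t • z) z t := by
        simpa using ((hasDerivAt_id t).smul_const z).const_add x
      exact (hψ.differentiable (by simp) (x + t • z)).hasFDerivAt.comp_hasDerivAt t h2
    have hc : Continuous fun t : ℝ => fderiv ℝ ψ (x + t • z) z := by fun_prop
    have h3 := intervalIntegral.integral_eq_sub_of_hasDerivAt (a := 0) (b := 1)
      (fun t _ => hd t) (hc.intervalIntegrable _ _)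
    simp only [one_smul, zero_smul, add_zero] at h3
    rw [← h3, intervalIntegral.integral_of_le zero_le_one]
    refine (enorm_integral_le_lintegral_enorm _).trans (lintegral_mono fun t => ?_)
    rw [mul_comm]
    exact ContinuousLinearMap.le_opENorm _ _
  refine (lintegral_mono h1).trans ?_
  rw [lintegral_lintegral_swap (by
    apply Measurable.aemeasurable
    exact (Continuous.measurable (by fun_prop)).const_mul _)]
  have h2 : ∀ t : ℝ, ∫⁻ x, ‖z‖ₑ * ‖fderiv ℝ ψ (x + t • z)‖ₑ = ‖z‖ₑ * ∫⁻ x, ‖fderiv ℝ ψ x‖ₑ := by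
    intro t
    rw [lintegral_const_mul _ (Continuous.measurable (by fun_prop)),
      lintegral_add_right_eq_self (fun x => ‖fderiv ℝ ψ x‖ₑ)]
  simp only [h2]
  simp

end Translation

theorem isCompactOperator_of_comp_approx {E F : Type*} [NormedAddCommGroup E] [NormedSpace ℝ E]
    [NormedAddCommGroup F] [NormedSpace ℝ F] [CompleteSpace F] {J : E →L[ℝ] F} {S : ℕ → F →L[ℝ] F}
    (hS : ∀ n, IsCompactOperator (S n)) {δ : ℕ → ℝ} (hδ : Tendsto δ atTop (𝓝 0))
    (hδ0 : ∀ n, 0 ≤ δ n) (h : ∀ n u, ‖S n (J u) - J u‖ ≤ δ n * ‖u‖) : IsCompactOperator J := by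
  have hlim : Tendsto (fun n => (S n).comp J) atTop (𝓝 J) := by
    rw [tendsto_iff_norm_sub_tendsto_zero]
    exact squeeze_zero (fun n => norm_nonneg _)
      (fun n => ContinuousLinearMap.opNorm_le_bound _ (hδ0 n) (h n)) hδ
  exact isCompactOperator_of_tendsto hlim (Eventually.of_forall fun n => (hS n).comp_clm J)

/-! ### Compactness of the embedding into `L¹` by finite-rank averaging. -/

section Averaging

variable {N : ℕ} {Ω : Set (RN N)}

/-- The integral over a set as a bounded functional on `L¹`. -/
def setIntegralL {X : Type*} [MeasurableSpace X] (μ : Measure X) (s : Set X) :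
    Lp ℝ 1 μ →L[ℝ] ℝ :=
  LinearMap.mkContinuous
    { toFun := fun u => ∫ x in s, u x ∂μ
      map_add' := fun u v => by
        rw [← integral_add (L1.integrable_coeFn u).integrableOn (L1.integrable_coeFn v).integrableOn]
        exact integral_congr_ae (ae_restrict_of_ae (Lp.coeFn_add u v))
      map_smul' := fun c u => by
        rw [RingHom.id_apply, smul_eq_mul, ← integral_const_mul]
        exact integral_congr_ae (ae_restrict_of_ae (Lp.coeFn_smul c u)) } 1 fun u => by
    rw [one_mul, L1.norm_eq_integral_norm]
    refine (norm_integral_le_integral_norm _).trans ?_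
    exact setIntegral_le_integral (L1.integrable_coeFn u).norm (ae_of_all _ fun x => norm_nonneg _)

/-- The finite-rank operator replacing `u` at `x` by its average over the ball of radius `ε` about
`π x`. -/
def averageL [Fact (volume Ω < ⊤)] (ε : ℝ) (π : SimpleFunc (RN N) (RN N)) :
    Lp ℝ 1 (volume.restrict Ω) →L[ℝ] Lp ℝ 1 (volume.restrict Ω) :=
  ∑ y ∈ π.range, (((volume (Metric.ball (0 : RN N) ε)).toReal⁻¹ •
    setIntegralL (volume.restrict Ω) (Metric.ball y ε)).smulRight
      (indicatorConstLp 1 (π.measurableSet_fiber y) (measure_ne_top _ _) (1 : ℝ)))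

theorem isCompactOperator_averageL [Fact (volume Ω < ⊤)] (ε : ℝ) (π : SimpleFunc (RN N) (RN N)) :
    IsCompactOperator (averageL (Ω := Ω) ε π) := by
  refine Submodule.sum_mem (compactOperator (RingHom.id ℝ) (Lp ℝ 1 (volume.restrict Ω))
    (Lp ℝ 1 (volume.restrict Ω))) fun y _ => ?_
  set g := indicatorConstLp (μ := volume.restrict Ω) 1 (π.measurableSet_fiber y)
    (measure_ne_top _ _) (1 : ℝ)
  set ℓ := (volume (Metric.ball (0 : RN N) ε)).toReal⁻¹ •
    setIntegralL (volume.restrict Ω) (Metric.ball y ε)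
  exact (isCompactOperator_of_locallyCompactSpace_dom ℓ).clm_comp
    (ContinuousLinearMap.toSpanSingleton ℝ g)

theorem coeFn_averageL [Fact (volume Ω < ⊤)] (ε : ℝ) (π : SimpleFunc (RN N) (RN N))
    (u : Lp ℝ 1 (volume.restrict Ω)) :
    averageL ε π u =ᵐ[volume.restrict Ω] fun x => (volume (Metric.ball (0 : RN N) ε)).toReal⁻¹ *
      ∫ w in Metric.ball (π x) ε, u w ∂(volume.restrict Ω) := by
  rw [averageL, sum_apply]
  have h1 : ∀ y ∈ π.range, ∀ᵐ x ∂volume.restrict Ω, ((((volume (Metric.ball (0 : RN N) ε)).toReal⁻¹ •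
      setIntegralL (volume.restrict Ω) (Metric.ball y ε)).smulRight
      (indicatorConstLp 1 (π.measurableSet_fiber y) (measure_ne_top _ _) (1 : ℝ)) u :
        Lp ℝ 1 (volume.restrict Ω)) : RN N → ℝ) x =
      (π ⁻¹' {y}).indicator (fun x => (volume (Metric.ball (0 : RN N) ε)).toReal⁻¹ *
        ∫ w in Metric.ball (π x) ε, u w ∂(volume.restrict Ω)) x := by
    intro y _
    rw [ContinuousLinearMap.smulRight_apply]
    filter_upwards [Lp.coeFn_smul (((volume (Metric.ball (0 : RN N) ε)).toReal⁻¹ •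
      setIntegralL (volume.restrict Ω) (Metric.ball y ε)) u) (indicatorConstLp 1
        (π.measurableSet_fiber y) (measure_ne_top (volume.restrict Ω) _) (1 : ℝ)),
      indicatorConstLp_coeFn (p := 1) (hs := π.measurableSet_fiber y)
      (hμs := measure_ne_top (volume.restrict Ω) _) (c := (1 : ℝ))] with x hx' hx
    rw [hx', Pi.smul_apply, hx]
    by_cases hxy : x ∈ π ⁻¹' {y}
    · rw [indicator_of_mem hxy, indicator_of_mem hxy, smul_eq_mul, mul_one]
      have : π x = y := hxy
      rw [this]
      rfl
    · rw [indicator_of_notMem hxy, indicator_of_notMem hxy, smul_zero]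
  have h2 := (eventually_all_finset π.range).2 h1
  filter_upwards [h2, Lp.coeFn_finsetSum π.range (fun y => (((volume (Metric.ball (0 : RN N) ε)).toReal⁻¹ •
    setIntegralL (volume.restrict Ω) (Metric.ball y ε)).smulRight
      (indicatorConstLp 1 (π.measurableSet_fiber y) (measure_ne_top _ _) (1 : ℝ))) u)] with x hx hs
  rw [hs, Finset.sum_apply, Finset.sum_congr rfl hx, Finset.sum_eq_single (π x)]
  · rw [indicator_of_mem (by simp)]
  · intro y _ hy
    exact indicator_of_notMem (fun h => hy h.symm) _
  · intro h
    exact absurd (π.mem_range_self x) h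

/-- The ball about `π x` lies in the ball of radius `2ε` about `x`, so the error is at most an
integral of translation differences over `‖z‖ < 2ε`. The factor `2^N` is the volume ratio of balls
of radii `2ε` and `ε`. -/
theorem average_approx {ε : ℝ} (hε : 0 < ε) (hΩ : MeasurableSet Ω) {π : SimpleFunc (RN N) (RN N)}
    (hπ : ∀ x ∈ Ω, dist (π x) x < ε) {ψ : RN N → ℝ} (hψ : IsTestFunction Ω ψ) :
    ∫⁻ x in Ω, ‖(volume (Metric.ball (0 : RN N) ε)).toReal⁻¹ *
      (∫ w in Metric.ball (π x) ε, ψ w ∂(volume.restrict Ω)) - ψ x‖ₑ ≤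
      ENNReal.ofReal (2 ^ N * (2 * ε)) * ∫⁻ x, ‖fderiv ℝ ψ x‖ₑ := by
  have hψc : Continuous ψ := hψ.contDiff.continuous
  set V := volume (Metric.ball (0 : RN N) ε) with hV
  have hV0 : V ≠ 0 := (Metric.measure_ball_pos volume 0 hε).ne'
  have hVt : V ≠ ⊤ := measure_ball_lt_top.ne
  have hVr : V.toReal ≠ 0 := (ENNReal.toReal_pos hV0 hVt).ne'
  have hVy : ∀ y : RN N, volume (Metric.ball y ε) = V := fun y => by
    rw [hV, Measure.addHaar_ball_of_pos volume y hε, Measure.addHaar_ball_of_pos volume 0 hε]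
  have hψint : Integrable ψ := hψc.integrable_of_hasCompactSupport hψ.hasCompactSupport
  have h1 : ∀ x ∈ Ω, ‖V.toReal⁻¹ *
      (∫ w in Metric.ball (π x) ε, ψ w ∂(volume.restrict Ω)) - ψ x‖ₑ ≤
      V⁻¹ * ∫⁻ z in Metric.ball (0 : RN N) (2 * ε), ‖ψ (x + z) - ψ x‖ₑ := by
    intro x hx
    -- Normalising by the volume of the full ball is consistent even near the boundary, because `ψ`
    -- vanishes outside `Ω`.
    have e1 : ∫ w in Metric.ball (π x) ε, ψ w ∂(volume.restrict Ω) =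
        ∫ w in Metric.ball (π x) ε, ψ w := by
      rw [Measure.restrict_restrict measurableSet_ball]
      symm
      refine setIntegral_eq_of_subset_of_forall_sdiff_eq_zero measurableSet_ball
        inter_subset_left fun w hw => ?_
      by_contra h0
      exact hw.2 ⟨hw.1, hψ.support_subset h0⟩
    have e2 : V.toReal⁻¹ * (∫ w in Metric.ball (π x) ε, ψ w) - ψ x =
        V.toReal⁻¹ * ∫ w in Metric.ball (π x) ε, (ψ w - ψ x) := by
      rw [integral_sub hψint.integrableOn (integrableOn_const
        measure_ball_lt_top.ne), setIntegral_const,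
        Measure.real, hVy, smul_eq_mul]
      field_simp
    rw [e1, e2, enorm_mul]
    have e3 : ‖V.toReal⁻¹‖ₑ = V⁻¹ := by
      rw [← ENNReal.toReal_inv, Real.enorm_eq_ofReal ENNReal.toReal_nonneg,
        ENNReal.ofReal_toReal (ENNReal.inv_ne_top.2 hV0)]
    rw [e3]
    gcongr
    refine (enorm_integral_le_lintegral_enorm _).trans ?_
    have hsub : Metric.ball (π x) ε ⊆ Metric.ball x (2 * ε) := by
      refine Metric.ball_subset_ball' ?_
      linarith [hπ x hx]
    refine (lintegral_mono_set hsub).trans_eq ?_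
    rw [← lintegral_indicator measurableSet_ball, ← lintegral_indicator measurableSet_ball,
      ← lintegral_add_left_eq_self _ x]
    refine lintegral_congr fun z => ?_
    have hmem : x + z ∈ Metric.ball x (2 * ε) ↔ z ∈ Metric.ball (0 : RN N) (2 * ε) := by
      simp [Metric.mem_ball, dist_eq_norm]
    by_cases hz : z ∈ Metric.ball (0 : RN N) (2 * ε)
    · rw [indicator_of_mem hz, indicator_of_mem (hmem.2 hz)]
    · rw [indicator_of_notMem hz, indicator_of_notMem (fun h => hz (hmem.1 h))]
  have hmeas : Measurable (Function.uncurry fun (x z : RN N) => ‖ψ (x + z) - ψ x‖ₑ) :=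
    Continuous.measurable (by fun_prop)
  calc _ ≤ ∫⁻ x in Ω, V⁻¹ * ∫⁻ z in Metric.ball (0 : RN N) (2 * ε), ‖ψ (x + z) - ψ x‖ₑ :=
        setLIntegral_mono' hΩ h1
    _ ≤ ∫⁻ x, V⁻¹ * ∫⁻ z in Metric.ball (0 : RN N) (2 * ε), ‖ψ (x + z) - ψ x‖ₑ :=
        setLIntegral_le_lintegral _ _
    _ = V⁻¹ * ∫⁻ z in Metric.ball (0 : RN N) (2 * ε), ∫⁻ x, ‖ψ (x + z) - ψ x‖ₑ := by
        rw [lintegral_const_mul' _ _ (ENNReal.inv_ne_top.2 hV0),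
          lintegral_lintegral_swap hmeas.aemeasurable]
    _ ≤ V⁻¹ * ∫⁻ z in Metric.ball (0 : RN N) (2 * ε),
          ENNReal.ofReal (2 * ε) * ∫⁻ x, ‖fderiv ℝ ψ x‖ₑ := by
        gcongr V⁻¹ * ?_
        refine setLIntegral_mono' measurableSet_ball fun z hz => ?_
        refine (lintegral_enorm_translate_sub_le (hψ.contDiff.of_le (by simp)) z).trans ?_
        gcongr
        rw [← ofReal_norm]
        exact ENNReal.ofReal_le_ofReal (by simpa using (mem_ball_zero_iff.1 hz).le)
    _ = _ := by
        rw [setLIntegral_const, Measure.addHaar_ball_mul_of_pos volume 0 two_pos, ← hV]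
        simp only [finrank_euclideanSpace, Fintype.card_fin]
        rw [ENNReal.ofReal_mul (p := 2 ^ N) (by positivity)]
        calc _ = (V⁻¹ * V) * (ENNReal.ofReal (2 ^ N) * ENNReal.ofReal (2 * ε) *
              ∫⁻ x, ‖fderiv ℝ ψ x‖ₑ) := by ring
          _ = _ := by rw [ENNReal.inv_mul_cancel hV0 hVt, one_mul]

theorem exists_simpleFunc_dist_lt (hb : Bornology.IsBounded Ω) {ε : ℝ} (hε : 0 < ε) :
    ∃ π : SimpleFunc (RN N) (RN N), ∀ x ∈ Ω, dist (π x) x < ε := by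
  have hK : IsCompact (closure Ω) := hb.isCompact_closure
  let e := TopologicalSpace.denseSeq (RN N)
  obtain ⟨t, ht⟩ := hK.elim_finite_subcover (fun k : ℕ => Metric.ball (e k) ε)
    (fun _ => Metric.isOpen_ball) (fun x _ => by
      obtain ⟨k, hk⟩ := (TopologicalSpace.denseRange_denseSeq (RN N)).exists_dist_lt x hε
      exact mem_iUnion.2 ⟨k, hk⟩)
  refine ⟨SimpleFunc.nearestPt e (t.sup id), fun x hx => ?_⟩
  obtain ⟨k, hk, hxk⟩ := mem_iUnion₂.1 (ht (subset_closure hx))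
  have h1 := SimpleFunc.edist_nearestPt_le e x (Finset.le_sup (f := id) hk)
  rw [edist_dist, edist_dist, ENNReal.ofReal_le_ofReal_iff dist_nonneg] at h1
  rw [Metric.mem_ball, dist_comm] at hxk
  exact h1.trans_lt hxk

/-- The norm of the inclusion of `L^p(Ω)` into `L¹(Ω)`. -/
def lpToL1Const (Ω : Set (RN N)) (p : ℝ) : ℝ≥0∞ :=
  (volume.restrict Ω) univ ^ (1 / (1 : ℝ≥0∞).toReal - 1 / (ENNReal.ofReal p).toReal)

theorem lpToL1Const_ne_top [hΩ : Fact (volume Ω < ⊤)] {p : ℝ} (hp : 1 < p) :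
    lpToL1Const Ω p ≠ ⊤ := by
  refine ENNReal.rpow_ne_top_of_nonneg ?_ (by simpa using hΩ.out.ne)
  rw [ENNReal.toReal_one, ENNReal.toReal_ofReal (by linarith), sub_nonneg]
  exact one_div_le_one_div_of_le one_pos hp.le

theorem norm_averageL_sub_le_of_test [Fact (volume Ω < ⊤)] {p : ℝ} [Fact (1 < p)]
    (hΩ : MeasurableSet Ω) {ε : ℝ} (hε : 0 < ε) {π : SimpleFunc (RN N) (RN N)}
    (hπ : ∀ x ∈ Ω, dist (π x) x < ε) {w : W1p0 Ω p} {v : Lp ℝ 1 (volume.restrict Ω)}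
    {ψ : RN N → ℝ} (hψ : IsTestFunction Ω ψ) (hv : v =ᵐ[volume.restrict Ω] ψ)
    (hgr : w.grad =ᵐ[volume.restrict Ω] gradient ψ) :
    ‖averageL ε π v - v‖ ≤ 2 ^ N * 2 * (lpToL1Const Ω p).toReal * ε * ‖w‖ := by
  have hp : 1 < p := Fact.out
  have hDt := lpToL1Const_ne_top (Ω := Ω) hp
  have hae : (averageL ε π v - v : Lp ℝ 1 (volume.restrict Ω))
      =ᵐ[volume.restrict Ω] fun x => (volume (Metric.ball (0 : RN N) ε)).toReal⁻¹ *
      (∫ y in Metric.ball (π x) ε, ψ y ∂(volume.restrict Ω)) - ψ x := by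
    filter_upwards [Lp.coeFn_sub (averageL ε π v) v, coeFn_averageL ε π v, hv] with x h1 h2 h3
    rw [h1, Pi.sub_apply, h2, h3, integral_congr_ae (ae_restrict_of_ae hv)]
  have h1 : ‖averageL ε π v - v‖ₑ ≤
      ENNReal.ofReal (2 ^ N * (2 * ε)) * (‖W1p0.gradL Ω p w‖ₑ * lpToL1Const Ω p) := by
    rw [Lp.enorm_def, eLpNorm_congr_ae hae, eLpNorm_one_eq_lintegral_enorm]
    refine (average_approx hε hΩ hπ hψ).trans ?_
    gcongr
    rw [← eLpNorm_one_eq_lintegral_enorm, hψ.eLpNorm_fderiv, Lp.enorm_def, W1p0.coe_gradL,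
      eLpNorm_congr_ae hgr]
    exact eLpNorm_le_eLpNorm_mul_rpow_measure_univ (ENNReal.one_le_ofReal.2 hp.le)
      hψ.continuous_gradient.aestronglyMeasurable
  have h2 : ‖averageL ε π v - v‖ ≤
      2 ^ N * (2 * ε) * (‖W1p0.gradL Ω p w‖ * (lpToL1Const Ω p).toReal) := by
    have := ENNReal.toReal_mono
      (ENNReal.mul_ne_top ENNReal.ofReal_ne_top (ENNReal.mul_ne_top enorm_ne_top hDt)) h1
    rwa [toReal_enorm, ENNReal.toReal_mul, ENNReal.toReal_mul, toReal_enorm,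
      ENNReal.toReal_ofReal (by positivity)] at this
  have h3 : ‖W1p0.gradL Ω p w‖ ≤ ‖w‖ := WithLp.norm_snd_le _ (w : LpPair Ω p)
  calc _ ≤ _ := h2
    _ = 2 ^ N * (2 * ε) * (lpToL1Const Ω p).toReal * ‖W1p0.gradL Ω p w‖ := by ring
    _ ≤ 2 ^ N * (2 * ε) * (lpToL1Const Ω p).toReal * ‖w‖ :=
        mul_le_mul_of_nonneg_left h3 (by positivity)
    _ = _ := by ring

/-- The averages at scale `1/(n+1)` approximate `J` in operator norm with error `O(1/(n+1))`. The
estimate is proved for test functions and extends by density. -/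
theorem W1p0.isCompactOperator_embedding {p : ℝ} [Fact (1 < p)] (hb : Bornology.IsBounded Ω)
    (hΩ : MeasurableSet Ω) (J : W1p0 Ω p →L[ℝ] Lp ℝ 1 (volume.restrict Ω))
    (hJ : ∀ u, J u =ᵐ[volume.restrict Ω] u.fn) : IsCompactOperator J := by
  have : Fact (volume Ω < ⊤) := ⟨hb.measure_lt_top⟩
  choose π hπ using fun n : ℕ => exists_simpleFunc_dist_lt hb (Nat.one_div_pos_of_nat (n := n) (α := ℝ))
  set ε : ℕ → ℝ := fun n => 1 / ((n : ℝ) + 1) with hε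
  have hε0 : ∀ n, 0 < ε n := fun n => Nat.one_div_pos_of_nat
  set K : ℝ := 2 ^ N * 2 * (lpToL1Const Ω p).toReal with hK
  have hK0 : 0 ≤ K := by positivity
  have key : ∀ n (u : W1p0 Ω p), ‖averageL (ε n) (π n) (J u) - J u‖ ≤ K * ε n * ‖u‖ := by
    intro n u
    obtain ⟨w, ψ, hw, hψ⟩ := u.exists_test_seq
    have hc1 : Continuous fun u : W1p0 Ω p => ‖averageL (ε n) (π n) (J u) - J u‖ :=
      (((averageL (ε n) (π n)).continuous.comp J.continuous).sub J.continuous).norm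
    have hc2 : Continuous fun u : W1p0 Ω p => K * ε n * ‖u‖ := continuous_const.mul continuous_norm
    exact le_of_tendsto_of_tendsto' ((hc1.tendsto u).comp hw) ((hc2.tendsto u).comp hw)
      fun m => norm_averageL_sub_le_of_test hΩ (hε0 n) (hπ n) (hψ m).1 ((hJ _).trans (hψ m).2.1)
        (hψ m).2.2
  have h0 : Tendsto (fun n => K * ε n) atTop (𝓝 0) := by
    simpa [hε] using (tendsto_one_div_add_atTop_nhds_zero_nat (𝕜 := ℝ)).const_mul K
  exact isCompactOperator_of_comp_approx (fun n => isCompactOperator_averageL (ε n) (π n)) h0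
    (fun n => mul_nonneg hK0 (hε0 n).le) key

end Averaging

/-! ### Interpolation exponents and absorption of sublinear terms. -/

section Exponents

/-- There is an exponent `q > r`, admissible in the Sobolev embedding, for which interpolation
between `L^τ` and `L^q` gives subcritical growth. -/
theorem exists_interpolation_exponent {N : ℕ} {p r τ : ℝ} (hp : 1 < p) (hpr : p < r)
    (hr : (r : EReal) < critExp N p) (hτ : (r - p) * max (N / p) 1 < τ) :
    ∃ q, r < q ∧ (p < N → p⁻¹ - (N : ℝ)⁻¹ ≤ q⁻¹) ∧ q * (r - p) < τ * (q - p) := by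
  have hrp : 0 < r - p := by linarith
  have h1 : (r - p) * (N / p) < τ :=
    (mul_le_mul_of_nonneg_left (le_max_left _ _) hrp.le).trans_lt hτ
  have h2 : r - p < τ := by
    have := (mul_le_mul_of_nonneg_left (le_max_right ((N : ℝ) / p) 1) hrp.le).trans_lt hτ
    rwa [mul_one] at this
  unfold critExp at hr
  split_ifs at hr with hpN
  · rw [EReal.coe_lt_coe_iff] at hr
    have hNp : (0 : ℝ) < N - p := by linarith
    have hp0 : 0 < p := by linarith
    have hN0 : (0 : ℝ) < N := by linarith
    -- At `q = p^*` one has `q = (N/p)(q - p)`, so the last inequality reduces to `(r - p) N/p < τ`.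
    refine ⟨N * p / (N - p), hr, fun _ => le_of_eq (by field_simp), ?_⟩
    have h3 : (N : ℝ) * p / (N - p) - p = p ^ 2 / (N - p) := by field_simp; ring
    have h4 : (N : ℝ) * p / (N - p) = N / p * (p ^ 2 / (N - p)) := by field_simp
    rw [h3, h4]
    have h5 : 0 < p ^ 2 / (N - p) := by positivity
    nlinarith [mul_lt_mul_of_pos_right h1 h5]
  · have hd : 0 < τ - (r - p) := by linarith
    -- With no critical exponent, the condition reads `τp < q(τ - (r - p))` and holds for all large
    -- `q`.
    refine ⟨max (r + 1) ((τ * p + 1) / (τ - (r - p))), ?_, fun h => absurd h hpN, ?_⟩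
    · exact (lt_add_one r).trans_le (le_max_left _ _)
    · have h3 := le_max_right (r + 1) ((τ * p + 1) / (τ - (r - p)))
      rw [div_le_iff₀ hd] at h3
      linarith

theorem integral_rpow_interpolation {X : Type*} [MeasurableSpace X] {μ : Measure X} {τ r q : ℝ}
    (hτ : 0 < τ) (hτr : τ < r) (hrq : r < q) {f : X → ℝ} (hf0 : ∀ x, 0 ≤ f x)
    (hfm : AEMeasurable f μ) (h1 : Integrable (fun x => f x ^ τ) μ)
    (h2 : Integrable (fun x => f x ^ q) μ) :
    ∫ x, f x ^ r ∂μ ≤ (∫ x, f x ^ τ ∂μ) ^ ((q - r) / (q - τ)) *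
      (∫ x, f x ^ q ∂μ) ^ ((r - τ) / (q - τ)) := by
  have hqτ : 0 < q - τ := by linarith
  set θ := (r - τ) / (q - τ) with hθ
  have hθ0 : 0 ≤ θ := div_nonneg (by linarith) hqτ.le
  have hθ1 : 0 ≤ (q - r) / (q - τ) := div_nonneg (by linarith) hqτ.le
  have hsum : (q - r) / (q - τ) + θ = 1 := by rw [hθ]; field_simp; ring
  have hexp : τ * ((q - r) / (q - τ)) + q * θ = r := by rw [hθ]; field_simp; ring
  have hi1 : 0 ≤ ∫ x, f x ^ τ ∂μ := integral_nonneg fun x => Real.rpow_nonneg (hf0 x) _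
  have hi2 : 0 ≤ ∫ x, f x ^ q ∂μ := integral_nonneg fun x => Real.rpow_nonneg (hf0 x) _
  have hr0 : r ≠ 0 := by linarith
  rw [integral_eq_lintegral_of_nonneg_ae (ae_of_all _ fun x => Real.rpow_nonneg (hf0 x) _)
    (hfm.pow_const r).aestronglyMeasurable]
  refine ENNReal.toReal_le_of_le_ofReal (by positivity) ?_
  rw [ENNReal.ofReal_mul (by positivity), ← ENNReal.ofReal_rpow_of_nonneg hi1 hθ1,
    ← ENNReal.ofReal_rpow_of_nonneg hi2 hθ0,
    ofReal_integral_eq_lintegral_ofReal h1 (ae_of_all _ fun x => Real.rpow_nonneg (hf0 x) _),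
    ofReal_integral_eq_lintegral_ofReal h2 (ae_of_all _ fun x => Real.rpow_nonneg (hf0 x) _)]
  refine le_trans (le_of_eq (lintegral_congr fun x => ?_))
    (ENNReal.lintegral_mul_norm_pow_le h1.1.aemeasurable.ennreal_ofReal
      h2.1.aemeasurable.ennreal_ofReal hθ1 hθ0 hsum)
  rw [ENNReal.ofReal_rpow_of_nonneg (Real.rpow_nonneg (hf0 x) _) hθ1,
    ENNReal.ofReal_rpow_of_nonneg (Real.rpow_nonneg (hf0 x) _) hθ0,
    ← ENNReal.ofReal_mul (Real.rpow_nonneg (Real.rpow_nonneg (hf0 x) _) _),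
    ← Real.rpow_mul (hf0 x), ← Real.rpow_mul (hf0 x), ← Real.rpow_add' (hf0 x) (by rw [hexp]; exact hr0),
    hexp]

/-- For `X ≥ 1` the constant `C₁` is at most `C₁ X^s`; dividing by `X^s` bounds `X^{1-s}`. -/
theorem bounded_of_le_add_rpow {c C₁ C₂ s : ℝ} (hc : 0 < c) (hC₁ : 0 ≤ C₁) (hs : 0 ≤ s)
    (hs1 : s < 1) : ∃ B, ∀ X : ℝ, 0 ≤ X → c * X ≤ C₁ + C₂ * X ^ s → X ≤ B := by
  refine ⟨max 1 (((C₁ + C₂) / c) ^ (1 / (1 - s))), fun X hX h => ?_⟩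
  rcases le_total X 1 with h1 | h1
  · exact h1.trans (le_max_left _ _)
  · refine le_trans ?_ (le_max_right _ _)
    have hX0 : 0 < X := by linarith
    have h2 : 1 ≤ X ^ s := Real.one_le_rpow h1 hs
    have h3 : X = X ^ (1 - s) * X ^ s := by rw [← Real.rpow_add hX0]; simp
    have h4 : X ^ (1 - s) ≤ (C₁ + C₂) / c := by
      rw [le_div_iff₀ hc]
      have h5 : c * X ≤ (C₁ + C₂) * X ^ s := by nlinarith
      have h6 : (X ^ (1 - s) * c) * X ^ s ≤ (C₁ + C₂) * X ^ s := by
        calc _ = c * (X ^ (1 - s) * X ^ s) := by ring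
          _ = c * X := by rw [← h3]
          _ ≤ _ := h5
      exact le_of_mul_le_mul_right h6 (by linarith)
    have h7 := Real.rpow_le_rpow (by positivity) h4 (by
      have : 0 < 1 - s := by linarith
      positivity : 0 ≤ 1 / (1 - s))
    rwa [← Real.rpow_mul hX, mul_one_div_cancel (by linarith), Real.rpow_one] at h7

end Exponents

/-! ### The primitive of the reaction. -/

section Primitive

variable {N : ℕ}

theorem hasFDerivAt_primitiveF {g : RN N → ℝ → ℝ} {x : RN N} (hg : Continuous (g x)) (s : ℝ) :
    HasFDerivAt (primitiveF g x) (innerSL ℝ (g x s)) s := by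
  have h1 : HasDerivAt (primitiveF g x) (g x s) s :=
    intervalIntegral.integral_hasDerivAt_right (hg.intervalIntegrable _ _)
      (hg.stronglyMeasurableAtFilter _ _) hg.continuousAt
  refine h1.hasFDerivAt.congr_fderiv ?_
  ext
  simp

/-- Rescaling `[0, s]` to `[0, 1]` gives a parameter integral over a fixed interval. -/
theorem measurable_primitiveF {g : RN N → ℝ → ℝ} (hm : Measurable (Function.uncurry g)) :
    Measurable (Function.uncurry (primitiveF g)) := by
  have h1 : ∀ x s, primitiveF g x s = ∫ t in (0 : ℝ)..1, s * g x (s * t) := by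
    intro x s
    rw [primitiveF, intervalIntegral.integral_const_mul]
    have := intervalIntegral.smul_integral_comp_mul_left (f := g x) (a := 0) (b := 1) s
    rw [mul_zero, mul_one, smul_eq_mul] at this
    exact this.symm
  have h2 : Function.uncurry (primitiveF g) =
      fun z : RN N × ℝ => ∫ t in Ioc (0 : ℝ) 1, z.2 * g z.1 (z.2 * t) := by
    funext z
    rw [Function.uncurry, h1, intervalIntegral.integral_of_le zero_le_one]
  rw [h2]
  have h3 : Measurable fun w : (RN N × ℝ) × ℝ => w.1.2 * g w.1.1 (w.1.2 * w.2) := by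
    refine Measurable.mul (by fun_prop) ?_
    exact hm.comp (f := fun w : (RN N × ℝ) × ℝ => (w.1.1, w.1.2 * w.2)) (by fun_prop)
  exact (h3.stronglyMeasurable.integral_prod_right (ν := volume.restrict (Ioc (0 : ℝ) 1))).measurable

end Primitive

/-! ### Differentiability of the energy. -/

section Energy

variable {N : ℕ} {Ω : Set (RN N)} {p : ℝ} [Fact (1 < p)] {ϑ a₀ : ℝ → ℝ} {chat c₀ c₁ c₂ : ℝ}

theorem HypA.isNemytskii (hN : 1 ≤ N) (hϑ : IsComparison p ϑ chat c₀ c₁ c₂)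
    (ha : HypA N p ϑ a₀) (μ : Measure (RN N)) : IsNemytskii μ p fun _ : RN N => aMap N a₀ := by
  obtain ⟨B, hB⟩ := ha.norm_aMap_le hN Fact.out hϑ
  exact ⟨ha.continuous_aMap.measurable.comp measurable_snd, fun _ => ha.continuous_aMap,
    B, ae_of_all _ fun _ => hB⟩

theorem HypA.measurable_GFun (ha : HypA N p ϑ a₀) :
    Measurable (Function.uncurry fun _ : RN N => GFun N a₀) := by
  have h : Continuous (GFun N a₀) :=
    continuous_iff_continuousAt.2 fun ξ => (ha.hasFDerivAt_GFun ξ).continuousAt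
  exact h.measurable.comp measurable_snd

theorem energy_eq {r : ℝ} [Fact (1 ≤ ENNReal.ofReal r)] {g : RN N → ℝ → ℝ}
    {J : W1p0 Ω p →L[ℝ] Lp ℝ (ENNReal.ofReal r) (volume.restrict Ω)}
    (hJ : ∀ u, J u =ᵐ[volume.restrict Ω] u.fn) (u : W1p0 Ω p) :
    energy Ω p a₀ g u = (∫ x in Ω, GFun N a₀ (W1p0.gradL Ω p u x)) -
      ∫ x in Ω, primitiveF g x (J u x) := by
  rw [energy, ← W1p0.coe_gradL]
  congr 1
  refine integral_congr_ae ?_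
  filter_upwards [hJ u] with x hx
  rw [hx]

theorem energy_hasFDerivAt [IsFiniteMeasure (volume.restrict Ω)] (hN : 1 ≤ N)
    (hϑ : IsComparison p ϑ chat c₀ c₁ c₂) (ha : HypA N p ϑ a₀) {r p' r' : ℝ}
    (hp' : p.HolderConjugate p') (hr' : r.HolderConjugate r')
    [Fact (1 ≤ ENNReal.ofReal p')] [Fact (1 ≤ ENNReal.ofReal r)] [Fact (1 ≤ ENNReal.ofReal r')]
    {g : RN N → ℝ → ℝ} (hg : IsNemytskii (volume.restrict Ω) r g)
    {J : W1p0 Ω p →L[ℝ] Lp ℝ (ENNReal.ofReal r) (volume.restrict Ω)}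
    (hJ : ∀ u, J u =ᵐ[volume.restrict Ω] u.fn) (u : W1p0 Ω p) :
    HasFDerivAt (energy Ω p a₀ g)
      (((ha.isNemytskii hN hϑ _).deriv hp' (W1p0.gradL Ω p u)).comp (W1p0.gradL Ω p) -
        (hg.deriv hr' (J u)).comp J) u := by
  rw [show energy Ω p a₀ g = _ from funext (energy_eq hJ)]
  have h1 := ((ha.isNemytskii hN hϑ (volume.restrict Ω)).hasFDerivAt hp' ha.measurable_GFun
    (fun _ => ha.hasFDerivAt_GFun) (fun _ => by simp [GFun, G₀]) (W1p0.gradL Ω p u)).comp u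
      (W1p0.gradL Ω p).hasFDerivAt
  have h2 := (hg.hasFDerivAt hr' (measurable_primitiveF hg.measurable)
    (fun x => hasFDerivAt_primitiveF (hg.continuous x)) (fun _ => by simp [primitiveF])
      (J u)).comp u J.hasFDerivAt
  exact h1.sub h2

end Energy

/-! ### Boundedness of Cerami sequences. -/

section Cerami

variable {N : ℕ} {Ω : Set (RN N)} {p : ℝ} [Fact (1 < p)] {ϑ a₀ : ℝ → ℝ} {chat c₀ c₁ c₂ : ℝ}

/-- A reaction controlled from above and, in the quasi-superlinear sense, from below by a gauge
`m(s) ≤ |s|`. -/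
structure IsReaction (Ω : Set (RN N)) (p r τ : ℝ) (g : RN N → ℝ → ℝ) (m : ℝ → ℝ) : Prop where
  nemytskii : IsNemytskii (volume.restrict Ω) r g
  measurable : Measurable m
  nonneg : ∀ s, 0 ≤ m s
  le_abs : ∀ s, m s ≤ |s|
  upper : ∃ A, 0 ≤ A ∧ ∀ᵐ x ∂volume.restrict Ω, ∀ s, g x s * s ≤ A * (1 + m s ^ r)
  lower : ∃ β > 0, ∃ C, ∀ᵐ x ∂volume.restrict Ω, ∀ s,
    β * m s ^ τ - C ≤ g x s * s - p * primitiveF g x s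

/-- For `r ≤ τ` the `L^τ` bound suffices. Otherwise interpolation with `L^q` gives the power `qθ` of
`G`, that is `(G^p)^{qθ/p}`. -/
theorem integral_gauge_rpow_le [IsFiniteMeasure (volume.restrict Ω)] {r τ q : ℝ}
    [Fact (1 ≤ ENNReal.ofReal q)] (hp : 1 < p)
    (hpr : p < r) (hτ : 0 < τ) (hrq : r < q) (hq : q * (r - p) < τ * (q - p)) {m : ℝ → ℝ}
    (hmm : Measurable m) (hm0 : ∀ s, 0 ≤ m s) (hm : ∀ s, m s ≤ |s|) {D : ℝ} (hD : 0 ≤ D) {K : ℝ}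
    (hK : 0 ≤ K) : ∃ C₁ C₂ s : ℝ, 0 ≤ C₁ ∧ 0 ≤ s ∧ s < 1 ∧
      ∀ (u : Lp ℝ (ENNReal.ofReal q) (volume.restrict Ω)) (G : ℝ), 0 ≤ G → ‖u‖ ≤ D * G →
        Integrable (fun x => m (u x) ^ τ) (volume.restrict Ω) → ∫ x in Ω, m (u x) ^ τ ≤ K →
        ∫ x in Ω, m (u x) ^ r ≤ C₁ + C₂ * (G ^ p) ^ s := by
  have hq0 : 0 < q := by linarith
  have hp0 : 0 < p := by linarith
  rcases le_or_gt r τ with hrτ | hτr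
  · refine ⟨(volume.restrict Ω).real univ + K, 0, 0, by positivity, le_rfl, one_pos,
      fun u G hG _ hi hle => ?_⟩
    have h1 : ∫ x in Ω, m (u x) ^ r ≤ ∫ x in Ω, (1 + m (u x) ^ τ) := by
      refine integral_mono_of_nonneg (ae_of_all _ fun x => Real.rpow_nonneg (hm0 _) _)
        ((integrable_const 1).add hi) (ae_of_all _ fun x => ?_)
      have h0 := Real.rpow_nonneg (hm0 (u x)) τ
      simp only
      rcases le_total (m (u x)) 1 with h | h
      · have := Real.rpow_le_one (hm0 (u x)) h (by linarith : 0 ≤ r)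
        linarith
      · have := Real.rpow_le_rpow_of_exponent_le h hrτ
        linarith
    rw [integral_add (integrable_const 1) hi, integral_const, smul_eq_mul, mul_one] at h1
    linarith
  · have hqτ : 0 < q - τ := by linarith
    set θ := (r - τ) / (q - τ) with hθ
    have hθ0 : 0 ≤ θ := div_nonneg (by linarith) hqτ.le
    -- Here `qθ < p` means `q(r - τ) < p(q - τ)`, a rearrangement of `hq`.
    have hs1 : q * θ / p < 1 := by
      rw [div_lt_one hp0, hθ, mul_div_assoc', div_lt_iff₀ hqτ]
      linarith
    refine ⟨0, K ^ ((q - r) / (q - τ)) * (D ^ q) ^ θ, q * θ / p, le_rfl, by positivity, hs1,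
      fun u G hG hu hi hle => ?_⟩
    have hum : AEMeasurable (fun x => m (u x)) (volume.restrict Ω) :=
      hmm.comp_aemeasurable (Lp.aestronglyMeasurable u).aemeasurable
    have hpw : ∀ x, m (u x) ^ q ≤ ‖u x‖ ^ q := fun x =>
      Real.rpow_le_rpow (hm0 _) (hm _) hq0.le
    have hiq : Integrable (fun x => m (u x) ^ q) (volume.restrict Ω) :=
      (integrable_norm_rpow hq0 u).mono' (hum.pow_const q).aestronglyMeasurable
        (ae_of_all _ fun x => by
          rw [Real.norm_of_nonneg (Real.rpow_nonneg (hm0 _) _)]; exact hpw x)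
    have h1 := integral_rpow_interpolation hτ hτr hrq (fun x => hm0 (u x)) hum hi hiq
    have h2 : ∫ x in Ω, m (u x) ^ q ≤ (D * G) ^ q := by
      refine (integral_mono hiq (integrable_norm_rpow hq0 u) hpw).trans ?_
      rw [← norm_rpow_eq_integral hq0]
      exact Real.rpow_le_rpow (norm_nonneg _) hu hq0.le
    have hi1 : 0 ≤ ∫ x in Ω, m (u x) ^ τ := integral_nonneg fun x => Real.rpow_nonneg (hm0 _) _
    have hi2 : 0 ≤ ∫ x in Ω, m (u x) ^ q := integral_nonneg fun x => Real.rpow_nonneg (hm0 _) _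
    have hθ1 : 0 ≤ (q - r) / (q - τ) := div_nonneg (by linarith) hqτ.le
    refine h1.trans ?_
    rw [zero_add, mul_assoc]
    refine mul_le_mul (Real.rpow_le_rpow hi1 hle hθ1) ?_ (by positivity) (by positivity)
    refine (Real.rpow_le_rpow hi2 h2 hθ0).trans_eq ?_
    rw [Real.mul_rpow hD hG, Real.mul_rpow (by positivity) (by positivity), ← Real.rpow_mul hG,
      ← Real.rpow_mul hG]
    congr 2
    field_simp

theorem inner_GFun_lower (ha : HypA N p ϑ a₀) : ∃ c₆, ∀ ξ : RN N,
    -c₆ ≤ p * GFun N a₀ ξ - inner ℝ (aMap N a₀ ξ) ξ := by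
  obtain ⟨c₆, h6, h⟩ := ha.primitive_lower
  refine ⟨c₆, fun ξ => ?_⟩
  rcases eq_or_ne ξ 0 with rfl | hξ
  · simp [GFun, G₀, h6.le]
  · rw [aMap, real_inner_smul_left, real_inner_self_eq_norm_sq, mul_comm (a₀ _)]
    exact h _ (norm_pos_iff.2 hξ)

/-- Pairs `(z, w)` with bounded energy and bounded radial derivative of the energy have bounded
gradient part `z`. -/
theorem bounded_of_energy_bounded [IsFiniteMeasure (volume.restrict Ω)] (hN : 1 ≤ N)
    (hϑ : IsComparison p ϑ chat c₀ c₁ c₂) (ha : HypA N p ϑ a₀) {r τ q p' r' : ℝ}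
    (hp' : p.HolderConjugate p') (hr' : r.HolderConjugate r') [Fact (1 ≤ ENNReal.ofReal q)]
    (hpr : p < r) (hτ : 0 < τ) (hrq : r < q) (hq : q * (r - p) < τ * (q - p))
    {g : RN N → ℝ → ℝ} {m : ℝ → ℝ} (hg : IsReaction Ω p r τ g m) {D : ℝ} (hD : 0 ≤ D)
    {M : ℝ} (hM : 0 ≤ M) :
    ∃ R, ∀ (z : Lp (RN N) (ENNReal.ofReal p) (volume.restrict Ω))
      (w : Lp ℝ (ENNReal.ofReal r) (volume.restrict Ω))
      (wq : Lp ℝ (ENNReal.ofReal q) (volume.restrict Ω)), wq =ᵐ[volume.restrict Ω] w →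
      ‖wq‖ ≤ D * ‖z‖ →
      |(∫ x in Ω, GFun N a₀ (z x)) - ∫ x in Ω, primitiveF g x (w x)| ≤ M →
      |(∫ x in Ω, inner ℝ (aMap N a₀ (z x)) (z x)) - ∫ x in Ω, inner ℝ (g x (w x)) (w x)| ≤ M →
      ‖z‖ ≤ R := by
  have hp : 1 < p := Fact.out
  have hp0 : 0 < p := by linarith
  have : Fact (1 ≤ ENNReal.ofReal r) := ⟨ENNReal.one_le_ofReal.2 hr'.lt.le⟩
  have : Fact (1 ≤ ENNReal.ofReal p') := ⟨ENNReal.one_le_ofReal.2 hp'.symm.lt.le⟩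
  have : Fact (1 ≤ ENNReal.ofReal r') := ⟨ENNReal.one_le_ofReal.2 hr'.symm.lt.le⟩
  obtain ⟨A, hA0, hA⟩ := hg.upper
  obtain ⟨β, hβ, C, hC⟩ := hg.lower
  obtain ⟨c₆, h6⟩ := inner_GFun_lower ha
  have haN := ha.isNemytskii hN hϑ (volume.restrict Ω)
  set c := c₁ / (p - 1) with hc
  have hc0 : 0 < c := div_pos hϑ.c₁_pos (by linarith)
  set V := (volume.restrict Ω).real univ with hV
  have hV0 : 0 ≤ V := by positivity
  -- The `L^τ` bound obtained from `dF - p IF = (dF - dG) + (dG - p IG) + p(IG - IF)`, whose terms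
  -- are at most `M`, `|c₆| V` and `pM`.
  set K := ((p + 1) * M + |c₆| * V + |C| * V) / β with hK
  have hK0 : 0 ≤ K := by positivity
  obtain ⟨C₁, C₂, s, hC₁, hs0, hs1, hgauge⟩ := integral_gauge_rpow_le hp hpr hτ hrq hq
    hg.measurable hg.nonneg hg.le_abs hD hK0 (Ω := Ω)
  obtain ⟨B, hB⟩ := bounded_of_le_add_rpow (C₁ := M + A * (V + C₁)) (C₂ := A * C₂) hc0
    (by positivity) hs0 hs1
  refine ⟨|B| ^ (1 / p), fun z w wq hwq hwqb h1 h2 => ?_⟩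
  set IG := ∫ x in Ω, GFun N a₀ (z x)
  set IF := ∫ x in Ω, primitiveF g x (w x)
  have hIGi : Integrable (fun x => GFun N a₀ (z x)) (volume.restrict Ω) :=
    haN.integrable_primitive hp ha.measurable_GFun
      (fun _ => ha.hasFDerivAt_GFun) (fun _ => by simp [GFun, G₀]) z
  have hIFi : Integrable (fun x => primitiveF g x (w x)) (volume.restrict Ω) :=
    hg.nemytskii.integrable_primitive (by linarith) (measurable_primitiveF hg.nemytskii.measurable)
      (fun x => hasFDerivAt_primitiveF (hg.nemytskii.continuous x)) (fun _ => by simp [primitiveF]) w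
  have hdGi := haN.integrable_inner hp' z z
  have hdFi : Integrable (fun x => g x (w x) * w x) (volume.restrict Ω) := by
    refine (hg.nemytskii.integrable_inner hr' w w).congr (ae_of_all _ fun x => ?_)
    simp [mul_comm]
  have hdF : ∫ x in Ω, inner ℝ (g x (w x)) (w x) = ∫ x in Ω, g x (w x) * w x :=
    integral_congr_ae (ae_of_all _ fun x => by simp [mul_comm])
  rw [hdF] at h2
  set dG := ∫ x in Ω, inner ℝ (aMap N a₀ (z x)) (z x)
  set dF := ∫ x in Ω, g x (w x) * w x
  have e1 : -(|c₆| * V) ≤ p * IG - dG := by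
    rw [← integral_const_mul, ← integral_sub (hIGi.const_mul p) hdGi]
    have := integral_mono (integrable_const (-|c₆|)) ((hIGi.const_mul p).sub hdGi)
      fun x => (neg_le_neg (le_abs_self c₆)).trans (h6 (z x))
    rw [integral_const, smul_eq_mul] at this
    simp only [Pi.sub_apply] at this
    linarith
  have e2 : dF - p * IF ≤ (p + 1) * M + |c₆| * V := by
    have h3 := abs_le.1 h1
    have h4 := abs_le.1 h2
    nlinarith [h3.1, h3.2, h4.1, h4.2]
  have hsub : Integrable (fun x => g x (w x) * w x - p * primitiveF g x (w x))
      (volume.restrict Ω) := hdFi.sub (hIFi.const_mul p)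
  have hrhs : Integrable (fun x => g x (w x) * w x - p * primitiveF g x (w x) + C)
      (volume.restrict Ω) := hsub.add (integrable_const C)
  have hwm : AEMeasurable (fun x => m (w x)) (volume.restrict Ω) :=
    hg.measurable.comp_aemeasurable (Lp.aestronglyMeasurable w).aemeasurable
  -- No upper bound on `τ` is available here; integrability comes from the quasi-superlinear lower
  -- bound itself.
  have hτi : Integrable (fun x => m (w x) ^ τ) (volume.restrict Ω) := by
    refine (hrhs.const_mul β⁻¹).mono' (hwm.pow_const τ).aestronglyMeasurable ?_
    filter_upwards [hC] with x hx
    rw [Real.norm_of_nonneg (Real.rpow_nonneg (hg.nonneg _) _), inv_mul_eq_div, le_div_iff₀ hβ]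
    linarith [hx (w x)]
  have e3 : ∫ x in Ω, m (w x) ^ τ ≤ K := by
    rw [hK, le_div_iff₀ hβ, mul_comm, ← integral_const_mul]
    have h3 : ∫ x in Ω, β * m (w x) ^ τ ≤
        ∫ x in Ω, (g x (w x) * w x - p * primitiveF g x (w x) + C) := by
      refine integral_mono_ae (hτi.const_mul β) hrhs ?_
      filter_upwards [hC] with x hx
      linarith [hx (w x)]
    have h4 : ∫ x in Ω, (g x (w x) * w x - p * primitiveF g x (w x) + C) =
        dF - p * IF + V * C := by
      rw [integral_add hsub (integrable_const C),
        integral_sub hdFi (hIFi.const_mul p), integral_const_mul, integral_const, smul_eq_mul]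
    have h5 : V * C ≤ |C| * V := by
      rw [mul_comm]; exact mul_le_mul_of_nonneg_right (le_abs_self C) hV0
    linarith
  have hcongr : ∀ t : ℝ, (fun x => m (wq x) ^ t) =ᵐ[volume.restrict Ω] fun x => m (w x) ^ t := by
    intro t
    filter_upwards [hwq] with x hx
    rw [hx]
  have e4 := hgauge wq ‖z‖ (norm_nonneg _) hwqb (hτi.congr (hcongr τ).symm)
    (by rwa [integral_congr_ae (hcongr τ)])
  rw [integral_congr_ae (hcongr r)] at e4
  have hri : Integrable (fun x => m (w x) ^ r) (volume.restrict Ω) := by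
    refine (integrable_norm_rpow (by linarith) w).mono' (hwm.pow_const r).aestronglyMeasurable
      (ae_of_all _ fun x => ?_)
    rw [Real.norm_of_nonneg (Real.rpow_nonneg (hg.nonneg _) _)]
    exact Real.rpow_le_rpow (hg.nonneg _) (hg.le_abs _) (by linarith)
  have e5 : dF ≤ A * (V + ∫ x in Ω, m (w x) ^ r) := by
    have h3 : dF ≤ ∫ x in Ω, A * (1 + m (w x) ^ r) := by
      refine integral_mono_ae hdFi (((integrable_const 1).add hri).const_mul A) ?_
      filter_upwards [hA] with x hx
      exact hx (w x)
    rwa [integral_const_mul, integral_add (integrable_const 1) hri, integral_const, smul_eq_mul,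
      mul_one] at h3
  have e6 : c * ‖z‖ ^ p ≤ dG := by
    rw [norm_rpow_eq_integral hp0, ← integral_const_mul]
    exact integral_mono ((integrable_norm_rpow hp0 z).const_mul c) hdGi
      fun x => ha.inner_aMap_self hN hp hϑ (z x)
  have e7 : c * ‖z‖ ^ p ≤ M + A * (V + C₁) + A * C₂ * (‖z‖ ^ p) ^ s := by
    have h3 := mul_le_mul_of_nonneg_left e4 hA0
    have h4 := (abs_le.1 h2).2
    nlinarith
  have e8 := (hB _ (by positivity) e7).trans (le_abs_self B)
  have e9 := Real.rpow_le_rpow (by positivity) e8 (by positivity : 0 ≤ 1 / p)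
  rwa [← Real.rpow_mul (norm_nonneg _), mul_one_div_cancel hp0.ne', Real.rpow_one] at e9

theorem HypA.norm_sub_rpow_le [IsFiniteMeasure (volume.restrict Ω)] (hN : 1 ≤ N)
    (hϑ : IsComparison p ϑ chat c₀ c₁ c₂) (ha : HypA N p ϑ a₀) {p' : ℝ}
    (hp' : p.HolderConjugate p') [Fact (1 ≤ ENNReal.ofReal p')] {δ : ℝ} (hδ : 0 < δ) :
    ∃ C, 0 ≤ C ∧ ∀ z z' : Lp (RN N) (ENNReal.ofReal p) (volume.restrict Ω), ‖z - z'‖ ^ p ≤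
      C * ((ha.isNemytskii hN hϑ _).deriv hp' z (z - z') -
        (ha.isNemytskii hN hϑ _).deriv hp' z' (z - z')) + δ * (‖z‖ ^ p + ‖z'‖ ^ p) := by
  have hp : 1 < p := Fact.out
  have hp0 : 0 < p := by linarith
  obtain ⟨C, hC, h⟩ := ha.uniform_monotone hN hp hϑ hδ
  refine ⟨C, hC, fun z z' => ?_⟩
  have haN := ha.isNemytskii hN hϑ (volume.restrict Ω)
  have i1 := haN.integrable_inner hp' z (z - z')
  have i2 := haN.integrable_inner hp' z' (z - z')
  have j1 := integrable_norm_rpow hp0 z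
  have j2 := integrable_norm_rpow hp0 z'
  have k1 : Integrable (fun x => C * (inner ℝ (aMap N a₀ (z x)) ((z - z') x) -
      inner ℝ (aMap N a₀ (z' x)) ((z - z') x))) (volume.restrict Ω) := (i1.sub i2).const_mul C
  have k2 : Integrable (fun x => δ * (‖z x‖ ^ p + ‖z' x‖ ^ p)) (volume.restrict Ω) :=
    (j1.add j2).const_mul δ
  rw [haN.deriv_apply, haN.deriv_apply, norm_rpow_eq_integral hp0, norm_rpow_eq_integral hp0,
    norm_rpow_eq_integral hp0, ← integral_sub i1 i2, ← integral_add j1 j2, ← integral_const_mul,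
    ← integral_const_mul, ← integral_add k1 k2]
  refine integral_mono_ae (integrable_norm_rpow hp0 _) (k1.add k2) ?_
  filter_upwards [Lp.coeFn_sub z z'] with x hx
  simp only [hx, Pi.sub_apply]
  rw [← inner_sub_left]
  exact h (z x) (z' x)

end Cerami

/-! ### An abstract Cerami criterion. -/

section Abstract

variable {W Z Y : Type*} [NormedAddCommGroup W] [NormedSpace ℝ W] [NormedAddCommGroup Z]
  [NormedSpace ℝ Z] [NormedAddCommGroup Y] [NormedSpace ℝ Y]

/-- An almost critical bounded sequence converges, when the principal part is uniformly monotone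
and the sequence converges in the space carrying the perturbation. -/
theorem exists_tendsto_of_uniform_monotone [CompleteSpace W] {T : W →L[ℝ] Z} {J : W →L[ℝ] Y}
    {DG : Z → Z →L[ℝ] ℝ} {DF : Y → Y →L[ℝ] ℝ} (hDF : Continuous DF) {P p : ℝ} (hP : 0 < P)
    (hp : 0 < p) (hT : ∀ u, ‖u‖ ≤ P * ‖T u‖)
    (hmono : ∀ δ > 0, ∃ C, 0 ≤ C ∧ ∀ z z', ‖z - z'‖ ^ p ≤
      C * (DG z (z - z') - DG z' (z - z')) + δ * (‖z‖ ^ p + ‖z'‖ ^ p))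
    {v : ℕ → W} {R R' : ℝ} (hR0 : 0 ≤ R) (hR : ∀ n, ‖T (v n)‖ ≤ R) (hR' : ∀ n, ‖v n‖ ≤ R')
    (hE : Tendsto (fun n => ‖(DG (T (v n))).comp T - (DF (J (v n))).comp J‖) atTop (𝓝 0))
    {y : Y} (hJ : Tendsto (fun n => J (v n)) atTop (𝓝 y)) : ∃ u₀, Tendsto v atTop (𝓝 u₀) := by
  have hR'0 : 0 ≤ R' := (norm_nonneg _).trans (hR' 0)
  have hL : ∃ L, 0 ≤ L ∧ ∀ n, ‖DF (J (v n))‖ ≤ L := by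
    have h1 : Tendsto (fun n => ‖DF (J (v n))‖) atTop (𝓝 ‖DF y‖) :=
      ((hDF.tendsto y).comp hJ).norm
    obtain ⟨L, hL⟩ := h1.bddAbove_range
    exact ⟨L, (norm_nonneg _).trans (hL ⟨0, rfl⟩), fun n => hL ⟨n, rfl⟩⟩
  obtain ⟨L, hL0, hL⟩ := hL
  refine cauchySeq_tendsto_of_complete (Metric.cauchySeq_iff.2 fun ε hε => ?_)
  set η := (ε / P) ^ p with hη
  have hη0 : 0 < η := by positivity
  -- `δ` comes first because `C` depends on it, and `κ` is adapted to `C` afterwards. The error and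
  -- monotonicity terms then contribute at most `η/2` and `η/4`; the added ones avoid zero
  -- denominators.
  set δ := η / (4 * (R ^ p + 1)) with hδ
  have hδ0 : 0 < δ := by positivity
  obtain ⟨C, hC, hmon⟩ := hmono δ hδ0
  set κ := η / (4 * (C * (4 * R' + 2 * L) + 1)) with hκ
  have hκ0 : 0 < κ := by positivity
  obtain ⟨n₁, hn₁⟩ := eventually_atTop.1 (hE.eventually (gt_mem_nhds hκ0))
  obtain ⟨n₂, hn₂⟩ := Metric.cauchySeq_iff.1 hJ.cauchySeq κ hκ0
  refine ⟨max n₁ n₂, fun i hi j hj => ?_⟩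
  have hEi := (hn₁ i ((le_max_left _ _).trans hi)).le
  have hEj := (hn₁ j ((le_max_left _ _).trans hj)).le
  have hJij := (hn₂ i ((le_max_right _ _).trans hi) j ((le_max_right _ _).trans hj)).le
  rw [dist_eq_norm] at hJij ⊢
  have hd : ‖v i - v j‖ ≤ 2 * R' := (norm_sub_le _ _).trans (by linarith [hR' i, hR' j])
  have key : ∀ k, ‖(DG (T (v k))).comp T - (DF (J (v k))).comp J‖ ≤ κ →
      |DG (T (v k)) (T (v i) - T (v j))| ≤ κ * (2 * R') + L * κ := by
    intro k hk
    -- The principal part is the almost vanishing derivative tested on a bounded vector, plus a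
    -- bounded functional tested on a small difference in `Y`.
    have e : DG (T (v k)) (T (v i) - T (v j)) =
        ((DG (T (v k))).comp T - (DF (J (v k))).comp J) (v i - v j) +
          DF (J (v k)) (J (v i) - J (v j)) := by
      simp only [sub_apply, ContinuousLinearMap.comp_apply, map_sub]
      ring
    rw [e]
    refine (abs_add_le _ _).trans (add_le_add ?_ ?_)
    · exact (ContinuousLinearMap.le_opNorm _ _).trans
        (mul_le_mul hk hd (norm_nonneg _) hκ0.le)
    · exact (ContinuousLinearMap.le_opNorm _ _).trans
        (mul_le_mul (hL k) hJij (norm_nonneg _) hL0)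
  have h1 := abs_le.1 (key i hEi)
  have h2 := abs_le.1 (key j hEj)
  have h3 := hmon (T (v i)) (T (v j))
  have hRp : ∀ k, ‖T (v k)‖ ^ p ≤ R ^ p := fun k => Real.rpow_le_rpow (norm_nonneg _) (hR k) hp.le
  have hRp0 : 0 ≤ R ^ p := by positivity
  have h4 : δ * (‖T (v i)‖ ^ p + ‖T (v j)‖ ^ p) ≤ η / 2 := by
    have h5 : δ * (‖T (v i)‖ ^ p + ‖T (v j)‖ ^ p) ≤ δ * (2 * (R ^ p + 1)) :=
      mul_le_mul_of_nonneg_left (by linarith [hRp i, hRp j]) hδ0.le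
    have h6 : δ * (2 * (R ^ p + 1)) = η / 2 := by rw [hδ]; field_simp; ring
    linarith
  have h5 : C * (DG (T (v i)) (T (v i) - T (v j)) - DG (T (v j)) (T (v i) - T (v j))) ≤ η / 4 := by
    have h6 : C * (DG (T (v i)) (T (v i) - T (v j)) - DG (T (v j)) (T (v i) - T (v j))) ≤
        C * (κ * (4 * R' + 2 * L)) := mul_le_mul_of_nonneg_left (by linarith [h1.2, h2.1]) hC
    have h7 : κ * (C * (4 * R' + 2 * L) + 1) = η / 4 := by rw [hκ]; field_simp
    nlinarith
  have h6 : ‖T (v i - v j)‖ ^ p < (ε / P) ^ p := by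
    rw [map_sub]; linarith
  have h7 := (Real.rpow_lt_rpow_iff (norm_nonneg _) (by positivity) hp).1 h6
  rw [lt_div_iff₀ hP, mul_comm] at h7
  exact (hT _).trans_lt h7

/-- The weight `1 + ‖u‖` in the Cerami condition is what bounds `φ'(u)u`, as `hbdd` requires. -/
theorem ceramiCondition_of_uniform_monotone [CompleteSpace W] {T : W →L[ℝ] Z} {J : W →L[ℝ] Y}
    {DG : Z → Z →L[ℝ] ℝ} {DF : Y → Y →L[ℝ] ℝ} (hDG : Continuous DG) (hDF : Continuous DF)
    {φ : W → ℝ} (hd : ∀ u, HasFDerivAt φ ((DG (T u)).comp T - (DF (J u)).comp J) u) {P p : ℝ}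
    (hP : 0 < P) (hp : 0 < p) (hT : ∀ u, ‖u‖ ≤ P * ‖T u‖)
    (hmono : ∀ δ > 0, ∃ C, 0 ≤ C ∧ ∀ z z', ‖z - z'‖ ^ p ≤
      C * (DG z (z - z') - DG z' (z - z')) + δ * (‖z‖ ^ p + ‖z'‖ ^ p))
    (hbdd : ∀ M, 0 ≤ M → ∃ R, ∀ u, |φ u| ≤ M →
      |DG (T u) (T u) - DF (J u) (J u)| ≤ M → ‖T u‖ ≤ R)
    (hcomp : ∀ (u : ℕ → W) (R : ℝ), (∀ n, ‖u n‖ ≤ R) →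
      ∃ y, ∃ k : ℕ → ℕ, StrictMono k ∧ Tendsto (fun n => J (u (k n))) atTop (𝓝 y)) :
    CeramiCondition φ := by
  refine ⟨contDiff_one_iff_hasFDerivAt.2 ⟨_, ?_, hd⟩, fun u ⟨M, hM⟩ hlim => ?_⟩
  · exact ((hDG.comp T.continuous).clm_comp continuous_const).sub
      ((hDF.comp J.continuous).clm_comp continuous_const)
  set f' : W → W →L[ℝ] ℝ := fun u => (DG (T u)).comp T - (DF (J u)).comp J with hf'
  have hlim' : Tendsto (fun n => (1 + ‖u n‖) * ‖f' (u n)‖) atTop (𝓝 0) := by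
    refine (tendsto_zero_iff_norm_tendsto_zero.1 hlim).congr fun n => ?_
    rw [norm_smul, (hd (u n)).fderiv, Real.norm_of_nonneg (by positivity)]
  have hE : Tendsto (fun n => ‖f' (u n)‖) atTop (𝓝 0) :=
    squeeze_zero (fun n => norm_nonneg _) (fun n =>
      le_mul_of_one_le_left (norm_nonneg _) (by linarith [norm_nonneg (u n)])) hlim'
  obtain ⟨M₂, hM₂⟩ := hlim'.bddAbove_range
  obtain ⟨R, hR⟩ := hbdd (max M M₂) ((abs_nonneg _).trans ((hM 0).trans (le_max_left _ _)))
  have hgr : ∀ n, ‖T (u n)‖ ≤ R := by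
    refine fun n => hR _ ((hM n).trans (le_max_left _ _)) ?_
    have h1 := (f' (u n)).le_opNorm (u n)
    refine h1.trans (le_trans ?_ ((hM₂ ⟨n, rfl⟩).trans (le_max_right _ _)))
    simp only
    nlinarith [norm_nonneg (f' (u n))]
  have hbd : ∀ n, ‖u n‖ ≤ P * R := fun n =>
    (hT _).trans (mul_le_mul_of_nonneg_left (hgr n) hP.le)
  obtain ⟨y, k, hk, hy⟩ := hcomp u _ hbd
  obtain ⟨u₀, hu₀⟩ := exists_tendsto_of_uniform_monotone (v := u ∘ k) hDF hP hp hT hmono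
    ((norm_nonneg _).trans (hgr 0)) (fun n => hgr (k n)) (fun n => hbd (k n))
    (hE.comp hk.tendsto_atTop) hy
  exact ⟨u₀, k, hk, hu₀⟩

end Abstract

/-! ### Compactness in `L^r` and the Cerami condition for general reactions. -/

section Final

theorem norm_rpow_interpolation {X : Type*} [MeasurableSpace X] {μ : Measure X} {r q : ℝ}
    (hr : 1 < r) (hrq : r < q) {u : Lp ℝ 1 μ} {w : Lp ℝ (ENNReal.ofReal r) μ}
    {v : Lp ℝ (ENNReal.ofReal q) μ} (huw : u =ᵐ[μ] w) (hvw : v =ᵐ[μ] w) :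
    ‖w‖ ^ r ≤ ‖u‖ ^ ((q - r) / (q - 1)) * (‖v‖ ^ q) ^ ((r - 1) / (q - 1)) := by
  have hq0 : 0 < q := by linarith
  have e1 : ‖w‖ ^ r = ∫ x, ‖u x‖ ^ r ∂μ := by
    rw [norm_rpow_eq_integral (by linarith)]
    refine integral_congr_ae ?_
    filter_upwards [huw] with x hx
    rw [hx]
  have e2 : (fun x => ‖v x‖ ^ q) =ᵐ[μ] fun x => ‖u x‖ ^ q := by
    filter_upwards [huw, hvw] with x h1 h2
    rw [h1, h2]
  have e3 : ‖u‖ = ∫ x, ‖u x‖ ^ (1 : ℝ) ∂μ := by simp [L1.norm_eq_integral_norm]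
  rw [e1, e3, norm_rpow_eq_integral hq0 v, integral_congr_ae e2]
  exact integral_rpow_interpolation one_pos hr hrq (fun x => norm_nonneg _)
    (Lp.aestronglyMeasurable u).norm.aemeasurable
    (by simpa using (L1.integrable_coeFn u).norm) ((integrable_norm_rpow hq0 v).congr e2)

theorem cauchySeq_of_norm_rpow_le {Y Y' : Type*} [NormedAddCommGroup Y] [NormedAddCommGroup Y']
    {x : ℕ → Y} {y : ℕ → Y'} {r a K : ℝ} (hr : 0 < r) (ha : 0 < a) (hK : 0 ≤ K)
    (h : ∀ i j, ‖x i - x j‖ ^ r ≤ ‖y i - y j‖ ^ a * K) (hy : CauchySeq y) : CauchySeq x := by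
  refine Metric.cauchySeq_iff.2 fun ε hε => ?_
  obtain ⟨n, hn⟩ := Metric.cauchySeq_iff.1 hy ((ε ^ r / (K + 1)) ^ (1 / a)) (by positivity)
  refine ⟨n, fun i hi j hj => ?_⟩
  have h1 := hn i hi j hj
  rw [dist_eq_norm] at h1 ⊢
  have h2 := Real.rpow_lt_rpow (norm_nonneg _) h1 ha
  rw [← Real.rpow_mul (by positivity), one_div_mul_cancel ha.ne', Real.rpow_one,
    lt_div_iff₀ (by positivity)] at h2
  have h3 : ‖x i - x j‖ ^ r < ε ^ r := by
    have := h i j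
    have : 0 ≤ ‖y i - y j‖ ^ a := by positivity
    linarith
  exact (Real.rpow_lt_rpow_iff (norm_nonneg _) hε.le hr).1 h3

variable {N : ℕ} {Ω : Set (RN N)} {p : ℝ} [Fact (1 < p)] {ϑ a₀ : ℝ → ℝ} {chat c₀ c₁ c₂ : ℝ}

theorem W1p0.norm_le_gradL (hN : 1 ≤ N) (hb : Bornology.IsBounded Ω) :
    ∃ P > 0, ∀ u : W1p0 Ω p, ‖u‖ ≤ P * ‖W1p0.gradL Ω p u‖ := by
  have hp : 1 < p := Fact.out
  obtain ⟨J, hJ, C, hC0, hC⟩ := W1p0.exists_embedding (Ω := Ω) (p := p) hN hb hp.le rfl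
    (fun _ => by simp)
  refine ⟨C + 1, by positivity, fun u => (W1p0.norm_le u).trans ?_⟩
  have h1 : J u = W1p0.fnL Ω p u := Lp.ext (hJ u)
  have h2 := hC u
  rw [h1] at h2
  linarith

/-- A bounded sequence of `W^{1,p}_0(Ω)` has a subsequence converging in `L^r(Ω)`. -/
theorem W1p0.exists_subseq_tendsto (hN : 1 ≤ N) (hb : Bornology.IsBounded Ω)
    (hΩ : MeasurableSet Ω) {r q : ℝ} (hr : 1 < r) (hrq : r < q)
    (hpq : p < N → p⁻¹ - (N : ℝ)⁻¹ ≤ q⁻¹) [Fact (1 ≤ ENNReal.ofReal r)]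
    {J : W1p0 Ω p →L[ℝ] Lp ℝ (ENNReal.ofReal r) (volume.restrict Ω)}
    (hJ : ∀ u, J u =ᵐ[volume.restrict Ω] u.fn) {u : ℕ → W1p0 Ω p} {R : ℝ} (hR : ∀ n, ‖u n‖ ≤ R) :
    ∃ y, ∃ k : ℕ → ℕ, StrictMono k ∧ Tendsto (fun n => J (u (k n))) atTop (𝓝 y) := by
  have hR0 : 0 ≤ R := (norm_nonneg _).trans (hR 0)
  have : Fact (1 ≤ ENNReal.ofReal q) := ⟨ENNReal.one_le_ofReal.2 (by linarith)⟩
  have hadm : ∀ t, 0 < t → t ≤ q → p < N → p⁻¹ - (N : ℝ)⁻¹ ≤ t⁻¹ := fun t ht htq h =>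
    (hpq h).trans (inv_anti₀ ht htq)
  obtain ⟨J₁, hJ₁, -⟩ := W1p0.exists_embedding (Ω := Ω) (p := p) hN hb (q := 1) le_rfl
    (s := 1) (by simp) (hadm 1 one_pos (by linarith))
  obtain ⟨Jq, hJq, D, hD0, hD⟩ := W1p0.exists_embedding (Ω := Ω) (p := p) hN hb (q := q)
    (by linarith) rfl hpq
  obtain ⟨K, hK, hKs⟩ :=
    (W1p0.isCompactOperator_embedding hb hΩ J₁ hJ₁).image_closedBall_subset_compact
      (𝕜₁ := ℝ) (f := (J₁ : W1p0 Ω p →ₗ[ℝ] Lp ℝ 1 (volume.restrict Ω))) R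
  obtain ⟨y₁, -, k, hk, hlim⟩ := hK.tendsto_subseq
    (fun n => hKs ⟨u n, mem_closedBall_zero_iff.2 (hR n), rfl⟩)
  have hq1 : 0 < q - 1 := by linarith
  -- Convergence in `L¹` and boundedness in `L^q` give the Cauchy property in `L^r`, by
  -- interpolating differences.
  have hc : CauchySeq fun n => J (u (k n)) := by
    refine cauchySeq_of_norm_rpow_le (y := fun n => J₁ (u (k n))) (r := r)
      (a := (q - r) / (q - 1)) (K := ((D * (2 * R)) ^ q) ^ ((r - 1) / (q - 1))) (by linarith)
      (div_pos (by linarith) hq1) (by positivity) (fun i j => ?_) hlim.cauchySeq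
    rw [← map_sub, ← map_sub]
    set w := u (k i) - u (k j) with hw
    have hwR : ‖w‖ ≤ 2 * R := (norm_sub_le _ _).trans (by linarith [hR (k i), hR (k j)])
    refine (norm_rpow_interpolation hr hrq ((hJ₁ w).trans (hJ w).symm)
      ((hJq w).trans (hJ w).symm)).trans ?_
    have hθ : 0 ≤ (r - 1) / (q - 1) := div_nonneg (by linarith) hq1.le
    refine mul_le_mul_of_nonneg_left (Real.rpow_le_rpow (by positivity)
      (Real.rpow_le_rpow (norm_nonneg _) ?_ (by linarith)) hθ) (by positivity)
    have hg : ‖W1p0.gradL Ω p w‖ ≤ ‖w‖ := WithLp.norm_snd_le _ (w : LpPair Ω p)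
    exact (hD w).trans (mul_le_mul_of_nonneg_left (hg.trans hwR) hD0)
  obtain ⟨y, hy⟩ := cauchySeq_tendsto_of_complete hc
  exact ⟨y, k, hk, hy⟩

theorem ceramiCondition_of_isReaction (hN : 1 ≤ N) (hb : Bornology.IsBounded Ω)
    (hΩ : MeasurableSet Ω) (hϑ : IsComparison p ϑ chat c₀ c₁ c₂) (ha : HypA N p ϑ a₀) {r τ : ℝ}
    (hpr : p < r) (hrc : (r : EReal) < critExp N p) (hτ : (r - p) * max (N / p) 1 < τ)
    {g : RN N → ℝ → ℝ} {m : ℝ → ℝ} (hg : IsReaction Ω p r τ g m) :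
    CeramiCondition (energy Ω p a₀ g) := by
  have hp : 1 < p := Fact.out
  have hr : 1 < r := hp.trans hpr
  have hτ0 : 0 < τ := lt_of_le_of_lt
    (mul_nonneg (by linarith) (zero_le_one.trans (le_max_right _ _))) hτ
  have : IsFiniteMeasure (volume.restrict Ω) := ⟨by simpa using hb.measure_lt_top⟩
  obtain ⟨q, hrq, hpq, hq⟩ := exists_interpolation_exponent hp hpr hrc hτ
  have hp' := Real.HolderConjugate.conjExponent hp
  have hr' := Real.HolderConjugate.conjExponent hr
  have : Fact (1 ≤ ENNReal.ofReal p.conjExponent) := ⟨ENNReal.one_le_ofReal.2 hp'.symm.lt.le⟩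
  have : Fact (1 ≤ ENNReal.ofReal r) := ⟨ENNReal.one_le_ofReal.2 hr.le⟩
  have : Fact (1 ≤ ENNReal.ofReal r.conjExponent) := ⟨ENNReal.one_le_ofReal.2 hr'.symm.lt.le⟩
  have : Fact (1 ≤ ENNReal.ofReal q) := ⟨ENNReal.one_le_ofReal.2 (by linarith)⟩
  obtain ⟨J, hJ, -⟩ := W1p0.exists_embedding (Ω := Ω) (p := p) hN hb hr.le rfl
    (fun h => (hpq h).trans (inv_anti₀ (by linarith) hrq.le))
  obtain ⟨Jq, hJq, D, hD0, hD⟩ := W1p0.exists_embedding (Ω := Ω) (p := p) hN hb (q := q)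
    (by linarith) rfl hpq
  obtain ⟨P, hP0, hP⟩ := W1p0.norm_le_gradL (Ω := Ω) (p := p) hN hb
  have haN := ha.isNemytskii hN hϑ (volume.restrict Ω)
  refine ceramiCondition_of_uniform_monotone (haN.continuous_deriv hp')
    (hg.nemytskii.continuous_deriv hr') (energy_hasFDerivAt hN hϑ ha hp' hr' hg.nemytskii hJ) hP0
    (by linarith : 0 < p) hP (fun δ hδ => ha.norm_sub_rpow_le hN hϑ hp' hδ) (fun M hM => ?_)
    (fun u R hR => W1p0.exists_subseq_tendsto hN hb hΩ hr hrq hpq hJ hR)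
  obtain ⟨R, hR⟩ := bounded_of_energy_bounded hN hϑ ha hp' hr' hpr hτ0 hrq hq hg hD0 hM
  refine ⟨R, fun u h1 h2 => hR _ (J u) (Jq u) ((hJq _).trans (hJ _).symm) (hD _) ?_ ?_⟩
  · rwa [← energy_eq hJ]
  · rwa [← haN.deriv_apply hp', ← hg.nemytskii.deriv_apply hr']

end Final

/-! ### Measurable modifications and truncated reactions. -/

section Caratheodory

variable {N : ℕ} {Ω : Set (RN N)}

/-- Nemytskii maps are required here to be jointly measurable and continuous for every `x`. Setting
`f` to zero on a measurable null set achieves this without changing the energy. -/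
theorem IsCaratheodory.exists_measurable_modification {f : RN N → ℝ → ℝ}
    (hf : IsCaratheodory Ω f) : ∃ g : RN N → ℝ → ℝ, Measurable (Function.uncurry g) ∧
      (∀ x, Continuous (g x)) ∧ ∀ᵐ x ∂volume.restrict Ω, g x = f x := by
  classical
  set μ := volume.restrict Ω
  have hae : ∀ᵐ x ∂μ, Continuous (f x) ∧ ∀ s : ℚ, f x s = (hf.measurable s).mk _ x :=
    hf.continuous.and (ae_all_iff.2 fun s => (hf.measurable s).ae_eq_mk)
  -- Only countably many slices, those at rational `s`, are compared with measurable versions, so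
  -- the exceptional set is null. Continuity recovers the other slices as limits.
  set E := toMeasurable μ {x | ¬ (Continuous (f x) ∧ ∀ s : ℚ, f x s = (hf.measurable s).mk _ x)}
    with hE
  have hEm : MeasurableSet E := measurableSet_toMeasurable _ _
  have hE0 : μ E = 0 := by rw [hE, measure_toMeasurable]; exact hae
  have hEc : ∀ x ∉ E, Continuous (f x) ∧ ∀ s : ℚ, f x s = (hf.measurable s).mk _ x := by
    intro x hx
    by_contra h
    exact hx (subset_toMeasurable _ _ h)
  set g : RN N → ℝ → ℝ := fun x s => if x ∈ E then 0 else f x s with hg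
  have hgc : ∀ x, Continuous (g x) := by
    intro x
    by_cases hx : x ∈ E
    · simpa [hg, hx] using continuous_const
    · simpa [hg, hx] using (hEc x hx).1
  have hgQ : ∀ s : ℚ, Measurable fun x => g x s := by
    intro s
    have : (fun x => g x s) = fun x => if x ∈ E then 0 else (hf.measurable s).mk _ x := by
      funext x
      by_cases hx : x ∈ E
      · simp [hg, hx]
      · simp [hg, hx, (hEc x hx).2 s]
    rw [this]
    exact Measurable.ite hEm measurable_const (hf.measurable s).measurable_mk
  have hgm : ∀ s : ℝ, Measurable fun x => g x s := by
    intro s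
    obtain ⟨t, ht, hlim⟩ := mem_closure_iff_seq_limit.1 (Rat.denseRange_cast (𝕜 := ℝ) s)
    choose t' ht' using ht
    refine measurable_of_tendsto_metrizable (f := fun n x => g x (t n)) (fun n => ?_) ?_
    · rw [← ht' n]
      exact hgQ (t' n)
    · exact tendsto_pi_nhds.2 fun x => ((hgc x).tendsto s).comp hlim
  refine ⟨g, ?_, hgc, ?_⟩
  · exact (measurable_uncurry_of_continuous_of_measurable (u := fun s x => g x s) hgc hgm).comp
      measurable_swap
  · filter_upwards [measure_eq_zero_iff_ae_notMem.1 hE0] with x hx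
    funext s
    simp [hg, hx]

theorem energy_congr {p : ℝ} [Fact (1 < p)] {a₀ : ℝ → ℝ} {f g : RN N → ℝ → ℝ}
    (h : ∀ᵐ x ∂volume.restrict Ω, g x = f x) : energy Ω p a₀ g = energy Ω p a₀ f := by
  funext u
  rw [energy, energy]
  congr 1
  refine integral_congr_ae ?_
  filter_upwards [h] with x hx
  rw [primitiveF, primitiveF, hx]

theorem HypF.exists_growth {p c₁ r : ℝ} [Fact (1 < p)] {f : RN N → ℝ → ℝ}
    (hf : HypF Ω p c₁ r f) : ∃ A, 0 ≤ A ∧ ∀ᵐ x ∂volume.restrict Ω, ∀ s : ℝ,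
      |f x s| ≤ A * (1 + |s| ^ (r - 1)) := by
  obtain ⟨α, ⟨hα, hα0⟩, h⟩ := hf.growth
  refine ⟨(eLpNorm α ⊤ (volume.restrict Ω)).toReal, ENNReal.toReal_nonneg, ?_⟩
  have hb : ∀ᵐ x ∂volume.restrict Ω, α x ≤ (eLpNorm α ⊤ (volume.restrict Ω)).toReal := by
    rw [eLpNorm_exponent_top]
    filter_upwards [enorm_ae_le_eLpNormEssSup α (volume.restrict Ω)] with x hx
    have h1 := ENNReal.toReal_mono (by
      have := hα.2
      rw [eLpNorm_exponent_top] at this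
      exact this.ne) hx
    rw [toReal_enorm] at h1
    exact (le_abs_self _).trans h1
  filter_upwards [h, hb] with x h1 h2 s
  exact (h1 s).trans (mul_le_mul_of_nonneg_right h2 (by positivity))

theorem abs_primitiveF_le {g : RN N → ℝ → ℝ} {x : RN N} {A r s S : ℝ} (hA : 0 ≤ A) (hr : 1 ≤ r)
    (h : ∀ s : ℝ, |g x s| ≤ A * (1 + |s| ^ (r - 1))) (hs : |s| ≤ S) :
    |primitiveF g x s| ≤ A * (1 + S ^ (r - 1)) * S := by
  have hS : 0 ≤ S := (abs_nonneg s).trans hs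
  have h1 : ‖∫ t in (0 : ℝ)..s, g x t‖ ≤ A * (1 + S ^ (r - 1)) * |s - 0| := by
    refine intervalIntegral.norm_integral_le_of_norm_le_const fun t ht => ?_
    have ht' : |t| ≤ S := by
      have := abs_sub_left_of_mem_uIcc (uIoc_subset_uIcc ht)
      rw [sub_zero, sub_zero] at this
      exact this.trans hs
    refine (h t).trans (mul_le_mul_of_nonneg_left ?_ hA)
    have := Real.rpow_le_rpow (abs_nonneg t) ht' (by linarith : 0 ≤ r - 1)
    linarith
  rw [sub_zero] at h1
  exact h1.trans (mul_le_mul_of_nonneg_left hs (by positivity))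

/-- For large `|s|` half of `β₀` survives; for `|s| ≤ S` the growth bound controls both terms, which
fixes the constant `C`. -/
theorem HypF.exists_lower {p c₁ r : ℝ} [Fact (1 < p)] {f : RN N → ℝ → ℝ} (hf : HypF Ω p c₁ r f) :
    ∃ τ, (r - p) * max (N / p) 1 < τ ∧ ∃ β > 0, ∃ C, ∀ᵐ x ∂volume.restrict Ω, ∀ s : ℝ,
      β * |s| ^ τ - C ≤ f x s * s - p * primitiveF f x s := by
  have hp : 1 < p := Fact.out
  have hpr := hf.p_lt_r
  obtain ⟨τ, hτ, -, β₀, hβ₀, h⟩ := hf.quasi_superlinear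
  obtain ⟨A, hA0, hA⟩ := hf.exists_growth
  obtain ⟨S, hS, hq⟩ := h (β₀ / 2) (by positivity)
  have hτ0 : 0 < τ := lt_of_le_of_lt
    (mul_nonneg (by linarith) (zero_le_one.trans (le_max_right _ _))) hτ
  set B := A * (1 + S ^ (r - 1)) * S with hB
  have hB0 : 0 ≤ B := by positivity
  refine ⟨τ, hτ, β₀ / 2, by positivity, (1 + p) * B + β₀ / 2 * S ^ τ, ?_⟩
  filter_upwards [hA, hq] with x hAx hqx s
  have hSτ : 0 ≤ β₀ / 2 * S ^ τ := by positivity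
  rcases le_total S |s| with hs | hs
  · have h1 := hqx s hs
    have hs0 : 0 < |s| ^ τ := Real.rpow_pos_of_pos (hS.trans_le hs) _
    rw [le_div_iff₀ hs0] at h1
    have : 0 ≤ (1 + p) * B := by positivity
    have h2 : (β₀ - β₀ / 2) * |s| ^ τ = β₀ / 2 * |s| ^ τ := by ring
    linarith
  · have h1 := abs_le.1 (abs_primitiveF_le hA0 (by linarith) hAx hs)
    have h2 : |f x s * s| ≤ B := by
      rw [abs_mul]
      refine mul_le_mul ((hAx s).trans (mul_le_mul_of_nonneg_left ?_ hA0)) hs (abs_nonneg _)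
        (by positivity)
      have := Real.rpow_le_rpow (abs_nonneg s) hs (by linarith : 0 ≤ r - 1)
      linarith
    have h3 : β₀ / 2 * |s| ^ τ ≤ β₀ / 2 * S ^ τ :=
      mul_le_mul_of_nonneg_left (Real.rpow_le_rpow (abs_nonneg s) hs hτ0.le) (by positivity)
    have h4 := (abs_le.1 h2).1
    have h5 : p * primitiveF f x s ≤ p * B := mul_le_mul_of_nonneg_left h1.2 (by linarith)
    linarith

/-- A truncation: on each segment `[0, s]` either the identity or zero. -/
structure IsTruncation (ρ : ℝ → ℝ) : Prop where
  continuous : Continuous ρ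
  eq_or : ∀ s, (∀ t ∈ uIcc 0 s, ρ t = t) ∨ ∀ t ∈ uIcc 0 s, ρ t = 0

theorem IsTruncation.abs_le {ρ : ℝ → ℝ} (hρ : IsTruncation ρ) (s : ℝ) : |ρ s| ≤ |s| := by
  rcases hρ.eq_or s with h | h
  · rw [h s right_mem_uIcc]
  · rw [h s right_mem_uIcc, abs_zero]; exact abs_nonneg s

theorem isTruncation_id : IsTruncation fun s => s := ⟨continuous_id, fun _ => Or.inl fun _ _ => rfl⟩

theorem isTruncation_pos : IsTruncation fun s => max s 0 := by
  refine ⟨continuous_id.max continuous_const, fun s => ?_⟩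
  rcases le_total 0 s with h | h
  · left; intro t ht; rw [uIcc_of_le h] at ht; exact max_eq_left ht.1
  · right; intro t ht; rw [uIcc_of_ge h] at ht; exact max_eq_right ht.2

theorem isTruncation_neg : IsTruncation fun s => -max (-s) 0 := by
  refine ⟨(continuous_neg.max continuous_const).neg, fun s => ?_⟩
  rcases le_total 0 s with h | h
  · right; intro t ht; rw [uIcc_of_le h] at ht
    rw [max_eq_right (by linarith [ht.1]), neg_zero]
  · left; intro t ht; rw [uIcc_of_ge h] at ht
    rw [max_eq_left (by linarith [ht.2]), neg_neg]

/-- On the segment from `0` to `s` the truncation is either the identity, or zero with integrand `g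
x 0 = 0`. -/
theorem IsTruncation.primitiveF_eq {ρ : ℝ → ℝ} (hρ : IsTruncation ρ) {g : RN N → ℝ → ℝ} {x : RN N}
    (h0 : g x 0 = 0) (s : ℝ) :
    primitiveF (fun x s => g x (ρ s)) x s = primitiveF g x (ρ s) := by
  rcases hρ.eq_or s with h | h
  · rw [h s right_mem_uIcc]
    exact intervalIntegral.integral_congr fun t ht => by simp only [h t ht]
  · rw [h s right_mem_uIcc, primitiveF, primitiveF, intervalIntegral.integral_same]
    rw [intervalIntegral.integral_congr (g := fun _ => (0 : ℝ))
      fun t ht => by simp only [h t ht, h0]]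
    simp

/-- With gauge `|ρ s|`, the identity `g(x, ρ s) s = g(x, ρ s) ρ s` and the formula for the primitive
reduce every bound to the bounds on `f` at `ρ s`. -/
theorem HypF.ceramiCondition_truncation (hN : 1 ≤ N) (hΩ : IsBoundedC2Domain Ω) {p : ℝ}
    [Fact (1 < p)] {ϑ : ℝ → ℝ} {chat c₀ c₁ c₂ : ℝ} (hϑ : IsComparison p ϑ chat c₀ c₁ c₂)
    {a₀ : ℝ → ℝ} (ha : HypA N p ϑ a₀) {r : ℝ} {f : RN N → ℝ → ℝ} (hf : HypF Ω p c₁ r f)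
    {ρ : ℝ → ℝ} (hρ : IsTruncation ρ) :
    CeramiCondition (energy Ω p a₀ fun x s => f x (ρ s)) := by
  have hp : 1 < p := Fact.out
  have hpr := hf.p_lt_r
  obtain ⟨g, hgm, hgc, hgf⟩ := hf.caratheodory.exists_measurable_modification
  obtain ⟨A, hA0, hA⟩ := hf.exists_growth
  obtain ⟨τ, hτ, β, hβ, C, hC⟩ := hf.exists_lower
  have hcongr : ∀ᵐ x ∂volume.restrict Ω, (fun s => g x (ρ s)) = fun s => f x (ρ s) := by
    filter_upwards [hgf] with x hx
    rw [hx]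
  rw [← energy_congr (g := fun x s => g x (ρ s)) hcongr]
  have hmul : ∀ x, g x 0 = 0 → ∀ s, g x (ρ s) * s = g x (ρ s) * ρ s := by
    intro x hx s
    rcases hρ.eq_or s with h | h
    · rw [h s right_mem_uIcc]
    · rw [h s right_mem_uIcc, hx, zero_mul, zero_mul]
  refine ceramiCondition_of_isReaction hN hΩ.isBounded hΩ.isOpen.measurableSet hϑ ha hpr
    hf.r_lt_crit hτ (m := fun s => |ρ s|) ⟨⟨?_, fun x => (hgc x).comp hρ.continuous, A, ?_⟩,
      hρ.continuous.abs.measurable, fun s => abs_nonneg _, hρ.abs_le,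
      ⟨2 * A, by positivity, ?_⟩, β, hβ, C, ?_⟩
  · exact hgm.comp (measurable_fst.prodMk (hρ.continuous.measurable.comp measurable_snd))
  · filter_upwards [hA, hgf] with x hx hgx s
    rw [hgx, Real.norm_eq_abs, Real.norm_eq_abs]
    refine (hx _).trans (mul_le_mul_of_nonneg_left ?_ hA0)
    have := Real.rpow_le_rpow (abs_nonneg _) (hρ.abs_le s) (by linarith : 0 ≤ r - 1)
    linarith
  · filter_upwards [hA, hgf, hf.zero] with x hx hgx h0 s
    rw [hmul x (by rw [hgx, h0]), hgx]
    set y := |ρ s| with hy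
    have hy0 : 0 ≤ y := abs_nonneg _
    have h1 : f x (ρ s) * ρ s ≤ A * (1 + y ^ (r - 1)) * y := by
      refine (le_abs_self _).trans ?_
      rw [abs_mul]
      exact mul_le_mul_of_nonneg_right (hx _) hy0
    have h2 : y ^ (r - 1) * y = y ^ r := by
      rw [← Real.rpow_add_one' hy0 (by linarith)]; congr 1; ring
    have h3 : y ≤ 1 + y ^ r := by
      rcases le_total y 1 with h | h
      · have := Real.rpow_nonneg hy0 r; linarith
      · have := Real.self_le_rpow_of_one_le h (by linarith : 1 ≤ r); linarith
    calc _ ≤ _ := h1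
      _ = A * (y + y ^ r) := by rw [← h2]; ring
      _ ≤ A * (2 * (1 + y ^ r)) := mul_le_mul_of_nonneg_left (by linarith) hA0
      _ = _ := by ring
  · filter_upwards [hC, hgf, hf.zero] with x hx hgx h0 s
    have hg0 : g x 0 = 0 := by rw [hgx, h0]
    rw [hmul x hg0, hρ.primitiveF_eq hg0]
    have : primitiveF g x = primitiveF f x := by
      funext s; rw [primitiveF, primitiveF, hgx]
    rw [this, hgx]
    exact hx (ρ s)

end Caratheodory

end

theorem mainTheorem5 {N : ℕ} (hN : 1 ≤ N) (Ω : Set (RN N)) (hΩ : IsBoundedC2Domain Ω)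
    (p : ℝ) [Fact (1 < p)]
    (ϑ : ℝ → ℝ) (chat c₀ c₁ c₂ : ℝ) (hϑ : IsComparison p ϑ chat c₀ c₁ c₂)
    (a₀ : ℝ → ℝ) (ha : HypA N p ϑ a₀)
    (r : ℝ) (f : RN N → ℝ → ℝ) (hf : HypF Ω p c₁ r f) :
    CeramiCondition (energy Ω p a₀ f) ∧
      CeramiCondition (energy Ω p a₀ (truncPos f)) ∧
      CeramiCondition (energy Ω p a₀ (truncNeg f)) :=
  ⟨hf.ceramiCondition_truncation hN hΩ hϑ ha isTruncation_id,
    hf.ceramiCondition_truncation hN hΩ hϑ ha isTruncation_pos,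
    hf.ceramiCondition_truncation hN hΩ hϑ ha isTruncation_neg⟩
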